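/- Let $\mathbb R^\infty$ be a real vector space of countably infinite dimension with a positive definite inner product, let $k$ be a commutative ring, and let $V,W$ denote finite-dimensional linear subspaces of $\mathbb R^\infty$. For $V\perp W$ write $V\times W=V+W$, and $P\times Q=\{x+y: x\in P,\,y\in Q\}$ for $P\subset V$, $Q\subset W$. **Cones and polytopes.** A *convex cone* is the set of nonnegative linear combinations of finitely many vectors; a *cone* is a finite union (possibly empty) of convex cones. A *convex polytope* is the convex hull of a nonempty finite set; a *polytope* is a finite union (possibly empty) of convex polytopes. A *(conical) cell structure* on a polytope (cone) $P$ is a finite set of convex polytopes (convex cones), the *cells*, with union $P$, such that every face of a cell (subset where a linear function is maximized) is a union of cells and no point lies in the relative interiors of two different cells. A function $f$ of the cones (polytopes) in $V$ is a *valuation* if $f(\emptyset)=0$ and $f(P\cup Q)=f(P)+f(Q)-f(P\cap Q)$; one writes $f(\operatorname{int}\sigma)=f(\sigma)-f(\partial\sigma)$ for a cell $\sigma$, where $\operatorname{int}$ is the relative interior and $\partial\sigma=\sigma\setminus\operatorname{int}\sigma$. **Invariants.** An *object* is a function $V\mapsto O_V\in k$ with $O_0=1$ and $O_{V\times W}=O_VO_W$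 whenever $V\perp W$. A *morphism* is a family $F=\{F_V\}$ of $k$-valued valuations of the cones in $V$ with $F_0(0)=1$ and $F_{V\times W}(P\times Q)=F_V(P)F_W(Q)$ whenever $V\perp W$. A *multiplicative polytope invariant* is a family $G=\{G_V\}$ of $k$-valued valuations of the polytopes in $V$, each invariant under translations in $V$, with the same two multiplicativity conditions. The *source*, *target* and *location* are the objects $s(F)_V=F_V(V)$, $t(F)_V=F_V(0)$, $p(G)_V=G_V(\text{point})$. **The $\star$-product.** For a cell $\sigma$ of a cell structure of $P\subset V$, let $\langle\sigma\rangle$ be the linear subspace parallel to the affine span of $\sigma$, let $\sigma^\perp$ be the orthogonal complement of $\langle\sigma\rangle$ in $V$, and let the normal cone $\nu(\sigma,P)\subset\sigma^\perp$ be the set of all $w\in\sigma^\perp$ such that $x+tw\in P$ for all sufficiently small $t>0$, where $x$ is a point of $\operatorname{int}\sigma$. If $F$ is a morphism and $G$ is a morphism with $s(F)=t(G)$ (respectively a multiplicative polytope invariant with $s(F)=p(G)$), put, for a cone (respectively polytope) $P\subset V$, $$(F\star G)_V(P)=\sum_{\sigma}F_{\sigma^\perp}(\nu(\sigma,P))\cdot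 G_{\langle\sigma\rangle}(\operatorname{int}\sigma),$$ the sum being over the cells $\sigma$ of a (conical) cell structure of $P$; in the polytope case $\sigma$ is first translated into $\langle\sigma\rangle$. **Theorem.** 1. Every cone (polytope) has a conical cell structure (cell structure), whose cells have nonempty relative interiors. The sum does not depend on the cell structure or on the points $x\in\operatorname{int}\sigma$, and it defines a morphism (respectively a multiplicative polytope invariant) $F\star G$. 2. The objects, together with the morphisms $F$ viewed as arrows from $s(F)$ to $t(F)$, form a groupoid in which the composition of $F$ with $G$ (first $G$, then $F$) is $F\star G$. In particular $s(F\star G)=s(G)$, $t(F\star G)=t(F)$, and $\star$ is associative. The identity of an object $O$ is the morphism $1_O=O\bullet\epsilon$ with $(1_O)_V(P)=O_V$ for every nonempty cone $P\subset V$. The inverse of $F$ is the morphism $FD$ with $(FD)_V(P)=F_V(D_VP)$ for every convex cone $P\subset V$, where $D_VP=\{w\in V:\langle w,x\rangle\le 0\text{ for all }x\in P\}$. 3. The groupoid acts by $\star$ on the multiplicative polytope invariants: $p(F\star G)=t(F)$ if $s(F)=p(G)$; $1_{p(G)}\star G=G$; and $(F\star G)\star H=F\star(G\star H)$ for morphisms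 $F,G$ and a multiplicative polytope invariant $H$ with $s(F)=t(G)$ and $s(G)=p(H)$. -/

import Mathlib

open Filter Topology CategoryTheory
open scoped Pointwise

universe u v

/-! ### Convex cones, cones, convex polytopes, polytopes -/

section Sets

variable {E : Type u} [NormedAddCommGroup E] [InnerProductSpace ℝ E]

/-- A convex cone: the set of all nonnegative linear combinations of finitely many vectors. -/
def IsConvexCone (P : Set E) : Prop :=
  ∃ C : PointedCone ℝ E, C.FG ∧ P = (C : Set E)

/-- A cone: a finite union of convex cones (the empty union is allowed). -/
def IsCone (P : Set E) : Prop :=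
  ∃ T : Finset (Set E), (∀ C ∈ T, IsConvexCone C) ∧ P = ⋃₀ (T : Set (Set E))

/-- `P` is a cone in the finite-dimensional subspace `V`. -/
def IsConeIn (V : Submodule ℝ E) (P : Set E) : Prop :=
  FiniteDimensional ℝ V ∧ IsCone P ∧ P ⊆ (V : Set E)

/-- A nonempty convex polytope: the convex hull of a nonempty finite set of points. -/
def IsConvexPolytope (P : Set E) : Prop :=
  ∃ s : Finset E, s.Nonempty ∧ P = convexHull ℝ (s : Set E)

/-- A polytope (compact PL subspace): a finite union of convex polytopes; it need not be convex and
may be empty. -/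
def IsPolytope (P : Set E) : Prop :=
  ∃ T : Finset (Set E), (∀ C ∈ T, IsConvexPolytope C) ∧ P = ⋃₀ (T : Set (Set E))

/-- `P` is a polytope in the finite-dimensional subspace `V`. -/
def IsPolytopeIn (V : Submodule ℝ E) (P : Set E) : Prop :=
  FiniteDimensional ℝ V ∧ IsPolytope P ∧ P ⊆ (V : Set E)

/-- The dual `D_V P` of `P` in `V`. -/
def dualCone (V : Submodule ℝ E) (P : Set E) : Set E :=
  {w | w ∈ V ∧ ∀ x ∈ P, inner ℝ w x ≤ 0}

/-! ### Cell structures and normal cones -/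

/-- A finite set `K` of cells (of the kind prescribed by `IsCell`) such that every face of every
cell is a union of cells, no point lies in the interior of more than one cell, and the union of all
cells is `P`. Interiors are relative interiors; faces are the subsets where a linear function is
maximized. -/
structure IsCellStructure (IsCell : Set E → Prop) (K : Finset (Set E)) (P : Set E) : Prop where
  cell : ∀ σ ∈ K, IsCell σ
  face : ∀ σ ∈ K, ∀ τ : Set E, IsExposed ℝ σ τ → ∃ L ⊆ K, τ = ⋃₀ (L : Set (Set E))
  eq_of_mem_interior : ∀ σ ∈ K, ∀ τ ∈ K, ∀ x : E,
    x ∈ intrinsicInterior ℝ σ → x ∈ intrinsicInterior ℝ τ → σ = τ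
  union : P = ⋃₀ (K : Set (Set E))

/-- A conical cell structure on the cone `P`. -/
abbrev IsConicalCellStructure (K : Finset (Set E)) (P : Set E) : Prop :=
  IsCellStructure IsConvexCone K P

/-- A cell structure on the polytope `P`. -/
abbrev IsPolytopeCellStructure (K : Finset (Set E)) (P : Set E) : Prop :=
  IsCellStructure IsConvexPolytope K P

/-- A choice of a point `b σ` in the (relative) interior of each cell `σ` of `K`. -/
def IsBasePoint (K : Finset (Set E)) (b : Set E → E) : Prop :=
  ∀ σ ∈ K, b σ ∈ intrinsicInterior ℝ σ

/-- The orthogonal complement in `V` of the linear subspace parallel to the affine span of `σ`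
(for a convex cone this linear subspace is just the span). -/
noncomputable def perpIn (V : Submodule ℝ E) (σ : Set E) : Submodule ℝ E :=
  V ⊓ (vectorSpan ℝ σ)ᗮ

/-- The normal cone `ν(σ, P)`, computed at the point `x` of the interior of `σ`: the cone in
`perpIn V σ` that has the same germ at `0` as the part of `P - x` lying in `perpIn V σ`, that is,
the set of all `w` such that `x + t w ∈ P` for all small `t > 0`. -/
def normalCone (V : Submodule ℝ E) (P σ : Set E) (x : E) : Set E :=
  {w | w ∈ perpIn V σ ∧ ∀ᶠ t : ℝ in 𝓝[>] 0, x + t • w ∈ P}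

/-! ### Elementary facts on cones and polytopes -/

theorem IsConvexCone.isCone {P : Set E} (h : IsConvexCone P) : IsCone P :=
  ⟨{P}, by simpa using h, by simp⟩

theorem isConvexCone_submodule (V : Submodule ℝ E) [FiniteDimensional ℝ V] :
    IsConvexCone (V : Set E) := by
  obtain ⟨s, hs⟩ := (Submodule.fg_top V).1 (Module.Finite.fg_top (R := ℝ) (M := V))
  have hV : Submodule.span ℝ (s : Set E) = V := hs
  classical
  refine ⟨PointedCone.hull ℝ ((s : Set E) ∪ -(s : Set E)),
    Submodule.fg_span (s.finite_toSet.union s.finite_toSet.neg), ?_⟩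
  apply Set.Subset.antisymm
  · intro x hx
    rw [SetLike.mem_coe, ← hV] at hx
    have hneg : ∀ y ∈ PointedCone.hull ℝ ((s : Set E) ∪ -(s : Set E)),
        -y ∈ PointedCone.hull ℝ ((s : Set E) ∪ -(s : Set E)) := by
      intro y hy
      induction hy using Submodule.span_induction with
      | mem y hy =>
        refine Submodule.subset_span ?_
        rcases hy with hy | hy
        · right; simpa using hy
        · left; simpa using hy
      | zero => simp
      | add y z _ _ hy hz => rw [neg_add]; exact Submodule.add_mem _ hy hz
      | smul c y _ hy => rw [← smul_neg]; exact Submodule.smul_mem _ c hy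
    rw [SetLike.mem_coe]
    induction hx using Submodule.span_induction with
    | mem y hy => exact Submodule.subset_span (Or.inl hy)
    | zero => exact Submodule.zero_mem _
    | add y z _ _ hy hz => exact Submodule.add_mem _ hy hz
    | smul c y _ hy =>
      rcases le_total 0 c with hc | hc
      · exact Submodule.smul_mem _ (⟨c, hc⟩ : {c : ℝ // 0 ≤ c}) hy
      · have := Submodule.smul_mem _ (⟨-c, neg_nonneg.2 hc⟩ : {c : ℝ // 0 ≤ c}) (hneg y hy)
        have h2 : (⟨-c, neg_nonneg.2 hc⟩ : {c : ℝ // 0 ≤ c}) • (-y) = c • y := by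
          change (-c) • (-y) = c • y
          simp
        rwa [h2] at this
  · intro x hx
    have hle : PointedCone.hull ℝ ((s : Set E) ∪ -(s : Set E)) ≤ PointedCone.ofSubmodule V := by
      refine Submodule.span_le.2 ?_
      rintro y (hy | hy)
      · exact (hV ▸ Submodule.subset_span hy : y ∈ V)
      · have h3 : -y ∈ V := hV ▸ Submodule.subset_span (show -y ∈ (s : Set E) from hy)
        exact (neg_mem_iff.1 h3 : y ∈ V)
    exact hle hx

theorem isConeIn_self (V : Submodule ℝ E) [hV : FiniteDimensional ℝ V] :
    IsConeIn V (V : Set E) :=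
  ⟨hV, (isConvexCone_submodule V).isCone, subset_rfl⟩

theorem isConeIn_zero (V : Submodule ℝ E) [hV : FiniteDimensional ℝ V] :
    IsConeIn V ({0} : Set E) :=
  ⟨hV, by simpa using (isConvexCone_submodule (⊥ : Submodule ℝ E)).isCone, by simp⟩

theorem isPolytopeIn_zero (V : Submodule ℝ E) [hV : FiniteDimensional ℝ V] :
    IsPolytopeIn V ({0} : Set E) :=
  ⟨hV, ⟨{{0}}, by simpa using ⟨{0}, by simp⟩, by simp⟩, by simp⟩

end Sets

/-! ### Objects, morphisms, multiplicative polytope invariants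

Here `E` plays the role of `ℝ^∞`. A function of the finite-dimensional subspaces of `E` is encoded
as a function of all subspaces that vanishes on the infinite-dimensional ones; a family of functions
of the cones (polytopes) in finite-dimensional subspaces is encoded as a function of all pairs
`(V, P)` that vanishes unless `P` is a cone (polytope) in the finite-dimensional subspace `V`. In
this way two such families are equal as soon as they agree on the actual cones (polytopes).

For orthogonal `V` and `W`, the product `V × W` is `V ⊔ W`, and `P × Q` is the set `P + Q` of all
sums `x + y` with `x ∈ P` and `y ∈ Q`. -/

section Invariants

variable (E : Type u) [NormedAddCommGroup E] [InnerProductSpace ℝ E] (k : Type v) [CommRing k]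

/-- A `k`-valued object: a multiplicative function of finite-dimensional subspaces. -/
@[ext] structure VectObj where
  toFun : Submodule ℝ E → k
  junk : ∀ V : Submodule ℝ E, ¬ FiniteDimensional ℝ V → toFun V = 0
  map_prod : ∀ V W : Submodule ℝ E, FiniteDimensional ℝ V → FiniteDimensional ℝ W → V ⟂ W →
    toFun (V ⊔ W) = toFun V * toFun W
  map_bot : toFun ⊥ = 1

/-- A `k`-valued morphism: a multiplicative family of valuations of cones. -/
@[ext] structure ConeMor where
  toFun : Submodule ℝ E → Set E → k
  junk : ∀ V P, ¬ IsConeIn V P → toFun V P = 0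
  map_empty : ∀ V : Submodule ℝ E, FiniteDimensional ℝ V → toFun V ∅ = 0
  map_union : ∀ V P Q, IsConeIn V P → IsConeIn V Q →
    toFun V (P ∪ Q) = toFun V P + toFun V Q - toFun V (P ∩ Q)
  map_prod : ∀ V W P Q, V ⟂ W → IsConeIn V P → IsConeIn W Q →
    toFun (V ⊔ W) (P + Q) = toFun V P * toFun W Q
  map_zero : toFun ⊥ {0} = 1

/-- A `k`-valued multiplicative polytope invariant: a multiplicative family of translation-invariant
valuations of polytopes. -/
@[ext] structure PolyInv where
  toFun : Submodule ℝ E → Set E → k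
  junk : ∀ V P, ¬ IsPolytopeIn V P → toFun V P = 0
  map_empty : ∀ V : Submodule ℝ E, FiniteDimensional ℝ V → toFun V ∅ = 0
  map_union : ∀ V P Q, IsPolytopeIn V P → IsPolytopeIn V Q →
    toFun V (P ∪ Q) = toFun V P + toFun V Q - toFun V (P ∩ Q)
  map_translate : ∀ V P, IsPolytopeIn V P → ∀ x ∈ V, toFun V (x +ᵥ P) = toFun V P
  map_prod : ∀ V W P Q, V ⟂ W → IsPolytopeIn V P → IsPolytopeIn W Q →
    toFun (V ⊔ W) (P + Q) = toFun V P * toFun W Q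
  map_zero : toFun ⊥ {0} = 1

variable {E k}

/-- The source `s(F)_V = F_V(V)`. -/
def ConeMor.source (F : ConeMor E k) : VectObj E k where
  toFun V := F.toFun V (V : Set E)
  junk V hV := F.junk V _ fun h => hV h.1
  map_prod V W hV hW h := by
    rw [Submodule.coe_sup]
    exact F.map_prod V W _ _ h (isConeIn_self V) (isConeIn_self W)
  map_bot := by simpa using F.map_zero

/-- The target `t(F)_V = F_V(0)`. -/
def ConeMor.target (F : ConeMor E k) : VectObj E k where
  toFun V := F.toFun V {0}
  junk V hV := F.junk V _ fun h => hV h.1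
  map_prod V W hV hW h := by
    simpa using F.map_prod V W _ _ h (isConeIn_zero V) (isConeIn_zero W)
  map_bot := F.map_zero

/-- The location `p(G)_V = G_V(point)`. -/
def PolyInv.location (G : PolyInv E k) : VectObj E k where
  toFun V := G.toFun V {0}
  junk V hV := G.junk V _ fun h => hV h.1
  map_prod V W hV hW h := by
    simpa using G.map_prod V W _ _ h (isPolytopeIn_zero V) (isPolytopeIn_zero W)
  map_bot := G.map_zero

/-- The set `Hom(A, B)` of the morphisms with source `A` and target `B`. -/
def HomSet (A B : VectObj E k) : Type (max u v) :=
  {F : ConeMor E k // F.source = A ∧ F.target = B}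

/-- The set of the multiplicative polytope invariants located at `A`. -/
def LocatedAt (A : VectObj E k) : Type (max u v) :=
  {G : PolyInv E k // G.location = A}

/-! ### The star product -/

/-- The sum over the cells `σ` of `F_{σ^⊥}(ν(σ, P)) * G_σ(int σ)`, for cones. Here `G_σ(int σ)` is
the value at `int σ = σ - ∂σ` of the extension of the valuation `G_σ` to differences of cones. -/
noncomputable def coneStarSum (F G : ConeMor E k) (V : Submodule ℝ E) (P : Set E)
    (K : Finset (Set E)) (b : Set E → E) : k :=
  ∑ σ ∈ K, F.toFun (perpIn V σ) (normalCone V P σ (b σ)) *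
    (G.toFun (vectorSpan ℝ σ) σ - G.toFun (vectorSpan ℝ σ) (σ \ intrinsicInterior ℝ σ))

/-- The sum over the cells `σ` of `F_{σ^⊥}(ν(σ, P)) * G_σ(int σ)`, for polytopes. Each cell is
translated by `-b σ` into the linear subspace parallel to its affine span. -/
noncomputable def polyStarSum (F : ConeMor E k) (G : PolyInv E k) (V : Submodule ℝ E) (P : Set E)
    (K : Finset (Set E)) (b : Set E → E) : k :=
  ∑ σ ∈ K, F.toFun (perpIn V σ) (normalCone V P σ (b σ)) *
    (G.toFun (vectorSpan ℝ σ) (-b σ +ᵥ σ) -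
      G.toFun (vectorSpan ℝ σ) (-b σ +ᵥ (σ \ intrinsicInterior ℝ σ)))

/-- `H = F ⋆ G`: the value of `H` on each cone `P` is given by the star sum, whatever conical cell
structure of `P` and whatever points in the interiors of the cells are used to compute it. -/
def IsConeStar (F G H : ConeMor E k) : Prop :=
  ∀ (V : Submodule ℝ E) (P : Set E), IsConeIn V P →
    ∀ (K : Finset (Set E)) (b : Set E → E), IsConicalCellStructure K P → IsBasePoint K b →
      H.toFun V P = coneStarSum F G V P K b

/-- `H = F ⋆ G` for a morphism `F` and a polytope invariant `G`: the value of `H` on each polytope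
`P` is given by the star sum, whatever cell structure of `P` and whatever points in the interiors of
the cells are used to compute it. -/
def IsPolyStar (F : ConeMor E k) (G H : PolyInv E k) : Prop :=
  ∀ (V : Submodule ℝ E) (P : Set E), IsPolytopeIn V P →
    ∀ (K : Finset (Set E)) (b : Set E → E), IsPolytopeCellStructure K P → IsBasePoint K b →
      H.toFun V P = polyStarSum F G V P K b

end Invariants

/-! Cones and polytopes are handled together: `IsCellKind` collects what is needed of the cells, and
`IsValFam` what is needed of the second factor `g`, whose arguments may lie in a translate of the
subspace. The geometry rests on the fact that cells are finite intersections of half-spaces. A ray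
that starts in a cell eventually stays in one open cell, so near a point everything is determined by
the cells that contain the point. Common refinements come from hyperplane arrangements
(`exists_complex_signCell`).

Independence of the cell structure is a cancellation. If an open cell int ρ of a subdivision lies in
int σ, then ν(ρ,P) is the product of ν(σ,P) and the linear space W = ⟨σ⟩ ∩ ρ^⊥
(`Adapted.map_normalCone`), so F acquires the extra factor F_W(W). Since s(F) = t(G), this factor
equals G_W(0), and it turns G_⟨ρ⟩(int ρ) into G_⟨σ⟩(int ρ). Additivity of G then adds up the terms
of these ρ to the term of σ (`starOn_subdivision`). On a complex adapted to P and Q the valuation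
property holds term by term (`starVal_union`), and products of complexes give multiplicativity
(`starVal_add`).

Associativity compares two double sums. The cones ν(σ,τ), for the cells τ ⊇ σ in P, form a cell
structure of ν(σ,P), and the normal cone of ν(σ,P) at ν(σ,τ) is ν(τ,P) (`normalCone_normalCone`).
Hence both triple products equal the sum of F(ν(τ,P)) G(int ν(σ,τ)) H(int σ) over the pairs σ ⊆ τ
(`starVal_assoc`).

For the inverse, P ↦ F_V(D_V P) has to be extended from convex cones to a valuation of all cones. It
is additive under cuts by hyperplanes, because duality exchanges the union and the intersection of
the two halves. Such a function respects every linear relation between indicator functions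
(`IsCutAdditive.sum_eq_zero`), hence extends. Finally, for convex P let N(σ) be the dual of ν(σ,P).
The set N(σ) × int σ consists of the points of V whose nearest point in P lies in int σ, so these
sets partition V, and (FD ⋆ F)_V(P) = F_V(V) (`starVal_dual_left`). The other inverse law follows as
D is an involution. -/

/-! ### Polyhedra -/

section Polyhedra

variable {E : Type u} [NormedAddCommGroup E] [InnerProductSpace ℝ E]

/-- An intersection of finitely many closed half-spaces with the subspace `V`. -/
def IsPolyhedronIn (V : Submodule ℝ E) (P : Set E) : Prop :=
  ∃ S : Set (StrongDual ℝ E × ℝ), S.Finite ∧ P = {x | x ∈ V ∧ ∀ p ∈ S, p.1 x ≤ p.2}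

/-- One step of Fourier-Motzkin elimination. -/
theorem exists_le_mul_iff {ι : Type*} {S : Set ι} (hS : S.Finite) (c d : ι → ℝ) :
    (∃ t, ∀ i ∈ S, c i ≤ t * d i) ↔
      (∀ i ∈ S, d i = 0 → c i ≤ 0) ∧
        ∀ i ∈ S, ∀ j ∈ S, 0 < d i → d j < 0 → c j * d i ≤ c i * d j := by
  constructor
  · rintro ⟨t, ht⟩
    refine ⟨fun i hi h => by simpa [h] using ht i hi, fun i hi j hj hdi hdj => ?_⟩
    have h1 := mul_le_mul_of_nonneg_right (ht j hj) hdi.le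
    have h2 := mul_le_mul_of_nonpos_right (ht i hi) hdj.le
    nlinarith
  · rintro ⟨h0, h1⟩
    -- Positive `d i` give lower bounds for `t`, negative ones upper bounds. Take the largest lower
    -- bound, or the smallest upper bound if there are no lower bounds.
    have key : ∃ t, (∀ i ∈ S, 0 < d i → c i / d i ≤ t) ∧ ∀ j ∈ S, d j < 0 → t ≤ c j / d j := by
      have hle : ∀ i ∈ S, ∀ j ∈ S, 0 < d i → d j < 0 → c i / d i ≤ c j / d j := by
        intro i hi j hj hdi hdj
        rw [div_le_iff₀ hdi, div_mul_eq_mul_div, le_div_iff_of_neg hdj]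
        exact h1 i hi j hj hdi hdj
      have hfL : {i ∈ S | 0 < d i}.Finite := hS.subset fun _ h => h.1
      have hfU : {i ∈ S | d i < 0}.Finite := hS.subset fun _ h => h.1
      rcases {i ∈ S | 0 < d i}.eq_empty_or_nonempty with hL | hL
      · rcases {i ∈ S | d i < 0}.eq_empty_or_nonempty with hU | hU
        · exact ⟨0, fun i hi h => absurd (show i ∈ {i ∈ S | 0 < d i} from ⟨hi, h⟩) (by simp [hL]),
            fun i hi h => absurd (show i ∈ {i ∈ S | d i < 0} from ⟨hi, h⟩) (by simp [hU])⟩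
        · obtain ⟨j, -, hm⟩ := Set.exists_min_image _ (fun i => c i / d i) hfU hU
          exact ⟨c j / d j, fun i hi h =>
            absurd (show i ∈ {i ∈ S | 0 < d i} from ⟨hi, h⟩) (by simp [hL]),
            fun i hi h => hm i ⟨hi, h⟩⟩
      · obtain ⟨i, hi, hm⟩ := Set.exists_max_image _ (fun i => c i / d i) hfL hL
        exact ⟨c i / d i, fun j hj h => hm j ⟨hj, h⟩, fun j hj h => hle i hi.1 j hj hi.2 h⟩
    obtain ⟨t, ht1, ht2⟩ := key
    refine ⟨t, fun i hi => ?_⟩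
    rcases lt_trichotomy (d i) 0 with h | h | h
    · exact (le_div_iff_of_neg h).1 (ht2 i hi h)
    · simpa [h] using h0 i hi h
    · exact (div_le_iff₀ h).1 (ht1 i hi h)

/-- The projection of a polyhedron along the coordinate `t` is a polyhedron: keep the constraints
without `t`, and combine each lower bound with each upper bound so that `t` cancels. -/
theorem isPolyhedronIn_exists (V : Submodule ℝ E) {S : Set ((StrongDual ℝ E × ℝ) × ℝ)}
    (hS : S.Finite) :
    IsPolyhedronIn V {x | x ∈ V ∧ ∃ t : ℝ, ∀ q ∈ S, q.1.1 x - q.1.2 ≤ t * q.2} := by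
  refine ⟨Prod.fst '' {q ∈ S | q.2 = 0} ∪
    (fun q : ((StrongDual ℝ E × ℝ) × ℝ) × ((StrongDual ℝ E × ℝ) × ℝ) =>
      (q.1.2 • q.2.1.1 - q.2.2 • q.1.1.1, q.1.2 * q.2.1.2 - q.2.2 * q.1.1.2)) ''
      ({q ∈ S | 0 < q.2} ×ˢ {q ∈ S | q.2 < 0}), ?_, ?_⟩
  · exact ((hS.subset fun _ h => h.1).image _).union
      (((hS.subset fun _ h => h.1).prod (hS.subset fun _ h => h.1)).image _)
  · ext x
    simp only [Set.mem_ofPred_eq]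
    refine and_congr_right fun _ => ?_
    rw [exists_le_mul_iff hS]
    constructor
    · rintro ⟨h0, h1⟩ p (⟨q, ⟨hq, hq0⟩, rfl⟩ | ⟨⟨q, r⟩, ⟨⟨hq, hq0⟩, hr, hr0⟩, rfl⟩)
      · linarith [h0 q hq hq0]
      · have := h1 q hq r hr hq0 hr0
        simp only [sub_apply, smul_apply, smul_eq_mul]
        linarith
    · intro h
      refine ⟨fun q hq hq0 => ?_, fun q hq r hr hq0 hr0 => ?_⟩
      · linarith [h q.1 (Or.inl ⟨q, ⟨hq, hq0⟩, rfl⟩)]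
      · have := h _ (Or.inr ⟨(q, r), ⟨⟨hq, hq0⟩, hr, hr0⟩, rfl⟩)
        simp only [sub_apply, smul_apply, smul_eq_mul] at this
        linarith

theorem IsPolyhedronIn.convex {V : Submodule ℝ E} {P : Set E} (h : IsPolyhedronIn V P) :
    Convex ℝ P := by
  obtain ⟨S, -, rfl⟩ := h
  intro x hx y hy a b ha hb hab
  refine ⟨V.add_mem (V.smul_mem _ hx.1) (V.smul_mem _ hy.1), fun p hp => ?_⟩
  simp only [map_add, map_smul, smul_eq_mul]
  have := hx.2 p hp
  have := hy.2 p hp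
  calc a * p.1 x + b * p.1 y ≤ a * p.2 + b * p.2 := by gcongr
    _ = p.2 := by rw [← add_mul, hab, one_mul]

theorem IsPolyhedronIn.isClosed {V : Submodule ℝ E} [FiniteDimensional ℝ V] {P : Set E}
    (h : IsPolyhedronIn V P) : IsClosed P := by
  obtain ⟨S, -, rfl⟩ := h
  refine V.closed_of_finiteDimensional.inter ?_
  have : {x : E | ∀ p ∈ S, p.1 x ≤ p.2} = ⋂ p ∈ S, {x | p.1 x ≤ p.2} := by ext; simp
  change IsClosed {x : E | ∀ p ∈ S, p.1 x ≤ p.2}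
  rw [this]
  exact isClosed_biInter fun p _ => isClosed_le p.1.continuous continuous_const

theorem IsPolyhedronIn.subset {V : Submodule ℝ E} {P : Set E} (h : IsPolyhedronIn V P) :
    P ⊆ V := by
  obtain ⟨S, -, rfl⟩ := h
  exact fun x hx => hx.1

theorem IsPolyhedronIn.inter {V W : Submodule ℝ E} {P Q : Set E} (hP : IsPolyhedronIn V P)
    (hQ : IsPolyhedronIn W Q) : IsPolyhedronIn (V ⊓ W) (P ∩ Q) := by
  obtain ⟨S, hS, rfl⟩ := hP
  obtain ⟨T, hT, rfl⟩ := hQ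
  refine ⟨S ∪ T, hS.union hT, ?_⟩
  ext x
  simp only [Set.mem_inter_iff, Set.mem_ofPred_eq, Submodule.mem_inf, Set.mem_union, or_imp,
    forall_and]
  tauto

/-- `W` is cut out of `V` by the inequalities ±⟨e, x⟩ ≤ 0, with `e` in a finite spanning set of the
orthogonal complement of `W` in `V`. -/
theorem IsPolyhedronIn.mono {V W : Submodule ℝ E} [FiniteDimensional ℝ V] {P : Set E} (h : W ≤ V)
    (hP : IsPolyhedronIn W P) : IsPolyhedronIn V P := by
  have : FiniteDimensional ℝ W := Submodule.finiteDimensional_of_le h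
  obtain ⟨S, hS, rfl⟩ := hP
  have : FiniteDimensional ℝ (Wᗮ ⊓ V : Submodule ℝ E) :=
    Submodule.finiteDimensional_of_le inf_le_right
  obtain ⟨s, hs⟩ : (Wᗮ ⊓ V : Submodule ℝ E).FG := Module.Finite.iff_fg.1 inferInstance
  let f : E → StrongDual ℝ E × ℝ := fun e => (innerSL ℝ e, 0)
  let g : E → StrongDual ℝ E × ℝ := fun e => (-innerSL ℝ e, 0)
  refine ⟨S ∪ (f '' s ∪ g '' s), hS.union ((s.finite_toSet.image _).union
    (s.finite_toSet.image _)), ?_⟩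
  ext x
  constructor
  · rintro ⟨hx, hx2⟩
    have h0 : ∀ e ∈ s, inner ℝ e x = (0 : ℝ) := by
      intro e he
      have : e ∈ Wᗮ ⊓ V := hs ▸ Submodule.subset_span he
      exact (Submodule.mem_orthogonal' _ _).1 this.1 x hx
    refine ⟨h hx, ?_⟩
    rintro p (hp | ⟨e, he, rfl⟩ | ⟨e, he, rfl⟩)
    · exact hx2 p hp
    · simp [f, h0 e he]
    · simp [g, h0 e he]
  · rintro ⟨hx, hx2⟩
    refine ⟨?_, fun p hp => hx2 p (Or.inl hp)⟩
    have h0 : ∀ e ∈ Wᗮ ⊓ V, inner ℝ e x = (0 : ℝ) := by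
      intro e he
      rw [← hs] at he
      induction he using Submodule.span_induction with
      | mem e he =>
        have h1 := hx2 (f e) (Or.inr (Or.inl ⟨e, he, rfl⟩))
        have h2 := hx2 (g e) (Or.inr (Or.inr ⟨e, he, rfl⟩))
        simp only [f, g, neg_apply, innerSL_apply_apply] at h1 h2
        linarith
      | zero => simp
      | add y z _ _ hy hz => rw [inner_add_left, hy, hz, add_zero]
      | smul c y _ hy => rw [inner_smul_left, hy, mul_zero]
    have hdec := Submodule.sup_orthogonal_inf_of_hasOrthogonalProjection h
    rw [← hdec] at hx
    obtain ⟨y, hy, z, hz, rfl⟩ := Submodule.mem_sup.1 hx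
    have h1 := h0 z hz
    rw [inner_add_right, (Submodule.mem_orthogonal' _ _).1 hz.1 y hy, zero_add,
      inner_self_eq_zero] at h1
    simpa [h1] using hy

theorem isPolyhedronIn_self (V : Submodule ℝ E) : IsPolyhedronIn V (V : Set E) :=
  ⟨∅, Set.finite_empty, by ext; simp⟩

theorem IsPolyhedronIn.vadd {V : Submodule ℝ E} {P : Set E} (hP : IsPolyhedronIn V P) {x : E}
    (hx : x ∈ V) : IsPolyhedronIn V (x +ᵥ P) := by
  obtain ⟨S, hS, rfl⟩ := hP
  refine ⟨(fun p : StrongDual ℝ E × ℝ => (p.1, p.2 + p.1 x)) '' S, hS.image _, ?_⟩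
  ext y
  rw [Set.mem_vadd_set_iff_neg_vadd_mem, vadd_eq_add]
  simp only [Set.mem_ofPred_eq, Set.forall_mem_image, map_add, map_neg]
  refine and_congr ?_ (forall₂_congr fun p _ => ?_)
  · exact V.add_mem_iff_right (V.neg_mem hx)
  · constructor <;> intro h <;> linarith

theorem isPolyhedronIn_singleton (V : Submodule ℝ E) [FiniteDimensional ℝ V] {x : E} (hx : x ∈ V) :
    IsPolyhedronIn V {x} := by
  have h0 : IsPolyhedronIn V ({0} : Set E) := by
    have := (isPolyhedronIn_self (⊥ : Submodule ℝ E)).mono (V := V) bot_le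
    simpa using this
  simpa using h0.vadd hx

/-- Vertices are added one at a time: `x` lies in the join of `v` and a polytope P exactly if x - t
v ∈ (1 - t) P for some t in [0, 1], and `t` can be eliminated. -/
theorem isPolyhedronIn_convexHull (V : Submodule ℝ E) [FiniteDimensional ℝ V] {s : Finset E}
    (hs : s.Nonempty) (hsV : (s : Set E) ⊆ V) : IsPolyhedronIn V (convexHull ℝ (s : Set E)) := by
  classical
  induction hs using Finset.Nonempty.cons_induction with
  | singleton a => simpa using isPolyhedronIn_singleton V (hsV (by simp))
  | cons v s hv hs ih =>
    rw [Finset.coe_cons] at hsV ⊢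
    have hvV : v ∈ V := hsV (Set.mem_insert _ _)
    have hP := ih (fun x hx => hsV (Set.mem_insert_of_mem _ hx))
    have hb : Bornology.IsBounded (convexHull ℝ (s : Set E)) :=
      isBounded_convexHull.2 s.finite_toSet.isBounded
    rw [convexHull_insert (by simpa using hs)]
    obtain ⟨S, hS, hPS⟩ := hP
    obtain ⟨p₀, hp₀⟩ : (convexHull ℝ (s : Set E)).Nonempty := by simpa using hs
    rw [hPS] at hp₀ hb ⊢
    -- For a constraint q ≤ c of P the condition reads q(x) - c ≤ t (q(v) - c). The two additional
    -- constraints encode 0 ≤ t and t ≤ 1.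
    let f : StrongDual ℝ E × ℝ → (StrongDual ℝ E × ℝ) × ℝ := fun p => (p, p.1 v - p.2)
    have hfin : (f '' S ∪ {((0, 0), 1), ((0, 1), -1)}).Finite := (hS.image _).union (by simp)
    convert isPolyhedronIn_exists V hfin using 1
    ext x
    simp only [Set.mem_ofPred_eq, Set.mem_union, or_imp, forall_and, Set.forall_mem_image,
      Set.mem_insert_iff, Set.mem_singleton_iff, forall_eq, f, convexJoin_singleton_left,
      Set.mem_iUnion, exists_prop]
    constructor
    · rintro ⟨p, ⟨hpV, hp⟩, a, b, ha, hb, hab, rfl⟩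
      refine ⟨V.add_mem (V.smul_mem _ hvV) (V.smul_mem _ hpV), a, fun q hq => ?_, ?_, ?_⟩
      · simp only [map_add, map_smul, smul_eq_mul]
        have h1 := mul_le_mul_of_nonneg_left (hp q hq) hb
        have h2 : q.2 = a * q.2 + b * q.2 := by rw [← add_mul, hab, one_mul]
        linarith
      · simpa using ha
      · simp; linarith
    · rintro ⟨hxV, t, ht, ht0, ht1⟩
      have ht0 : 0 ≤ t := by simpa using ht0
      have ht1 : t ≤ 1 := by
        simp at ht1; linarith
      rcases ht1.eq_or_lt with rfl | ht1
      -- At t = 1 the constraints only say that x - v is a recession direction of P; boundedness of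
      -- P then forces x = v.
      · have hray : ∀ n : ℕ, p₀ + (n : ℝ) • (x - v) ∈ {x | x ∈ V ∧ ∀ p ∈ S, p.1 x ≤ p.2} := by
          intro n
          refine ⟨V.add_mem hp₀.1 (V.smul_mem _ (V.sub_mem hxV hvV)), fun q hq => ?_⟩
          simp only [map_add, map_smul, map_sub, smul_eq_mul]
          have h1 : q.1 x - q.1 v ≤ 0 := by linarith [ht hq]
          have h2 := hp₀.2 q hq
          nlinarith [mul_nonneg (Nat.cast_nonneg (α := ℝ) n) (neg_nonneg.2 h1)]
        obtain ⟨R, hR⟩ := hb.exists_norm_le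
        have hxv : x = v := by
          by_contra hne
          have hpos : 0 < ‖x - v‖ := norm_pos_iff.2 (sub_ne_zero.2 hne)
          obtain ⟨n, hn⟩ := exists_nat_gt ((R + ‖p₀‖) / ‖x - v‖)
          rw [div_lt_iff₀ hpos] at hn
          have h1 := hR _ (hray n)
          have h2 : ‖(n : ℝ) • (x - v)‖ ≤ ‖p₀ + (n : ℝ) • (x - v)‖ + ‖p₀‖ := by
            calc ‖(n : ℝ) • (x - v)‖ = ‖(p₀ + (n : ℝ) • (x - v)) - p₀‖ := by congr 1; abel
              _ ≤ _ := norm_sub_le _ _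
          rw [norm_smul, Real.norm_natCast] at h2
          linarith
        exact ⟨p₀, hp₀, hxv ▸ left_mem_segment ℝ _ _⟩
      · have h1t : 0 < 1 - t := by linarith
        refine ⟨(1 - t)⁻¹ • (x - t • v), ⟨V.smul_mem _ (V.sub_mem hxV (V.smul_mem _ hvV)),
          fun q hq => ?_⟩, t, 1 - t, ht0, h1t.le, by ring, ?_⟩
        · simp only [map_smul, map_sub, smul_eq_mul]
          rw [inv_mul_le_iff₀ h1t]
          linarith [ht hq]
        · rw [smul_inv_smul₀ h1t.ne']; abel

/-- A new generator `v` amounts to the existence of t ≥ 0 with x - t v in the old cone, and `t` is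
eliminated. -/
theorem isPolyhedronIn_hull (V : Submodule ℝ E) [FiniteDimensional ℝ V] (s : Finset E)
    (hsV : (s : Set E) ⊆ V) : IsPolyhedronIn V (PointedCone.hull ℝ (s : Set E) : Set E) := by
  classical
  induction s using Finset.induction_on with
  | empty => simpa using isPolyhedronIn_singleton V V.zero_mem
  | insert v s hv ih =>
    rw [Finset.coe_insert] at hsV ⊢
    have hvV : v ∈ V := hsV (Set.mem_insert _ _)
    obtain ⟨S, hS, hPS⟩ := ih (fun x hx => hsV (Set.mem_insert_of_mem _ hx))
    let f : StrongDual ℝ E × ℝ → (StrongDual ℝ E × ℝ) × ℝ := fun p => (p, p.1 v)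
    have hfin : (f '' S ∪ {((0, 0), 1)}).Finite := (hS.image _).union (by simp)
    convert isPolyhedronIn_exists V hfin using 1
    ext x
    have hx : x ∈ (PointedCone.hull ℝ (insert v (s : Set E)) : Set E) ↔
        ∃ t : ℝ, 0 ≤ t ∧ x - t • v ∈ (PointedCone.hull ℝ (s : Set E) : Set E) := by
      rw [SetLike.mem_coe, Submodule.mem_span_insert]
      constructor
      · rintro ⟨a, z, hz, rfl⟩
        refine ⟨a.1, a.2, ?_⟩
        have : a • v + z - (a : ℝ) • v = z := by
          change (a : ℝ) • v + z - (a : ℝ) • v = z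
          abel
        rw [this]; exact hz
      · rintro ⟨t, ht, h⟩
        refine ⟨⟨t, ht⟩, _, h, ?_⟩
        change x = t • v + (x - t • v)
        abel
    rw [hx, hPS]
    simp only [Set.mem_ofPred_eq, Set.mem_union, or_imp, forall_and, Set.forall_mem_image,
      Set.mem_singleton_iff, forall_eq, f, map_sub, map_smul, smul_eq_mul]
    constructor
    · rintro ⟨t, ht, h1, h2⟩
      exact ⟨(V.sub_mem_iff_left (V.smul_mem _ hvV)).1 h1, t, fun q hq => by linarith [h2 q hq],
        by simpa using ht⟩
    · rintro ⟨h1, t, h2, h3⟩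
      exact ⟨t, by simpa using h3, V.sub_mem h1 (V.smul_mem _ hvV), fun q hq => by
        linarith [h2 hq]⟩

/-! ### Dual cones -/

theorem IsConvexCone.exists_finset {C : Set E} (hC : IsConvexCone C) :
    ∃ s : Finset E, C = (PointedCone.hull ℝ (s : Set E) : Set E) := by
  obtain ⟨D, ⟨s, rfl⟩, rfl⟩ := hC
  exact ⟨s, rfl⟩

theorem isConvexCone_hull {s : Set E} (hs : s.Finite) :
    IsConvexCone (PointedCone.hull ℝ s : Set E) :=
  ⟨_, Submodule.fg_span hs, rfl⟩

theorem IsConvexCone.zero_mem {C : Set E} (hC : IsConvexCone C) : (0 : E) ∈ C := by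
  obtain ⟨D, -, rfl⟩ := hC
  exact D.zero_mem

theorem IsConvexCone.nonempty {C : Set E} (hC : IsConvexCone C) : C.Nonempty := ⟨0, hC.zero_mem⟩

theorem IsConvexCone.smul_mem {C : Set E} (hC : IsConvexCone C) {c : ℝ} (hc : 0 ≤ c) {x : E}
    (hx : x ∈ C) : c • x ∈ C := by
  obtain ⟨D, -, rfl⟩ := hC
  exact D.smul_mem hc hx

theorem IsConvexCone.add_mem {C : Set E} (hC : IsConvexCone C) {x y : E}
    (hx : x ∈ C) (hy : y ∈ C) : x + y ∈ C := by
  obtain ⟨D, -, rfl⟩ := hC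
  exact D.add_mem hx hy

theorem IsConvexCone.isPolyhedronIn {C : Set E} (hC : IsConvexCone C) {V : Submodule ℝ E}
    [FiniteDimensional ℝ V] (h : C ⊆ V) : IsPolyhedronIn V C := by
  obtain ⟨s, rfl⟩ := hC.exists_finset
  exact isPolyhedronIn_hull V s (Submodule.subset_span.trans h)

/-- A linear form that is positive somewhere on P is unbounded on P by scaling, so every bound may
be lowered to 0; the bounds are nonnegative since 0 ∈ P. -/
theorem IsPolyhedronIn.exists_homogeneous {V : Submodule ℝ E} {P : Set E}
    (hP : IsPolyhedronIn V P) (h0 : (0 : E) ∈ P) (hsmul : ∀ c : ℝ, 0 ≤ c → ∀ x ∈ P, c • x ∈ P) :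
    ∃ S : Set (StrongDual ℝ E), S.Finite ∧ P = {x | x ∈ V ∧ ∀ a ∈ S, a x ≤ 0} := by
  obtain ⟨S, hS, rfl⟩ := hP
  refine ⟨Prod.fst '' S, hS.image _, ?_⟩
  ext x
  simp only [Set.mem_ofPred_eq, Set.forall_mem_image]
  constructor
  · rintro hx
    refine ⟨hx.1, fun p hp => ?_⟩
    by_contra! hpos
    have h1 := (hsmul ((|p.2| + 1) / p.1 x) (by positivity) x hx).2 p hp
    rw [map_smul, smul_eq_mul, div_mul_cancel₀ _ hpos.ne'] at h1
    linarith [le_abs_self p.2]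
  · rintro ⟨hxV, hx⟩
    refine ⟨hxV, fun p hp => (hx hp).trans ?_⟩
    simpa using h0.2 p hp

theorem exists_mem_inner_eq (V : Submodule ℝ E) [FiniteDimensional ℝ V] (a : StrongDual ℝ E) :
    ∃ v ∈ V, ∀ x ∈ V, inner ℝ v x = a x := by
  refine ⟨((InnerProductSpace.toDual ℝ V).symm (a.comp V.subtypeL) : V), Subtype.prop _, ?_⟩
  intro x hx
  exact InnerProductSpace.toDual_symm_apply (x := (⟨x, hx⟩ : V)) (y := a.comp V.subtypeL)

theorem dualCone_hull (V : Submodule ℝ E) (T : Set E) :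
    dualCone V (PointedCone.hull ℝ T : Set E) = dualCone V T := by
  ext w
  refine and_congr_right fun hw => ⟨fun h x hx => h x (Submodule.subset_span hx), fun h x hx => ?_⟩
  rw [SetLike.mem_coe] at hx
  induction hx using Submodule.span_induction with
  | mem x hx => exact h x hx
  | zero => simp
  | add x y _ _ hx hy => rw [inner_add_right]; linarith
  | smul c x _ hx =>
    change inner ℝ w ((c : ℝ) • x) ≤ 0
    rw [inner_smul_right]
    exact mul_nonpos_of_nonneg_of_nonpos c.2 hx

theorem IsPolyhedronIn.exists_dualCone {V : Submodule ℝ E} [FiniteDimensional ℝ V] {P : Set E}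
    (hP : IsPolyhedronIn V P) (h0 : (0 : E) ∈ P) (hsmul : ∀ c : ℝ, 0 ≤ c → ∀ x ∈ P, c • x ∈ P) :
    ∃ T : Set E, T.Finite ∧ T ⊆ V ∧ P = dualCone V T := by
  obtain ⟨S, hS, rfl⟩ := hP.exists_homogeneous h0 hsmul
  choose v hvV hv using exists_mem_inner_eq V
  refine ⟨v '' S, hS.image _, by rintro _ ⟨a, -, rfl⟩; exact hvV a, ?_⟩
  ext x
  simp only [dualCone, Set.mem_ofPred_eq, Set.forall_mem_image]
  refine and_congr_right fun hx => forall₂_congr fun a _ => ?_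
  rw [real_inner_comm, hv a x hx]

theorem IsConvexCone.exists_dualCone {C : Set E} (hC : IsConvexCone C) {V : Submodule ℝ E}
    [FiniteDimensional ℝ V] (h : C ⊆ V) : ∃ T : Set E, T.Finite ∧ T ⊆ V ∧ C = dualCone V T :=
  (hC.isPolyhedronIn h).exists_dualCone hC.zero_mem fun _ hc _ hx => hC.smul_mem hc hx

theorem dualCone_subset (V : Submodule ℝ E) (P : Set E) : dualCone V P ⊆ V := fun _ h => h.1

/-- The bipolar theorem. -/
theorem IsConvexCone.dualCone_dualCone {C : Set E} (hC : IsConvexCone C) {V : Submodule ℝ E}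
    [FiniteDimensional ℝ V] (h : C ⊆ V) : dualCone V (dualCone V C) = C := by
  apply Set.Subset.antisymm
  · obtain ⟨T, hT, hTV, rfl⟩ := hC.exists_dualCone h
    refine fun x hx => ⟨hx.1, fun y hy => hx.2 y ⟨hTV hy, fun z hz => ?_⟩⟩
    rw [real_inner_comm]; exact hz.2 y hy
  · intro x hx
    refine ⟨h hx, fun w hw => ?_⟩
    rw [real_inner_comm]; exact hw.2 x hx

/-- The other half of Minkowski-Weyl follows formally: the cone generated by `T` is the dual of a
finite set `X`, so its dual is the bidual of the cone generated by `X`, which is that cone. -/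
theorem isConvexCone_dualCone (V : Submodule ℝ E) [FiniteDimensional ℝ V] {T : Set E}
    (hT : T.Finite) (hTV : T ⊆ V) : IsConvexCone (dualCone V T) := by
  have hle : (PointedCone.hull ℝ T : Set E) ⊆ V := fun x hx =>
    (Submodule.span_le (p := PointedCone.ofSubmodule V)).2 hTV hx
  obtain ⟨X, hX, hXV, hX2⟩ := (isConvexCone_hull hT).exists_dualCone hle
  have hle2 : (PointedCone.hull ℝ X : Set E) ⊆ V := fun x hx =>
    (Submodule.span_le (p := PointedCone.ofSubmodule V)).2 hXV hx
  rw [← dualCone_hull, hX2, ← dualCone_hull V X, (isConvexCone_hull hX).dualCone_dualCone hle2]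
  exact isConvexCone_hull hX

theorem IsConvexCone.dual {C : Set E} (hC : IsConvexCone C) {V : Submodule ℝ E}
    [FiniteDimensional ℝ V] (h : C ⊆ V) : IsConvexCone (dualCone V C) := by
  obtain ⟨s, rfl⟩ := hC.exists_finset
  rw [dualCone_hull]
  exact isConvexCone_dualCone V s.finite_toSet (Submodule.subset_span.trans h)

theorem IsPolyhedronIn.isConvexCone {V : Submodule ℝ E} [FiniteDimensional ℝ V] {P : Set E}
    (hP : IsPolyhedronIn V P) (h0 : (0 : E) ∈ P) (hsmul : ∀ c : ℝ, 0 ≤ c → ∀ x ∈ P, c • x ∈ P) :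
    IsConvexCone P := by
  obtain ⟨T, hT, hTV, rfl⟩ := hP.exists_dualCone h0 hsmul
  exact isConvexCone_dualCone V hT hTV

/-! ### Bounded polyhedra are convex polytopes. -/

theorem IsPolyhedronIn.isCompact {V : Submodule ℝ E} [FiniteDimensional ℝ V] {P : Set E}
    (hP : IsPolyhedronIn V P) (hb : Bornology.IsBounded P) : IsCompact P := by
  have h1 : IsCompact ((↑) ⁻¹' P : Set V) :=
    Metric.isCompact_of_isClosed_isBounded (hP.isClosed.preimage continuous_subtype_val)
      (isometry_subtype_coe.antilipschitz.isBounded_preimage hb)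
  have := h1.image (continuous_subtype_val (p := fun x => x ∈ V))
  rwa [Set.image_preimage_eq_of_subset (by simpa using hP.subset)] at this

/-- An extreme point is determined by its set of active constraints: if the constraints active at x
are also active at y, then x ± ε (y - x) stays in P for small ε, so x = y. -/
theorem IsPolyhedronIn.finite_extremePoints {V : Submodule ℝ E} {P : Set E}
    (hP : IsPolyhedronIn V P) : (P.extremePoints ℝ).Finite := by
  obtain ⟨S, hS, rfl⟩ := hP
  have hinj : Set.InjOn (fun x : E => {p ∈ S | p.1 x = p.2})
      (({x | x ∈ V ∧ ∀ p ∈ S, p.1 x ≤ p.2} : Set E).extremePoints ℝ) := by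
    intro x hx y hy hxy
    have hact : ∀ p ∈ S, p.1 x = p.2 → p.1 y = p.2 := fun p hp h =>
      ((Set.ext_iff.1 hxy p).1 ⟨hp, h⟩).2
    by_contra hne
    have hev : ∀ᶠ ε : ℝ in 𝓝 0, x + ε • (y - x) ∈
        ({x | x ∈ V ∧ ∀ p ∈ S, p.1 x ≤ p.2} : Set E) := by
      have h1 : ∀ᶠ ε : ℝ in 𝓝 0, ∀ p ∈ S, p.1 (x + ε • (y - x)) ≤ p.2 := by
        rw [Filter.eventually_all_finite hS]
        intro p hp
        rcases (hx.1.2 p hp).eq_or_lt with h | h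
        · refine Eventually.of_forall fun ε => ?_
          simp [hact p hp h, h]
        · have hc : ContinuousAt (fun ε : ℝ => p.1 (x + ε • (y - x))) 0 := by fun_prop
          refine (hc.eventually_lt continuousAt_const ?_).mono fun ε h => h.le
          simpa using h
      filter_upwards [h1] with ε hε
      exact ⟨V.add_mem hx.1.1 (V.smul_mem _ (V.sub_mem hy.1.1 hx.1.1)), hε⟩
    have hev2 := (continuous_neg.tendsto' (0 : ℝ) 0 neg_zero).eventually hev
    obtain ⟨ε, ⟨h1, h2⟩, hε⟩ := (((hev.and hev2).filter_mono nhdsWithin_le_nhds).and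
      (self_mem_nhdsWithin (a := (0 : ℝ)) (s := Set.Ioi 0))).exists
    have h3 := hx.2 h1 h2 ⟨1 / 2, 1 / 2, by norm_num, by norm_num, by norm_num, by module⟩
    rw [add_eq_left, smul_eq_zero] at h3
    exact h3.elim (fun h => (ne_of_gt hε) h) fun h => hne (sub_eq_zero.1 h).symm
  exact Set.Finite.of_finite_image (hS.finite_subsets.subset (by
    rintro _ ⟨x, -, rfl⟩; exact fun p hp => hp.1)) hinj

theorem IsPolyhedronIn.isConvexPolytope {V : Submodule ℝ E} [FiniteDimensional ℝ V] {P : Set E}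
    (hP : IsPolyhedronIn V P) (hne : P.Nonempty) (hb : Bornology.IsBounded P) :
    IsConvexPolytope P := by
  have hext := hP.finite_extremePoints
  have hcomp := hP.isCompact hb
  refine ⟨hext.toFinset, ?_, ?_⟩
  · simpa using hcomp.extremePoints_nonempty hne
  · rw [Set.Finite.coe_toFinset, ← (hext.isClosed_convexHull ℝ).closure_eq,
      closure_convexHull_extremePoints (E := E) hcomp hP.convex]

end Polyhedra

/-! ### Relative interiors and tangent cones of polyhedra -/

section RelCore

variable {E : Type u} [NormedAddCommGroup E] [InnerProductSpace ℝ E]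

/-- A nonempty polyhedron in some finite-dimensional subspace. -/
def IsPolyhedron (P : Set E) : Prop :=
  P.Nonempty ∧ ∃ V : Submodule ℝ E, FiniteDimensional ℝ V ∧ IsPolyhedronIn V P

theorem IsPolyhedron.convex {P : Set E} (h : IsPolyhedron P) : Convex ℝ P :=
  let ⟨_, _, _, h⟩ := h; h.convex

theorem IsPolyhedron.isClosed {P : Set E} (h : IsPolyhedron P) : IsClosed P :=
  let ⟨_, _, _, h⟩ := h; h.isClosed

theorem vectorSpan_le_iff {P : Set E} {W : Submodule ℝ E} :
    vectorSpan ℝ P ≤ W ↔ ∀ x ∈ P, ∀ y ∈ P, x - y ∈ W := by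
  rw [vectorSpan_def, Submodule.span_le]
  constructor
  · exact fun h x hx y hy => h (Set.vsub_mem_vsub hx hy)
  · rintro h _ ⟨x, hx, y, hy, rfl⟩
    exact h x hx y hy

theorem sub_mem_vectorSpan {P : Set E} {x y : E} (hx : x ∈ P) (hy : y ∈ P) :
    x - y ∈ vectorSpan ℝ P := vsub_mem_vectorSpan ℝ hx hy

theorem vectorSpan_le_of_subset {P : Set E} {W : Submodule ℝ E} (h : P ⊆ W) :
    vectorSpan ℝ P ≤ W :=
  vectorSpan_le_iff.2 fun _ hx _ hy => W.sub_mem (h hx) (h hy)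

theorem IsPolyhedron.finiteDimensional {P : Set E} (h : IsPolyhedron P) :
    FiniteDimensional ℝ (vectorSpan ℝ P) :=
  let ⟨_, _, _, h⟩ := h; Submodule.finiteDimensional_of_le (vectorSpan_le_of_subset h.subset)

/-- The algebraic relative interior of a convex set. -/
def relCore (P : Set E) : Set E := {x | x ∈ P ∧ ∀ y ∈ P, ∃ ε : ℝ, 0 < ε ∧ x + ε • (x - y) ∈ P}

theorem relCore_subset (P : Set E) : relCore P ⊆ P := fun _ h => h.1

/-- A segment from `q` can be prolonged past `x`; contracting towards `y` gives a prolongation past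
the point of the segment from `y` to `x`. -/
theorem Convex.lineMap_mem_relCore {P : Set E} (hP : Convex ℝ P) {x y : E} (hx : x ∈ relCore P)
    (hy : y ∈ P) {t : ℝ} (ht : 0 < t) (ht1 : t ≤ 1) : y + t • (x - y) ∈ relCore P := by
  refine ⟨hP.add_smul_sub_mem hy hx.1 ⟨ht.le, ht1⟩, fun q hq => ?_⟩
  obtain ⟨ε, hε, hw⟩ := hx.2 q hq
  have h1 : (0 : ℝ) < 1 + ε := by linarith
  -- With α = t / (1 + ε) the prolonged point is a combination of x + ε (x - q), y and x with
  -- weights α, (1 + δ)(1 - t) and t δ. The choice of δ gives α ε = δ, which matches the coefficient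
  -- of q, and α + δ = t, which makes the weights sum to 1.
  have hδ : 0 < t * ε / (1 + ε) := by positivity
  refine ⟨t * ε / (1 + ε), hδ, ?_⟩
  set δ := t * ε / (1 + ε) with hδd
  have hα : t / (1 + ε) * ε = δ := by rw [hδd]; ring
  have hα2 : t / (1 + ε) * (1 + ε) = t := by field_simp
  have hα3 : t / (1 + ε) + δ = t := by rw [← hα]; linarith
  have hxy : (1 - t) • y + t • x ∈ P := hP hy hx.1 (by linarith) ht.le (by ring)
  have hmem := hP.sum_mem (t := Finset.univ) (w := ![t / (1 + ε), (1 + δ) * (1 - t), t * δ])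
    (z := ![x + ε • (x - q), y, x])
    (by
      intro i _
      fin_cases i
      · change 0 ≤ t / (1 + ε); positivity
      · exact mul_nonneg (by linarith) (by linarith)
      · exact mul_nonneg ht.le hδ.le)
    (by simp [Fin.sum_univ_three]; linarith)
    (by intro i _; fin_cases i <;> simp [hw, hy, hx.1])
  rw [Fin.sum_univ_three] at hmem
  simp only [Matrix.cons_val_zero, Matrix.cons_val_one, Matrix.cons_val] at hmem
  convert hmem using 1
  have h3 : t / (1 + ε) = t - δ := by linarith
  rw [smul_add, smul_smul, hα, h3]
  module

/-- Inactive constraints never obstruct a short prolongation; an active one does unless it is an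
equality on the whole polyhedron. -/
theorem IsPolyhedronIn.mem_relCore_iff {V : Submodule ℝ E} {S : Set (StrongDual ℝ E × ℝ)}
    (hS : S.Finite) {x : E} :
    x ∈ relCore {x | x ∈ V ∧ ∀ p ∈ S, p.1 x ≤ p.2} ↔
      x ∈ {x | x ∈ V ∧ ∀ p ∈ S, p.1 x ≤ p.2} ∧
        ∀ p ∈ S, p.1 x = p.2 → ∀ y ∈ {x | x ∈ V ∧ ∀ p ∈ S, p.1 x ≤ p.2}, p.1 y = p.2 := by
  refine and_congr_right fun hx => ⟨fun h p hp hpx y hy => ?_, fun h y hy => ?_⟩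
  · obtain ⟨ε, hε, hmem⟩ := h y hy
    refine le_antisymm (hy.2 p hp) ?_
    have := hmem.2 p hp
    simp only [map_add, map_smul, map_sub, smul_eq_mul, hpx] at this
    nlinarith
  · have h1 : ∀ᶠ ε : ℝ in 𝓝 0, ∀ p ∈ S, p.1 (x + ε • (x - y)) ≤ p.2 := by
      rw [Filter.eventually_all_finite hS]
      intro p hp
      rcases (hx.2 p hp).eq_or_lt with h' | h'
      · refine Eventually.of_forall fun ε => ?_
        simp [h p hp h' y hy, h']
      · have hc : ContinuousAt (fun ε : ℝ => p.1 (x + ε • (x - y))) 0 := by fun_prop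
        refine (hc.eventually_lt continuousAt_const ?_).mono fun ε h => h.le
        simpa using h'
    obtain ⟨ε, h1, hε⟩ := ((h1.filter_mono nhdsWithin_le_nhds).and
      (self_mem_nhdsWithin (a := (0 : ℝ)) (s := Set.Ioi 0))).exists
    exact ⟨ε, hε, V.add_mem hx.1 (V.smul_mem _ (V.sub_mem hx.1 hy.1)), h1⟩

/-- The forms of the constraints active at `x` are constant on `P`, hence vanish on its direction;
the other constraints hold near `x`. -/
theorem IsPolyhedron.eventually_add_smul_mem {P : Set E} (hP : IsPolyhedron P) {x w : E} (hx : x ∈ relCore P)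
    (hw : w ∈ vectorSpan ℝ P) : ∀ᶠ z in 𝓝[vectorSpan ℝ P] 0, x + z ∈ P := by
  obtain ⟨-, V, -, S, hS, rfl⟩ := hP
  obtain ⟨hxP, hact⟩ := (IsPolyhedronIn.mem_relCore_iff hS).1 hx
  have h1 : ∀ᶠ z : E in 𝓝[vectorSpan ℝ {x | x ∈ V ∧ ∀ p ∈ S, p.1 x ≤ p.2}] 0,
      ∀ p ∈ S, p.1 (x + z) ≤ p.2 := by
    rw [Filter.eventually_all_finite hS]
    intro p hp
    rcases (hxP.2 p hp).eq_or_lt with h' | h'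
    · filter_upwards [self_mem_nhdsWithin] with z hz
      have hker : vectorSpan ℝ {x | x ∈ V ∧ ∀ p ∈ S, p.1 x ≤ p.2} ≤
          LinearMap.ker (p.1 : E →ₗ[ℝ] ℝ) := by
        refine vectorSpan_le_iff.2 fun a ha b hb => ?_
        simp [hact p hp h' a ha, hact p hp h' b hb]
      have : p.1 z = 0 := hker hz
      simp [h', this]
    · have hc : ContinuousAt (fun z : E => p.1 (x + z)) 0 := by fun_prop
      refine ((hc.eventually_lt continuousAt_const ?_).mono fun ε h => h.le).filter_mono
        nhdsWithin_le_nhds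
      simpa using h'
  filter_upwards [h1, self_mem_nhdsWithin] with z hz hz2
  exact ⟨V.add_mem hxP.1 (vectorSpan_le_of_subset (fun y hy => hy.1) hz2), hz⟩

/-- This replaces the topology of the affine span, used in the definition of a cell structure, by
the prolongation property used in all later arguments. -/
theorem IsPolyhedron.intrinsicInterior_eq {P : Set E} (hP : IsPolyhedron P) :
    intrinsicInterior ℝ P = relCore P := by
  apply Set.Subset.antisymm
  · intro x hx
    refine ⟨intrinsicInterior_subset hx, fun y hy => ?_⟩
    obtain ⟨⟨x, hxs⟩, hint, rfl⟩ := mem_intrinsicInterior.1 hx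
    have hys : y ∈ affineSpan ℝ P := subset_affineSpan ℝ P hy
    have hmem : ∀ t : ℝ, x + t • (x - y) ∈ affineSpan ℝ P := fun t => by
      rw [add_comm]
      exact AffineSubspace.smul_vsub_vadd_mem _ t hxs hys hxs
    let f : ℝ → affineSpan ℝ P := fun t => ⟨x + t • (x - y), hmem t⟩
    have hf : Continuous f := by
      refine Continuous.subtype_mk ?_ _
      fun_prop
    have hf0 : f 0 = ⟨x, hxs⟩ := by simp [f]
    have hev : ∀ᶠ t in 𝓝 0, f t ∈ interior ((↑) ⁻¹' P : Set (affineSpan ℝ P)) :=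
      hf.continuousAt.eventually_mem (by rw [hf0]; exact isOpen_interior.mem_nhds hint)
    obtain ⟨ε, h1, hε⟩ := ((hev.filter_mono nhdsWithin_le_nhds).and
      (self_mem_nhdsWithin (a := (0 : ℝ)) (s := Set.Ioi 0))).exists
    exact ⟨ε, hε, interior_subset (s := ((↑) ⁻¹' P : Set (affineSpan ℝ P))) h1⟩
  · intro x hx
    have hxs : x ∈ affineSpan ℝ P := subset_affineSpan ℝ P hx.1
    refine mem_intrinsicInterior.2 ⟨⟨x, hxs⟩, ?_, rfl⟩
    rw [mem_interior_iff_mem_nhds]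
    have hev := hP.eventually_add_smul_mem hx (Submodule.zero_mem _)
    have hf : Tendsto (fun z : affineSpan ℝ P => (z : E) - x) (𝓝 ⟨x, hxs⟩)
        (𝓝[vectorSpan ℝ P] 0) := by
      refine tendsto_nhdsWithin_iff.2 ⟨?_, Eventually.of_forall fun z => ?_⟩
      · have : Continuous fun z : affineSpan ℝ P => (z : E) - x := by fun_prop
        exact this.tendsto' _ _ (sub_self x)
      · rw [← direction_affineSpan]
        exact AffineSubspace.vsub_mem_direction z.2 hxs
    filter_upwards [hf.eventually hev] with z hz
    simpa using hz

/-- A point with the fewest active constraints works: if one of them were not active at `y`, the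
midpoint with `y` would have fewer. -/
theorem IsPolyhedron.relCore_nonempty {P : Set E} (hP : IsPolyhedron P) : (relCore P).Nonempty := by
  obtain ⟨hne, V, -, S, hS, rfl⟩ := hP
  set P := {x | x ∈ V ∧ ∀ p ∈ S, p.1 x ≤ p.2} with hPd
  obtain ⟨x, hx, hmin⟩ : ∃ x ∈ P, ∀ y ∈ P, {p ∈ S | p.1 x = p.2}.ncard ≤
      {p ∈ S | p.1 y = p.2}.ncard := by
    refine ⟨Function.argminOn (fun x : E => {p ∈ S | p.1 x = p.2}.ncard) P hne,
      Function.argminOn_mem _ _ _, fun y hy =>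
        Function.argminOn_le (fun x : E => {p ∈ S | p.1 x = p.2}.ncard) P hy⟩
  refine ⟨x, (IsPolyhedronIn.mem_relCore_iff hS).2 ⟨hx, fun p hp hpx y hy => ?_⟩⟩
  by_contra hne
  have hz : x + (1 / 2 : ℝ) • (y - x) ∈ P :=
    (show IsPolyhedronIn V P from ⟨S, hS, rfl⟩).convex.add_smul_sub_mem hx hy (by norm_num)
  refine (hmin _ hz).not_gt (Set.ncard_lt_ncard ?_ (hS.subset fun _ h => h.1))
  have hlt : ∀ q ∈ S, q.1 (x + (1 / 2 : ℝ) • (y - x)) = q.2 → q.1 x = q.2 ∧ q.1 y = q.2 := by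
    intro q hq h
    simp only [map_add, map_smul, map_sub, smul_eq_mul] at h
    have h1 := hx.2 q hq
    have h2 := hy.2 q hq
    constructor <;> linarith
  exact ⟨fun q hq => ⟨hq.1, (hlt q hq.1 hq.2).1⟩, fun h => hne (hlt p hp (h ⟨hp, hpx⟩).2).2⟩

/-- A constraint that is active at `x` but not on all of `P` defines the proper face. -/
theorem IsPolyhedron.exists_exposed {P : Set E} (hP : IsPolyhedron P) {x : E} (hx : x ∈ P)
    (hxc : x ∉ relCore P) : ∃ τ : Set E, IsExposed ℝ P τ ∧ x ∈ τ ∧ τ ⊂ P := by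
  obtain ⟨hne, V, -, S, hS, rfl⟩ := hP
  rw [IsPolyhedronIn.mem_relCore_iff hS] at hxc
  push Not at hxc
  obtain ⟨p, hp, hpx, y, hy, hpy⟩ := hxc hx
  refine ⟨p.1.toExposed _, ContinuousLinearMap.toExposed.isExposed,
    ⟨hx, fun z hz => hpx ▸ hz.2 p hp⟩, fun z hz => hz.1, fun h => hpy ?_⟩
  have h1 := (h hy).2 x hx
  exact le_antisymm (hy.2 p hp) (hpx ▸ h1)

/-- A linear function that attains its maximum over `ρ` at a relative interior point is constant on
`ρ`. -/
theorem IsExposed.subset_of_mem_relCore {σ τ ρ : Set E} (h : IsExposed ℝ σ τ) (hρ : ρ ⊆ σ) {y : E}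
    (hy : y ∈ relCore ρ) (hyτ : y ∈ τ) : ρ ⊆ τ := by
  obtain ⟨l, rfl⟩ := h ⟨y, hyτ⟩
  intro z hz
  obtain ⟨ε, hε, hm⟩ := hy.2 z hz
  refine ⟨hρ hz, fun w hw => (hyτ.2 w hw).trans ?_⟩
  have := hyτ.2 _ (hρ hm)
  simp only [map_add, map_smul, map_sub, smul_eq_mul] at this
  nlinarith

/-! ### Tangent cones. -/

/-- The set of the vectors `w` such that `x + t w ∈ P` for all small `t > 0`. -/
def tangent (P : Set E) (x : E) : Set E := {w | ∀ᶠ t : ℝ in 𝓝[>] 0, x + t • w ∈ P}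

theorem mem_tangent {P : Set E} {x w : E} :
    w ∈ tangent P x ↔ ∀ᶠ t : ℝ in 𝓝[>] 0, x + t • w ∈ P := Iff.rfl

theorem normalCone_eq (V : Submodule ℝ E) (P σ : Set E) (x : E) :
    normalCone V P σ x = (perpIn V σ : Set E) ∩ tangent P x := rfl

theorem tangent_mono {P Q : Set E} (h : P ⊆ Q) (x : E) : tangent P x ⊆ tangent Q x :=
  fun _ hw => (mem_tangent.1 hw).mono fun _ ht => h ht

theorem tangent_inter (P Q : Set E) (x : E) : tangent (P ∩ Q) x = tangent P x ∩ tangent Q x := by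
  ext w
  simp only [mem_tangent, Set.mem_inter_iff, eventually_and]

theorem Convex.mem_tangent_iff {P : Set E} (hP : Convex ℝ P) {x : E} (hx : x ∈ P) {w : E} :
    w ∈ tangent P x ↔ ∃ t : ℝ, 0 < t ∧ x + t • w ∈ P := by
  constructor
  · intro h
    obtain ⟨t, h1, h2⟩ := ((mem_tangent.1 h).and self_mem_nhdsWithin).exists
    exact ⟨t, h2, h1⟩
  · rintro ⟨t, ht, h⟩
    filter_upwards [Ioc_mem_nhdsGT ht] with s hs
    have := hP.add_smul_sub_mem hx h (t := s / t) ⟨by have := hs.1; positivity,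
      (div_le_one ht).2 hs.2⟩
    rwa [add_sub_cancel_left, smul_smul, div_mul_cancel₀ _ ht.ne'] at this

/-- A ray cannot oscillate in and out of a closed convex set near its origin. With finitely many
cells this puts the germ of a ray in a single cell. -/
theorem Convex.frequently_mem_tangent {P : Set E} (hP : Convex ℝ P) {x w : E} (hcl : IsClosed P)
    (h : ∃ᶠ t : ℝ in 𝓝[>] 0, x + t • w ∈ P) : w ∈ tangent P x := by
  have hx : x ∈ P := by
    have hc : Tendsto (fun t : ℝ => x + t • w) (𝓝[>] 0) (𝓝 x) := by
      have : Continuous fun t : ℝ => x + t • w := by fun_prop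
      exact (this.tendsto' 0 x (by simp)).mono_left nhdsWithin_le_nhds
    exact hcl.mem_of_frequently_of_tendsto h hc
  obtain ⟨t, h1, h2⟩ := (h.and_eventually self_mem_nhdsWithin).exists
  exact (hP.mem_tangent_iff hx).2 ⟨t, h2, h1⟩

theorem mem_of_mem_tangent {P : Set E} {x w : E} (hcl : IsClosed P) (h : w ∈ tangent P x) :
    x ∈ P := by
  have hc : Tendsto (fun t : ℝ => x + t • w) (𝓝[>] 0) (𝓝 x) := by
    have : Continuous fun t : ℝ => x + t • w := by fun_prop
    exact (this.tendsto' 0 x (by simp)).mono_left nhdsWithin_le_nhds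
  exact hcl.mem_of_tendsto hc (mem_tangent.1 h)

theorem zero_mem_tangent {P : Set E} {x : E} (hx : x ∈ P) : (0 : E) ∈ tangent P x :=
  mem_tangent.2 (Eventually.of_forall fun t => by simpa using hx)

theorem tangent_smul_mem {P : Set E} {x w : E} (hx : x ∈ P) (hw : w ∈ tangent P x) {c : ℝ}
    (hc : 0 ≤ c) : c • w ∈ tangent P x := by
  rcases hc.eq_or_lt with rfl | hc
  · simpa using zero_mem_tangent hx
  · have : Tendsto (fun t : ℝ => t * c) (𝓝[>] 0) (𝓝[>] 0) := by
      refine tendsto_nhdsWithin_iff.2 ⟨?_, ?_⟩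
      · exact ((continuous_mul_const c).tendsto' 0 0 (by simp)).mono_left nhdsWithin_le_nhds
      · filter_upwards [self_mem_nhdsWithin] with t ht
        exact mul_pos ht hc
    filter_upwards [this.eventually hw] with t ht
    rwa [smul_smul]

theorem Convex.tangent_add_mem {P : Set E} (hP : Convex ℝ P) {x w z : E}
    (hw : w ∈ tangent P x) (hz : z ∈ tangent P x) : w + z ∈ tangent P x := by
  have : Tendsto (fun t : ℝ => t * 2) (𝓝[>] 0) (𝓝[>] 0) := by
    refine tendsto_nhdsWithin_iff.2 ⟨?_, ?_⟩
    · exact ((continuous_mul_const 2).tendsto' 0 0 (by simp)).mono_left nhdsWithin_le_nhds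
    · filter_upwards [self_mem_nhdsWithin] with t ht
      exact mul_pos ht (two_pos (α := ℝ))
  filter_upwards [this.eventually hw, this.eventually hz] with t h1 h2
  have := hP h1 h2 (a := 1 / 2) (b := 1 / 2) (by norm_num) (by norm_num) (by norm_num)
  convert this using 1
  module

theorem IsPolyhedron.vectorSpan_subset_tangent {P : Set E} (hP : IsPolyhedron P) {x : E}
    (hx : x ∈ relCore P) : (vectorSpan ℝ P : Set E) ⊆ tangent P x := by
  intro w hw
  have hf : Tendsto (fun t : ℝ => t • w) (𝓝[>] 0) (𝓝[vectorSpan ℝ P] 0) := by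
    refine tendsto_nhdsWithin_iff.2 ⟨?_, Eventually.of_forall fun t => ?_⟩
    · have : Continuous fun t : ℝ => t • w := by fun_prop
      exact (this.tendsto' 0 0 (by simp)).mono_left nhdsWithin_le_nhds
    · exact Submodule.smul_mem _ _ hw
  exact hf.eventually (hP.eventually_add_smul_mem hx hw)

theorem tangent_subset_vectorSpan {P : Set E} {x : E} (hx : x ∈ P) :
    tangent P x ⊆ vectorSpan ℝ P := by
  intro w hw
  obtain ⟨t, h1, h2⟩ := ((mem_tangent.1 hw).and self_mem_nhdsWithin).exists
  have h3 := sub_mem_vectorSpan h1 hx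
  rw [add_sub_cancel_left] at h3
  exact (Submodule.smul_mem_iff _ (ne_of_gt h2)).1 h3

theorem tangent_subset_of_subset {P : Set E} {x : E} {V : Submodule ℝ E} (h : P ⊆ V) (hx : x ∈ V) :
    tangent P x ⊆ V := by
  intro w hw
  obtain ⟨t, h1, h2⟩ := ((mem_tangent.1 hw).and self_mem_nhdsWithin).exists
  have h3 := (V.add_mem_iff_right hx).1 (h h1)
  exact (Submodule.smul_mem_iff _ (ne_of_gt h2)).1 h3

/-- The tangent cone is cut out by the homogeneous parts of the constraints active at `x`. -/
theorem IsPolyhedronIn.tangent {V : Submodule ℝ E} {P : Set E} (hP : IsPolyhedronIn V P) {x : E}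
    (hx : x ∈ P) : IsPolyhedronIn V (tangent P x) := by
  have hsub := tangent_subset_of_subset hP.subset (hP.subset hx)
  obtain ⟨S, hS, rfl⟩ := hP
  refine ⟨(fun p : StrongDual ℝ E × ℝ => (p.1, 0)) '' {p ∈ S | p.1 x = p.2},
    (hS.subset fun _ h => h.1).image _, ?_⟩
  ext w
  simp only [Set.mem_ofPred_eq, Set.forall_mem_image]
  constructor
  · intro hw
    refine ⟨hsub hw, fun p hp => ?_⟩
    obtain ⟨t, h1, h2⟩ := ((mem_tangent.1 hw).and self_mem_nhdsWithin).exists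
    have := h1.2 p hp.1
    rw [map_add, map_smul, smul_eq_mul, hp.2] at this
    have h2 : 0 < t := h2
    nlinarith
  · rintro ⟨hwV, hw⟩
    have h1 : ∀ᶠ ε : ℝ in 𝓝[>] 0, ∀ p ∈ S, p.1 (x + ε • w) ≤ p.2 := by
      rw [Filter.eventually_all_finite hS]
      intro p hp
      rcases (hx.2 p hp).eq_or_lt with h' | h'
      · filter_upwards [self_mem_nhdsWithin] with ε hε
        have := hw ⟨hp, h'⟩
        rw [map_add, map_smul, smul_eq_mul, h']
        nlinarith [show 0 < ε from hε]
      · have hc : ContinuousAt (fun ε : ℝ => p.1 (x + ε • w)) 0 := by fun_prop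
        refine ((hc.eventually_lt continuousAt_const ?_).mono fun ε h => h.le).filter_mono
          nhdsWithin_le_nhds
        simpa using h'
    filter_upwards [h1] with ε hε
    exact ⟨V.add_mem hx.1 (V.smul_mem _ hwV), hε⟩

/-- Tangent cones are constant along relative interiors. -/
theorem tangent_eq_of_mem_relCore {σ τ : Set E} (hτ : Convex ℝ τ) (h : σ ⊆ τ) {x y : E}
    (hx : x ∈ relCore σ) (hy : y ∈ relCore σ) : tangent τ x = tangent τ y := by
  suffices H : ∀ x ∈ relCore σ, ∀ y ∈ relCore σ, tangent τ x ⊆ tangent τ y from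
    (H x hx y hy).antisymm (H y hy x hx)
  intro x hx y hy w hw
  obtain ⟨ε, hε, hz⟩ := hy.2 x hx.1
  obtain ⟨t, ht, hxt⟩ := (hτ.mem_tangent_iff (h hx.1)).1 hw
  -- The homothety centred at z = y + ε (y - x) with ratio ε / (1 + ε) maps x to y, and x + t w to y
  -- + (ε / (1 + ε)) t w.
  refine (hτ.mem_tangent_iff (h hy.1)).2 ⟨ε / (1 + ε) * t, by positivity, ?_⟩
  have h1 : 0 < 1 + ε := by linarith
  have := hτ (h hz) hxt (a := 1 / (1 + ε)) (b := ε / (1 + ε)) (by positivity) (by positivity)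
    (by field_simp)
  convert this using 1
  have h2 : ε / (1 + ε) = 1 - 1 / (1 + ε) := by field_simp; ring
  have h3 : (1 / (1 + ε)) * ε = 1 - 1 / (1 + ε) := by field_simp; ring
  rw [smul_add (1 / (1 + ε)), smul_smul, h3, h2]
  module

theorem isConvexCone_inter_tangent {P : Set E} (hP : IsPolyhedron P) {x : E} (hx : x ∈ P)
    (W : Submodule ℝ E) : IsConvexCone ((W : Set E) ∩ tangent P x) := by
  obtain ⟨-, V, hV, hPV⟩ := id hP
  have : FiniteDimensional ℝ (W ⊓ V : Submodule ℝ E) :=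
    Submodule.finiteDimensional_of_le inf_le_right
  exact ((isPolyhedronIn_self W).inter (hPV.tangent hx)).isConvexCone
    ⟨W.zero_mem, zero_mem_tangent hx⟩
    fun c hc y hy => ⟨W.smul_mem _ hy.1, tangent_smul_mem hx hy.2 hc⟩

/-- For `q` in `P` the vector q - x is tangent, so `y` can be prolonged past it inside the tangent
cone. Scaled down into `P`, this yields the prolongation of the segment from `q` past x + t y. -/
theorem mem_relCore_add_smul {P : Set E} (hP : Convex ℝ P) {x y : E} (hx : x ∈ P)
    (hy : y ∈ relCore (tangent P x)) : ∀ᶠ t : ℝ in 𝓝[>] 0, x + t • y ∈ relCore P := by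
  obtain ⟨t₀, ht₀, h₀⟩ := (hP.mem_tangent_iff hx).1 hy.1
  filter_upwards [Ioo_mem_nhdsGT ht₀] with t ht
  have ht0 : 0 < t := ht.1
  refine ⟨?_, fun q hq => ?_⟩
  · have := hP.add_smul_sub_mem hx h₀ (t := t / t₀) ⟨by positivity, (div_le_one ht₀).2 ht.2.le⟩
    rwa [add_sub_cancel_left, smul_smul, div_mul_cancel₀ _ ht₀.ne'] at this
  · have hq' : q - x ∈ tangent P x :=
      (hP.mem_tangent_iff hx).2 ⟨1, one_pos, by simpa using hq⟩
    obtain ⟨ε, hε, hz⟩ := hy.2 _ hq'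
    obtain ⟨s, hs, hsz⟩ := (hP.mem_tangent_iff hx).1 hz
    -- The two quantities are α and α + β, where α, β and 1 - α - β are the weights of the
    -- combination below. As δ → 0 they tend to t / t₀, which lies strictly between 0 and 1.
    have hev : ∀ᶠ δ : ℝ in 𝓝 0, 0 < ((1 + δ) * t - δ * (1 + ε) / ε) / t₀ ∧
        ((1 + δ) * t - δ * (1 + ε) / ε) / t₀ + δ / ε / s < 1 := by
      have hc1 : Continuous fun δ : ℝ => ((1 + δ) * t - δ * (1 + ε) / ε) / t₀ := by fun_prop
      have hc2 : Continuous fun δ : ℝ =>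
        ((1 + δ) * t - δ * (1 + ε) / ε) / t₀ + δ / ε / s := by fun_prop
      refine (continuousAt_const.eventually_lt hc1.continuousAt ?_).and
        (hc2.continuousAt.eventually_lt continuousAt_const ?_)
      · simpa using div_pos ht0 ht₀
      · simpa using (div_lt_one ht₀).2 ht.2
    obtain ⟨δ, ⟨h1, h2⟩, hδ⟩ := ((hev.filter_mono nhdsWithin_le_nhds).and
      (self_mem_nhdsWithin (a := (0 : ℝ)) (s := Set.Ioi 0))).exists
    have hδ : 0 < δ := hδ
    refine ⟨δ, hδ, ?_⟩
    set α := ((1 + δ) * t - δ * (1 + ε) / ε) / t₀ with hα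
    set β := δ / ε / s with hβ
    have hαt : α * t₀ = (1 + δ) * t - δ * (1 + ε) / ε := by rw [hα]; field_simp
    have hβs : β * s = δ / ε := by rw [hβ]; field_simp
    have hmem := hP.sum_mem (t := Finset.univ) (w := ![α, β, 1 - α - β])
      (z := ![x + t₀ • y, x + s • (y + ε • (y - (q - x))), x])
      (by
        intro i _
        fin_cases i
        · exact h1.le
        · change 0 ≤ β; positivity
        · change 0 ≤ 1 - α - β; linarith)
      (by simp [Fin.sum_univ_three])
      (by
        intro i _
        fin_cases i
        · exact h₀
        · exact hsz
        · exact hx)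
    rw [Fin.sum_univ_three] at hmem
    simp only [Matrix.cons_val_zero, Matrix.cons_val_one, Matrix.cons_val] at hmem
    convert hmem using 1
    rw [smul_add α, smul_smul, hαt, smul_add β, smul_smul, hβs, smul_add (δ / ε), smul_smul,
      div_mul_cancel₀ _ hε.ne']
    have h3 : δ * (1 + ε) / ε = δ / ε + δ := by field_simp
    rw [h3]
    module

/-- The origin of the ray lies in `P` by closedness, and the half-open segment from it to one
relative interior point stays in the relative interior. -/
theorem IsPolyhedron.eventually_mem_relCore_of_frequently {P : Set E} (hP : IsPolyhedron P) {x w : E}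
    (h : ∃ᶠ t : ℝ in 𝓝[>] 0, x + t • w ∈ relCore P) :
    ∀ᶠ t : ℝ in 𝓝[>] 0, x + t • w ∈ relCore P := by
  have hx : x ∈ P := mem_of_mem_tangent hP.isClosed
    (hP.convex.frequently_mem_tangent hP.isClosed (h.mono fun t ht => ht.1))
  obtain ⟨t, h2, ht⟩ := (h.and_eventually self_mem_nhdsWithin).exists
  have ht : 0 < t := ht
  filter_upwards [Ioc_mem_nhdsGT ht] with s hs
  have := hP.convex.lineMap_mem_relCore h2 hx (t := s / t) (div_pos hs.1 ht)
    ((div_le_one ht).2 hs.2)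
  rwa [add_sub_cancel_left, smul_smul, div_mul_cancel₀ _ ht.ne'] at this

end RelCore

/-! ### Polyhedral complexes -/

section Complexes

set_option linter.unusedSectionVars false

variable {E : Type u} [NormedAddCommGroup E] [InnerProductSpace ℝ E]

/-- A finite set of polyhedra such that each point of a cell is in the relative interior of some
cell, and a cell is contained in every cell that meets its relative interior. -/
structure IsComplex (K : Finset (Set E)) : Prop where
  poly : ∀ σ ∈ K, IsPolyhedron σ
  exists_mem_relCore : ∀ σ ∈ K, ∀ x ∈ σ, ∃ ρ ∈ K, x ∈ relCore ρ
  subset : ∀ σ ∈ K, ∀ τ ∈ K, ∀ x, x ∈ relCore σ → x ∈ τ → σ ⊆ τ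

/-- A boundary point of `τ` lies in a proper face, which is a union of cells, hence in a strictly
smaller cell. By induction on the number of smaller cells, every point of `τ` is interior to a cell
inside `τ`; disjointness of interiors identifies that cell. -/
theorem IsCellStructure.isComplex {𝒞 : Set E → Prop} {K : Finset (Set E)} {P : Set E}
    (h : IsCellStructure 𝒞 K P) (h𝒞 : ∀ σ, 𝒞 σ → IsPolyhedron σ) : IsComplex K := by
  have hpoly : ∀ σ ∈ K, IsPolyhedron σ := fun σ hσ => h𝒞 σ (h.cell σ hσ)
  have key : ∀ n : ℕ, ∀ τ ∈ K, {σ ∈ (K : Set (Set E)) | σ ⊂ τ}.ncard = n → ∀ x ∈ τ,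
      ∃ σ ∈ K, σ ⊆ τ ∧ x ∈ relCore σ := by
    intro n
    induction n using Nat.strong_induction_on with
    | _ n ih =>
      intro τ hτ hn x hx
      by_cases hxc : x ∈ relCore τ
      · exact ⟨τ, hτ, subset_rfl, hxc⟩
      obtain ⟨φ, hφ, hxφ, hφτ⟩ := (hpoly τ hτ).exists_exposed hx hxc
      obtain ⟨L, hL, rfl⟩ := h.face τ hτ φ hφ
      obtain ⟨ρ, hρL, hxρ⟩ := hxφ
      have hρτ : ρ ⊂ τ := (Set.subset_sUnion_of_mem hρL).trans_ssubset hφτ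
      have hlt : {σ ∈ (K : Set (Set E)) | σ ⊂ ρ}.ncard < n := by
        rw [← hn]
        refine Set.ncard_lt_ncard ⟨fun σ hσ => ⟨hσ.1, hσ.2.trans hρτ⟩, fun hsub => ?_⟩
          (K.finite_toSet.subset fun _ h => h.1)
        exact (hsub ⟨hL hρL, hρτ⟩).2.ne rfl
      obtain ⟨σ, hσ, hσρ, hxσ⟩ := ih _ hlt ρ (hL hρL) rfl x hxρ
      exact ⟨σ, hσ, hσρ.trans hρτ.subset, hxσ⟩
  refine ⟨hpoly, fun σ hσ x hx => ?_, fun σ hσ τ hτ x hxσ hxτ => ?_⟩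
  · obtain ⟨ρ, hρ, -, h2⟩ := key _ σ hσ rfl x hx
    exact ⟨ρ, hρ, h2⟩
  · obtain ⟨ρ, hρ, hρτ, hxρ⟩ := key _ τ hτ rfl x hxτ
    rw [h.eq_of_mem_interior σ hσ ρ hρ x ((hpoly σ hσ).intrinsicInterior_eq ▸ hxσ)
      ((hpoly ρ hρ).intrinsicInterior_eq ▸ hxρ)]
    exact hρτ

theorem IsComplex.eq_of_mem {K : Finset (Set E)} (h : IsComplex K) {σ τ : Set E} (hσ : σ ∈ K)
    (hτ : τ ∈ K) {x : E} (hxσ : x ∈ relCore σ) (hxτ : x ∈ relCore τ) : σ = τ :=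
  (h.subset σ hσ τ hτ x hxσ hxτ.1).antisymm (h.subset τ hτ σ hσ x hxτ hxσ.1)

theorem IsComplex.isCellStructure {𝒞 : Set E → Prop} {K : Finset (Set E)}
    (h : IsComplex K) (h𝒞 : ∀ σ ∈ K, 𝒞 σ) : IsCellStructure 𝒞 K (⋃₀ (K : Set (Set E))) := by
  classical
  refine ⟨h𝒞, fun σ hσ τ hτ => ?_, fun σ hσ τ hτ x hxσ hxτ => ?_, rfl⟩
  · refine ⟨K.filter (· ⊆ τ), Finset.filter_subset _ _, ?_⟩
    ext x
    simp only [Set.mem_sUnion, Finset.mem_coe, Finset.mem_filter]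
    constructor
    · intro hx
      obtain ⟨ρ, hρ, hxρ⟩ := h.exists_mem_relCore σ hσ x (hτ.subset hx)
      exact ⟨ρ, ⟨hρ, hτ.subset_of_mem_relCore (h.subset ρ hρ σ hσ x hxρ (hτ.subset hx)) hxρ hx⟩,
        hxρ.1⟩
    · rintro ⟨ρ, ⟨-, h1⟩, h2⟩
      exact h1 h2
  · rw [(h.poly σ hσ).intrinsicInterior_eq] at hxσ
    rw [(h.poly τ hτ).intrinsicInterior_eq] at hxτ
    exact h.eq_of_mem hσ hτ hxσ hxτ

/-- `Q` is a union of cells of `K`. -/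
structure Adapted (K : Finset (Set E)) (Q : Set E) : Prop where
  exists_mem_relCore : ∀ x ∈ Q, ∃ σ ∈ K, x ∈ relCore σ
  subset : ∀ σ ∈ K, ∀ x ∈ relCore σ, x ∈ Q → σ ⊆ Q

open Classical in
/-- The cells of `K` that are contained in `Q`. -/
noncomputable def below (K : Finset (Set E)) (Q : Set E) : Finset (Set E) := K.filter (· ⊆ Q)

@[simp] theorem mem_below {K : Finset (Set E)} {Q σ : Set E} :
    σ ∈ below K Q ↔ σ ∈ K ∧ σ ⊆ Q := by
  classical
  exact Finset.mem_filter

theorem below_subset (K : Finset (Set E)) (Q : Set E) : below K Q ⊆ K :=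
  fun _ h => (mem_below.1 h).1

theorem IsComplex.below {K : Finset (Set E)} (h : IsComplex K) (Q : Set E) :
    IsComplex (below K Q) where
  poly σ hσ := h.poly σ (mem_below.1 hσ).1
  exists_mem_relCore σ hσ x hx := by
    rw [mem_below] at hσ
    obtain ⟨ρ, hρ, hxρ⟩ := h.exists_mem_relCore σ hσ.1 x hx
    exact ⟨ρ, mem_below.2 ⟨hρ, (h.subset ρ hρ σ hσ.1 x hxρ hx).trans hσ.2⟩, hxρ⟩
  subset σ hσ τ hτ := h.subset σ (mem_below.1 hσ).1 τ (mem_below.1 hτ).1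

theorem Adapted.sUnion_below {K : Finset (Set E)} {Q : Set E} (h : Adapted K Q) :
    ⋃₀ (below K Q : Set (Set E)) = Q := by
  ext x
  constructor
  · rintro ⟨σ, hσ, hx⟩
    exact (mem_below.1 hσ).2 hx
  · intro hx
    obtain ⟨σ, hσ, hxσ⟩ := h.exists_mem_relCore x hx
    exact ⟨σ, mem_below.2 ⟨hσ, h.subset σ hσ x hxσ hx⟩, hxσ.1⟩

theorem IsComplex.adapted_sUnion {K : Finset (Set E)} (h : IsComplex K) :
    Adapted K (⋃₀ (K : Set (Set E))) where
  exists_mem_relCore := by rintro x ⟨σ, hσ, hx⟩; exact h.exists_mem_relCore σ hσ x hx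
  subset σ hσ _ _ _ := Set.subset_sUnion_of_mem hσ

theorem IsComplex.adapted_cell {K : Finset (Set E)} (h : IsComplex K) {τ : Set E} (hτ : τ ∈ K) :
    Adapted K τ where
  exists_mem_relCore := h.exists_mem_relCore τ hτ
  subset σ hσ x hx hxτ := h.subset σ hσ τ hτ x hx hxτ

theorem Adapted.union {K : Finset (Set E)} {P Q : Set E} (hP : Adapted K P) (hQ : Adapted K Q) :
    Adapted K (P ∪ Q) where
  exists_mem_relCore x hx := hx.elim (hP.exists_mem_relCore x) (hQ.exists_mem_relCore x)
  subset σ hσ x hx h := h.elim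
    (fun h => (hP.subset σ hσ x hx h).trans Set.subset_union_left)
    (fun h => (hQ.subset σ hσ x hx h).trans Set.subset_union_right)

theorem Adapted.inter {K : Finset (Set E)} {P Q : Set E} (hP : Adapted K P) (hQ : Adapted K Q) :
    Adapted K (P ∩ Q) where
  exists_mem_relCore x hx := hP.exists_mem_relCore x hx.1
  subset σ hσ x hx h := Set.subset_inter (hP.subset σ hσ x hx h.1) (hQ.subset σ hσ x hx h.2)

theorem adapted_biUnion {ι : Type*} {K : Finset (Set E)} {s : Set ι} {P : ι → Set E}
    (h : ∀ i ∈ s, Adapted K (P i)) : Adapted K (⋃ i ∈ s, P i) where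
  exists_mem_relCore x hx := by
    obtain ⟨i, hi, hx⟩ := Set.mem_iUnion₂.1 hx
    exact (h i hi).exists_mem_relCore x hx
  subset σ hσ x hx hxQ := by
    obtain ⟨i, hi, hxQ⟩ := Set.mem_iUnion₂.1 hxQ
    exact ((h i hi).subset σ hσ x hx hxQ).trans (Set.subset_biUnion_of_mem (u := P) hi)

theorem IsComplex.adapted_boundary {K : Finset (Set E)} (h : IsComplex K) {τ : Set E}
    (hτ : τ ∈ K) : Adapted K (τ \ relCore τ) where
  exists_mem_relCore x hx := h.exists_mem_relCore τ hτ x hx.1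
  subset σ hσ x hx hxτ y hy := by
    have hsub := h.subset σ hσ τ hτ x hx hxτ.1
    refine ⟨hsub hy, fun hyc => hxτ.2 ?_⟩
    rwa [(h.subset τ hτ σ hσ y hyc hy).antisymm hsub]

/-! ### Unions of cells -/

/-- A finite union of cells. -/
def IsUnion (𝒞 : Set E → Prop) (P : Set E) : Prop :=
  ∃ T : Finset (Set E), (∀ C ∈ T, 𝒞 C) ∧ P = ⋃₀ (T : Set (Set E))

theorem Adapted.isUnion {𝒞 : Set E → Prop} {K : Finset (Set E)} (hK : ∀ σ ∈ K, 𝒞 σ) {Q : Set E}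
    (h : Adapted K Q) : IsUnion 𝒞 Q :=
  ⟨below K Q, fun σ hσ => hK σ (mem_below.1 hσ).1, h.sUnion_below.symm⟩

theorem isUnion_of_cell {𝒞 : Set E → Prop} {C : Set E} (h : 𝒞 C) : IsUnion 𝒞 C :=
  ⟨{C}, by simpa using h, by simp⟩

theorem isUnion_empty {𝒞 : Set E → Prop} : IsUnion 𝒞 (∅ : Set E) :=
  ⟨∅, by simp, by simp⟩

theorem IsUnion.union {𝒞 : Set E → Prop} {P Q : Set E} (hP : IsUnion 𝒞 P) (hQ : IsUnion 𝒞 Q) :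
    IsUnion 𝒞 (P ∪ Q) := by
  classical
  obtain ⟨S, hS, rfl⟩ := hP
  obtain ⟨T, hT, rfl⟩ := hQ
  refine ⟨S ∪ T, fun C hC => (Finset.mem_union.1 hC).elim (hS C) (hT C), ?_⟩
  rw [Finset.coe_union, Set.sUnion_union]

/-- The families of cells to which the theory of the star product applies. -/
structure IsCellKind (𝒞 : Set E → Prop) : Prop where
  poly : ∀ σ, 𝒞 σ → IsPolyhedron σ
  exists_complex : ∀ T : Finset (Set E), (∀ C ∈ T, 𝒞 C) → ∃ K : Finset (Set E), IsComplex K ∧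
    (∀ σ ∈ K, 𝒞 σ) ∧ ⋃₀ (K : Set (Set E)) = ⋃₀ (T : Set (Set E)) ∧ ∀ C ∈ T, Adapted K C
  add : ∀ σ τ, 𝒞 σ → 𝒞 τ → 𝒞 (σ + τ)
  zero : 𝒞 {0}

theorem IsCellKind.exists_complex_of_isUnion {𝒞 : Set E → Prop} (h𝒞 : IsCellKind 𝒞) {ι : Type*}
    [Finite ι] {P : ι → Set E} (hP : ∀ i, IsUnion 𝒞 (P i)) :
    ∃ K : Finset (Set E), IsComplex K ∧ (∀ σ ∈ K, 𝒞 σ) ∧ ∀ i, Adapted K (P i) := by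
  classical
  have := Fintype.ofFinite ι
  choose T hT hPT using hP
  obtain ⟨K, hK, hK𝒞, -, had⟩ := h𝒞.exists_complex (Finset.univ.biUnion T) (by
    intro C hC
    obtain ⟨i, -, hi⟩ := Finset.mem_biUnion.1 hC
    exact hT i C hi)
  refine ⟨K, hK, hK𝒞, fun i => ?_⟩
  rw [hPT i, Set.sUnion_eq_biUnion]
  exact adapted_biUnion fun C hC => had C (Finset.mem_biUnion.2 ⟨i, Finset.mem_univ _, hC⟩)

theorem IsUnion.inter {𝒞 : Set E → Prop} (h𝒞 : IsCellKind 𝒞) {P Q : Set E} (hP : IsUnion 𝒞 P)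
    (hQ : IsUnion 𝒞 Q) : IsUnion 𝒞 (P ∩ Q) := by
  obtain ⟨K, -, hK, had⟩ := h𝒞.exists_complex_of_isUnion (P := fun b : Bool => cond b P Q)
    (by intro b; cases b <;> assumption)
  exact ((had true).inter (had false)).isUnion hK

theorem IsUnion.add {𝒞 : Set E → Prop} (h𝒞 : IsCellKind 𝒞) {P Q : Set E} (hP : IsUnion 𝒞 P)
    (hQ : IsUnion 𝒞 Q) : IsUnion 𝒞 (P + Q) := by
  classical
  obtain ⟨S, hS, rfl⟩ := hP
  obtain ⟨T, hT, rfl⟩ := hQ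
  refine ⟨Finset.image₂ (· + ·) S T, fun C hC => ?_, ?_⟩
  · obtain ⟨A, hA, B, hB, rfl⟩ := Finset.mem_image₂.1 hC
    exact h𝒞.add A B (hS A hA) (hT B hB)
  · ext x
    simp only [Set.mem_add, Set.mem_sUnion, Finset.mem_coe, Finset.mem_image₂]
    constructor
    · rintro ⟨a, ⟨A, hA, ha⟩, b, ⟨B, hB, hb⟩, rfl⟩
      exact ⟨A + B, ⟨A, hA, B, hB, rfl⟩, Set.add_mem_add ha hb⟩
    · rintro ⟨_, ⟨A, hA, B, hB, rfl⟩, a, ha, b, hb, rfl⟩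
      exact ⟨a, ⟨A, hA, ha⟩, b, ⟨B, hB, hb⟩, rfl⟩

theorem IsUnion.isClosed {𝒞 : Set E → Prop} (h𝒞 : IsCellKind 𝒞) {P : Set E}
    (hP : IsUnion 𝒞 P) : IsClosed P := by
  obtain ⟨T, hT, rfl⟩ := hP
  rw [Set.sUnion_eq_biUnion]
  exact T.finite_toSet.isClosed_biUnion fun C hC => (h𝒞.poly C (hT C hC)).isClosed

/-! ### Hyperplane arrangements -/

/-- The closed cell through `y` of the arrangement of affine hyperplanes `S` in `V`. -/
def signCell (V : Submodule ℝ E) (S : Set (StrongDual ℝ E × ℝ)) (y : E) : Set E :=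
  {z | z ∈ V ∧ ∀ p ∈ S, (p.1 y ≤ p.2 → p.1 z ≤ p.2) ∧ (p.2 ≤ p.1 y → p.2 ≤ p.1 z)}

theorem mem_signCell_self {V : Submodule ℝ E} {S : Set (StrongDual ℝ E × ℝ)} {y : E} (hy : y ∈ V) :
    y ∈ signCell V S y := ⟨hy, fun _ _ => ⟨id, id⟩⟩

theorem isPolyhedronIn_signCell (V : Submodule ℝ E) {S : Set (StrongDual ℝ E × ℝ)} (hS : S.Finite)
    (y : E) : IsPolyhedronIn V (signCell V S y) := by
  refine ⟨{p ∈ S | p.1 y ≤ p.2} ∪ (fun p => -p) '' {p ∈ S | p.2 ≤ p.1 y},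
    (hS.subset fun _ h => h.1).union ((hS.subset fun _ h => h.1).image _), ?_⟩
  ext z
  refine and_congr_right fun _ => ?_
  constructor
  · rintro h p (hp | ⟨p, hp, rfl⟩)
    · exact (h p hp.1).1 hp.2
    · simpa using (h p hp.1).2 hp.2
  · refine fun h p hp => ⟨fun h1 => h p (Or.inl ⟨hp, h1⟩), fun h1 => ?_⟩
    simpa using h (-p) (Or.inr ⟨p, ⟨hp, h1⟩, rfl⟩)

theorem mem_relCore_signCell {V : Submodule ℝ E} {S : Set (StrongDual ℝ E × ℝ)} (hS : S.Finite)
    {y : E} (hy : y ∈ V) : y ∈ relCore (signCell V S y) := by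
  refine ⟨mem_signCell_self hy, fun z hz => ?_⟩
  have h1 : ∀ᶠ ε : ℝ in 𝓝 0, ∀ p ∈ S, (p.1 y ≤ p.2 → p.1 (y + ε • (y - z)) ≤ p.2) ∧
      (p.2 ≤ p.1 y → p.2 ≤ p.1 (y + ε • (y - z))) := by
    rw [Filter.eventually_all_finite hS]
    intro p hp
    have hc : ContinuousAt (fun ε : ℝ => p.1 (y + ε • (y - z))) 0 := by fun_prop
    rcases lt_trichotomy (p.1 y) p.2 with h | h | h
    · filter_upwards [hc.eventually_lt continuousAt_const (by simpa using h)] with ε hε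
      exact ⟨fun _ => hε.le, fun h' => absurd h' h.not_ge⟩
    · have : p.1 z = p.2 := le_antisymm ((hz.2 p hp).1 h.le) ((hz.2 p hp).2 h.ge)
      exact Eventually.of_forall fun ε => by simp [h, this]
    · filter_upwards [continuousAt_const.eventually_lt hc (by simpa using h)] with ε hε
      exact ⟨fun h' => absurd h' h.not_ge, fun _ => hε.le⟩
  obtain ⟨ε, h1, hε⟩ := ((h1.filter_mono nhdsWithin_le_nhds).and
    (self_mem_nhdsWithin (a := (0 : ℝ)) (s := Set.Ioi 0))).exists
  exact ⟨ε, hε, V.add_mem hy (V.smul_mem _ (V.sub_mem hy hz.1)), h1⟩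

/-- Prolonging from `x` past `y` stays in the cell, so no constraint strict at `x` can be active at
`y`: the sign pattern is constant on an open cell. -/
theorem le_iff_of_mem_relCore_signCell {V : Submodule ℝ E} {S : Set (StrongDual ℝ E × ℝ)} {x y : E}
    (hx : x ∈ V) (hy : y ∈ relCore (signCell V S x)) {p : StrongDual ℝ E × ℝ} (hp : p ∈ S) :
    (p.1 y ≤ p.2 → p.1 x ≤ p.2) ∧ (p.2 ≤ p.1 y → p.2 ≤ p.1 x) := by
  obtain ⟨ε, hε, h⟩ := hy.2 x (mem_signCell_self hx)
  have h1 := h.2 p hp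
  have h2 := hy.1.2 p hp
  simp only [map_add, map_smul, map_sub, smul_eq_mul] at h1
  constructor
  · intro h3
    by_contra! h4
    have h5 := h1.2 h4.le
    nlinarith
  · intro h3
    by_contra! h4
    have h5 := h1.1 h4.le
    nlinarith

/-- The cells are those through points of the union of `T`. They are finitely many, being determined
by two subsets of `S`, and each set in `T` is a union of cells as its constraints belong to `S`. -/
theorem exists_complex_signCell (V : Submodule ℝ E) [FiniteDimensional ℝ V]
    {S : Set (StrongDual ℝ E × ℝ)} (hS : S.Finite) (T : Finset (Set E))
    (hT : ∀ C ∈ T, ∃ S' ⊆ S, C = {x | x ∈ V ∧ ∀ p ∈ S', p.1 x ≤ p.2}) :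
    ∃ K : Finset (Set E), IsComplex K ∧
      (∀ σ ∈ K, ∃ y ∈ ⋃₀ (T : Set (Set E)), σ = signCell V S y) ∧
      ⋃₀ (K : Set (Set E)) = ⋃₀ (T : Set (Set E)) ∧ ∀ C ∈ T, Adapted K C := by
  have hfin : (signCell V S '' ⋃₀ (T : Set (Set E))).Finite := by
    let g : Set (StrongDual ℝ E × ℝ) × Set (StrongDual ℝ E × ℝ) → Set E := fun q =>
      {z | z ∈ V ∧ ∀ p ∈ S, (p ∈ q.1 → p.1 z ≤ p.2) ∧ (p ∈ q.2 → p.2 ≤ p.1 z)}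
    have h1 : (g '' ({s | s ⊆ S} ×ˢ {s | s ⊆ S})).Finite :=
      (hS.finite_subsets.prod hS.finite_subsets).image g
    refine h1.subset ?_
    rintro _ ⟨y, -, rfl⟩
    refine ⟨({p ∈ S | p.1 y ≤ p.2}, {p ∈ S | p.2 ≤ p.1 y}),
      ⟨fun p hp => hp.1, fun p hp => hp.1⟩, ?_⟩
    ext z
    refine and_congr_right fun _ => forall₂_congr fun p hp => ?_
    simp [hp]
  have hTV : ∀ C ∈ T, C ⊆ V := by
    intro C hC
    obtain ⟨S', -, rfl⟩ := hT C hC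
    exact fun x hx => hx.1
  have hsub : ∀ y, ∀ C ∈ T, y ∈ C → signCell V S y ⊆ C := by
    intro y C hC hy z hz
    obtain ⟨S', hS', rfl⟩ := hT C hC
    exact ⟨hz.1, fun p hp => (hz.2 p (hS' hp)).1 (hy.2 p hp)⟩
  have hV : ⋃₀ (T : Set (Set E)) ⊆ V := Set.sUnion_subset hTV
  have hmem : ∀ σ ∈ hfin.toFinset, ∃ y ∈ ⋃₀ (T : Set (Set E)), σ = signCell V S y := by
    intro σ hσ
    obtain ⟨y, hy, rfl⟩ := hfin.mem_toFinset.1 hσ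
    exact ⟨y, hy, rfl⟩
  have hU : ⋃₀ (hfin.toFinset : Set (Set E)) = ⋃₀ (T : Set (Set E)) := by
    rw [Set.Finite.coe_toFinset]
    apply Set.Subset.antisymm
    · rintro x ⟨_, ⟨y, ⟨C, hC, hy⟩, rfl⟩, hx⟩
      exact ⟨C, hC, hsub y C hC hy hx⟩
    · intro x hx
      exact ⟨_, ⟨x, hx, rfl⟩, mem_signCell_self (hV hx)⟩
  have hcore : ∀ x ∈ ⋃₀ (T : Set (Set E)), ∃ ρ ∈ hfin.toFinset, x ∈ relCore ρ := fun x hx =>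
    ⟨_, hfin.mem_toFinset.2 ⟨x, hx, rfl⟩, mem_relCore_signCell hS (hV hx)⟩
  refine ⟨hfin.toFinset, ⟨?_, fun σ hσ x hx => hcore x (hU ▸ ⟨σ, hσ, hx⟩), ?_⟩, hmem, hU,
    fun C hC => ⟨fun x hx => hcore x ⟨C, hC, hx⟩, ?_⟩⟩
  · intro σ hσ
    obtain ⟨y, hy, rfl⟩ := hmem σ hσ
    exact ⟨⟨y, mem_signCell_self (hV hy)⟩, V, inferInstance, isPolyhedronIn_signCell V hS y⟩
  · intro σ hσ τ hτ y hyσ hyτ z hz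
    obtain ⟨x, hx, rfl⟩ := hmem σ hσ
    obtain ⟨x', hx', rfl⟩ := hmem τ hτ
    refine ⟨hz.1, fun p hp => ?_⟩
    have h1 := le_iff_of_mem_relCore_signCell (hV hx) hyσ hp
    exact ⟨fun h => (hz.2 p hp).1 (h1.1 ((hyτ.2 p hp).1 h)),
      fun h => (hz.2 p hp).2 (h1.2 ((hyτ.2 p hp).2 h))⟩
  · intro σ hσ y hyσ hyC z hz
    obtain ⟨x, hx, rfl⟩ := hmem σ hσ
    obtain ⟨S', hS', rfl⟩ := hT C hC
    exact ⟨hz.1, fun p hp => (hz.2 p (hS' hp)).1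
      ((le_iff_of_mem_relCore_signCell (hV hx) hyσ (hS' hp)).1 (hyC.2 p hp))⟩

end Complexes

/-! ### Cones and polytopes as unions of cells -/

section Kinds

set_option linter.unusedSectionVars false

variable {E : Type u} [NormedAddCommGroup E] [InnerProductSpace ℝ E]

theorem IsConvexCone.exists_submodule {C : Set E} (hC : IsConvexCone C) :
    ∃ V : Submodule ℝ E, FiniteDimensional ℝ V ∧ C ⊆ V := by
  obtain ⟨s, rfl⟩ := hC.exists_finset
  exact ⟨Submodule.span ℝ s, FiniteDimensional.span_finset ℝ s, fun x hx =>
    (Submodule.span_le (p := PointedCone.ofSubmodule (Submodule.span ℝ (s : Set E)))).2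
      Submodule.subset_span hx⟩

theorem IsConvexPolytope.exists_submodule {C : Set E} (hC : IsConvexPolytope C) :
    ∃ V : Submodule ℝ E, FiniteDimensional ℝ V ∧ IsPolyhedronIn V C := by
  obtain ⟨s, hs, rfl⟩ := hC
  have := FiniteDimensional.span_finset ℝ s
  exact ⟨Submodule.span ℝ s, this, isPolyhedronIn_convexHull _ hs Submodule.subset_span⟩

theorem IsConvexCone.isPolyhedron {C : Set E} (hC : IsConvexCone C) : IsPolyhedron C := by
  obtain ⟨V, hV, h⟩ := hC.exists_submodule
  exact ⟨hC.nonempty, V, hV, hC.isPolyhedronIn h⟩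

theorem IsConvexPolytope.isPolyhedron {C : Set E} (hC : IsConvexPolytope C) : IsPolyhedron C := by
  refine ⟨?_, hC.exists_submodule⟩
  obtain ⟨s, hs, rfl⟩ := hC
  simpa using hs

theorem IsConvexPolytope.isBounded {C : Set E} (hC : IsConvexPolytope C) :
    Bornology.IsBounded C := by
  obtain ⟨s, hs, rfl⟩ := hC
  exact isBounded_convexHull.2 s.finite_toSet.isBounded

theorem IsConvexCone.add {C D : Set E} (hC : IsConvexCone C) (hD : IsConvexCone D) :
    IsConvexCone (C + D) := by
  obtain ⟨C, hC, rfl⟩ := hC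
  obtain ⟨D, hD, rfl⟩ := hD
  exact ⟨C ⊔ D, hC.sup hD, (Submodule.coe_sup C D).symm⟩

theorem isConvexCone_zero : IsConvexCone ({0} : Set E) :=
  ⟨⊥, Submodule.fg_bot, by simp⟩

theorem exists_common_submodule (T : Finset (Set E))
    (hT : ∀ C ∈ T, ∃ V : Submodule ℝ E, FiniteDimensional ℝ V ∧ C ⊆ V) :
    ∃ V : Submodule ℝ E, FiniteDimensional ℝ V ∧ ∀ C ∈ T, C ⊆ V := by
  choose! V hV hVC using hT
  have : ∀ C : T, FiniteDimensional ℝ (V C) := fun C => hV C C.2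
  exact ⟨⨆ C : T, V C, inferInstance, fun C hC =>
    (hVC C hC).trans (le_iSup (fun C : T => V C) ⟨C, hC⟩)⟩

theorem isCellKind_convexCone : IsCellKind (IsConvexCone (E := E)) where
  poly _ h := h.isPolyhedron
  add _ _ h1 h2 := h1.add h2
  zero := isConvexCone_zero
  exists_complex T hT := by
    obtain ⟨V, hV, hTV⟩ := exists_common_submodule T fun C hC => (hT C hC).exists_submodule
    have h1 : ∀ C ∈ T, ∃ S : Set (StrongDual ℝ E), S.Finite ∧
        C = {x | x ∈ V ∧ ∀ a ∈ S, a x ≤ 0} := fun C hC =>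
      ((hT C hC).isPolyhedronIn (hTV C hC)).exists_homogeneous (hT C hC).zero_mem
        fun c hc x hx => (hT C hC).smul_mem hc hx
    choose! S hS hST using h1
    let f : StrongDual ℝ E → StrongDual ℝ E × ℝ := fun a => (a, 0)
    have hfin : (⋃ C ∈ T, f '' S C).Finite :=
      T.finite_toSet.biUnion fun C hC => (hS C hC).image f
    obtain ⟨K, hK, hcell, hU, had⟩ := exists_complex_signCell V hfin T fun C hC =>
      ⟨f '' S C, Set.subset_biUnion_of_mem (u := fun C => f '' S C) hC, by
        rw [hST C hC]
        ext x
        simp [f, ← hST C hC]⟩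
    refine ⟨K, hK, fun σ hσ => ?_, hU, had⟩
    obtain ⟨y, -, rfl⟩ := hcell σ hσ
    have hp : ∀ p ∈ ⋃ C ∈ T, f '' S C, p.2 = 0 := by
      intro p hp
      simp only [Set.mem_iUnion] at hp
      obtain ⟨C, -, a, -, rfl⟩ := hp
      rfl
    -- All hyperplanes of the arrangement pass through 0, so its cells are cones.
    refine (isPolyhedronIn_signCell V hfin y).isConvexCone ⟨V.zero_mem, fun p h => ?_⟩
      fun c hc x hx => ⟨V.smul_mem _ hx.1, fun p h => ?_⟩
    · simp [hp p h]
    · have := hx.2 p h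
      rw [hp p h] at this ⊢
      rw [map_smul, smul_eq_mul]
      exact ⟨fun h => mul_nonpos_of_nonneg_of_nonpos hc (this.1 h),
        fun h => mul_nonneg hc (this.2 h)⟩

theorem isCellKind_convexPolytope : IsCellKind (IsConvexPolytope (E := E)) where
  poly _ h := h.isPolyhedron
  add := by
    classical
    rintro _ _ ⟨s, hs, rfl⟩ ⟨t, ht, rfl⟩
    exact ⟨s + t, hs.add ht, by rw [Finset.coe_add, convexHull_add]⟩
  zero := ⟨{0}, by simp⟩
  exists_complex T hT := by
    obtain ⟨V, hV, hTV⟩ := exists_common_submodule T fun C hC => by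
      obtain ⟨V, hV, h⟩ := (hT C hC).exists_submodule
      exact ⟨V, hV, h.subset⟩
    have h1 : ∀ C ∈ T, ∃ S : Set (StrongDual ℝ E × ℝ), S.Finite ∧
        C = {x | x ∈ V ∧ ∀ p ∈ S, p.1 x ≤ p.2} := fun C hC => by
      obtain ⟨s, hs, hsC⟩ := hT C hC
      exact hsC ▸ isPolyhedronIn_convexHull V hs
        ((subset_convexHull ℝ _).trans (hsC ▸ hTV C hC))
    choose! S hS hST using h1
    have hfin : (⋃ C ∈ T, S C).Finite := T.finite_toSet.biUnion hS
    obtain ⟨K, hK, hcell, hU, had⟩ := exists_complex_signCell V hfin T fun C hC =>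
      ⟨S C, Set.subset_biUnion_of_mem (u := fun C => S C) hC, hST C hC⟩
    refine ⟨K, hK, fun σ hσ => ?_, hU, had⟩
    obtain ⟨y, ⟨C, hC, hy⟩, rfl⟩ := hcell σ hσ
    have hyV := hTV C hC hy
    -- The cell through `y` is bounded because it lies in the polytope `C` that contains `y`.
    exact (isPolyhedronIn_signCell V hfin y).isConvexPolytope ⟨y, mem_signCell_self hyV⟩
      ((hT C hC).isBounded.subset
        ((had C hC).subset _ hσ y (mem_relCore_signCell hfin hyV) hy))

theorem IsCone.zero_mem {P : Set E} (h : IsCone P) (hne : P.Nonempty) : (0 : E) ∈ P := by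
  obtain ⟨T, hT, rfl⟩ := h
  obtain ⟨x, C, hC, hx⟩ := hne
  exact ⟨C, hC, (hT C hC).zero_mem⟩

theorem IsCone.vectorSpan_le_iff {P : Set E} (h : IsCone P) {V : Submodule ℝ E} :
    vectorSpan ℝ P ≤ V ↔ P ⊆ V := by
  refine ⟨fun hV x hx => ?_, vectorSpan_le_of_subset⟩
  have := hV (sub_mem_vectorSpan hx (h.zero_mem ⟨x, hx⟩))
  rwa [sub_zero] at this

/-! ### Valuations -/

/-- The sets A σ are adjoined in an order compatible with inclusion of the indices; each meets the
union of the earlier ones exactly in B σ. The A σ need not be the cells themselves: they will also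
be the tiles of the duality argument. -/
theorem valuation_biUnion_eq_sum {α M : Type*} [AddCommGroup M] {f : Set α → M} (h0 : f ∅ = 0)
    {K : Finset (Set E)} {A B : Set E → Set α}
    (hval : ∀ L ⊆ K, ∀ σ ∈ K, f (A σ ∪ ⋃ τ ∈ L, A τ) =
      f (A σ) + f (⋃ τ ∈ L, A τ) - f (A σ ∩ ⋃ τ ∈ L, A τ))
    (h1 : ∀ σ ∈ K, ∀ τ ∈ K, ¬ σ ⊆ τ → A σ ∩ A τ ⊆ B σ)
    (h2 : ∀ σ ∈ K, ∀ x ∈ B σ, x ∈ A σ ∧ ∃ τ ∈ K, τ ⊂ σ ∧ x ∈ A τ) :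
    f (⋃ σ ∈ K, A σ) = ∑ σ ∈ K, (f (A σ) - f (B σ)) := by
  classical
  have key : ∀ n : ℕ, ∀ L ⊆ K, (∀ σ ∈ L, ∀ τ ∈ K, τ ⊆ σ → τ ∈ L) → L.card = n →
      f (⋃ σ ∈ L, A σ) = ∑ σ ∈ L, (f (A σ) - f (B σ)) := by
    intro n
    induction n with
    | zero =>
      intro L _ _ hn
      rw [Finset.card_eq_zero] at hn
      simp [hn, h0]
    | succ n ih =>
      intro L hL hlow hn
      -- Removing a maximal cell keeps `L` closed under passing to smaller cells.
      obtain ⟨σ, hσ⟩ := L.exists_maximal (Finset.card_pos.1 (by omega))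
      have hmax : ∀ τ ∈ L, τ ≠ σ → ¬ σ ⊆ τ := fun τ hτ hne h => hne ((hσ.2 hτ h).antisymm h)
      have hL' : L.erase σ ⊆ K := (Finset.erase_subset _ _).trans hL
      have hind := ih (L.erase σ) hL' (by
        intro ρ hρ τ hτ hτρ
        rw [Finset.mem_erase] at hρ ⊢
        exact ⟨fun h => hmax ρ hρ.2 hρ.1 (h ▸ hτρ), hlow ρ hρ.2 τ hτ hτρ⟩)
        (by rw [Finset.card_erase_of_mem hσ.1, hn]; rfl)
      have hint : A σ ∩ ⋃ τ ∈ L.erase σ, A τ = B σ := by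
        apply Set.Subset.antisymm
        · rintro x ⟨hx, hx2⟩
          obtain ⟨τ, hτ, hxτ⟩ := Set.mem_iUnion₂.1 hx2
          rw [Finset.mem_erase] at hτ
          exact h1 σ (hL hσ.1) τ (hL hτ.2) (hmax τ hτ.2 hτ.1) ⟨hx, hxτ⟩
        · intro x hx
          obtain ⟨hx1, τ, hτ, hτσ, hxτ⟩ := h2 σ (hL hσ.1) x hx
          exact ⟨hx1, Set.mem_iUnion₂.2 ⟨τ, Finset.mem_erase.2
            ⟨hτσ.ne, hlow σ hσ.1 τ hτ hτσ.subset⟩, hxτ⟩⟩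
      have hun : ⋃ τ ∈ L, A τ = A σ ∪ ⋃ τ ∈ L.erase σ, A τ := by
        conv_lhs => rw [← Finset.insert_erase hσ.1]
        exact Finset.set_biUnion_insert _ _ _
      rw [hun, hval _ hL' σ (hL hσ.1), hint, hind, ← Finset.add_sum_erase _ _ hσ.1]
      abel
  exact key _ K subset_rfl (fun _ _ τ hτ _ => hτ) rfl

theorem Adapted.valuation_eq_sum {M : Type*} [AddCommGroup M] {f : Set E → M} (h0 : f ∅ = 0)
    {K : Finset (Set E)} (hK : IsComplex K) {Q : Set E} (hQ : Adapted K Q)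
    (hval : ∀ A B, Adapted K A → Adapted K B → A ⊆ Q → B ⊆ Q → f (A ∪ B) = f A + f B - f (A ∩ B)) :
    f Q = ∑ σ ∈ below K Q, (f σ - f (σ \ relCore σ)) := by
  have hadL : ∀ L ⊆ below K Q, Adapted K (⋃ τ ∈ L, τ) := fun L hL =>
    adapted_biUnion (s := (L : Set (Set E))) fun τ hτ => hK.adapted_cell (mem_below.1 (hL hτ)).1
  have := valuation_biUnion_eq_sum (f := f) (K := below K Q) (A := id)
    (B := fun σ => σ \ relCore σ) h0 ?_ ?_ ?_
  · have hQ' := hQ.sUnion_below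
    rw [Set.sUnion_eq_biUnion] at hQ'
    exact (congrArg f hQ'.symm).trans this
  · intro L hL σ hσ
    rw [mem_below] at hσ
    exact hval _ _ (hK.adapted_cell hσ.1) (hadL L hL) hσ.2
      (Set.iUnion₂_subset fun τ hτ => (mem_below.1 (hL hτ)).2)
  · rintro σ hσ τ hτ hστ x ⟨hxσ, hxτ⟩
    exact ⟨hxσ, fun h => hστ
      (hK.subset σ (mem_below.1 hσ).1 τ (mem_below.1 hτ).1 x h hxτ)⟩
  · rintro σ hσ x ⟨hxσ, hxc⟩
    rw [mem_below] at hσ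
    obtain ⟨ρ, hρ, hxρ⟩ := hK.exists_mem_relCore σ hσ.1 x hxσ
    have hsub := hK.subset ρ hρ σ hσ.1 x hxρ hxσ
    exact ⟨hxσ, ρ, mem_below.2 ⟨hρ, hsub.trans hσ.2⟩,
      hsub.ssubset_of_ne (fun h => hxc (h ▸ hxρ)), hxρ.1⟩

/-- Valuations that agree on a family of sets closed under intersection agree on its finite
unions. -/
theorem valuation_eq_of_isUnion {M : Type*} [AddCommGroup M] {𝒟 : Set E → Prop}
    (hinter : ∀ A B, 𝒟 A → 𝒟 B → 𝒟 (A ∩ B)) {f g : Set E → M} (h0 : f ∅ = g ∅)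
    (hf : ∀ P Q, IsUnion 𝒟 P → IsUnion 𝒟 Q → f (P ∪ Q) = f P + f Q - f (P ∩ Q))
    (hg : ∀ P Q, IsUnion 𝒟 P → IsUnion 𝒟 Q → g (P ∪ Q) = g P + g Q - g (P ∩ Q))
    (heq : ∀ A, 𝒟 A → f A = g A) {P : Set E} (hP : IsUnion 𝒟 P) : f P = g P := by
  classical
  obtain ⟨T, hT, rfl⟩ := hP
  generalize hn : T.card = n
  induction n using Nat.strong_induction_on generalizing T with
  | _ n ih =>
    rcases T.eq_empty_or_nonempty with rfl | ⟨C, hC⟩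
    · simpa using h0
    have hcard : (T.erase C).card < n := by
      rw [← hn]; exact Finset.card_erase_lt_of_mem hC
    have hT' : ∀ D ∈ T.erase C, 𝒟 D := fun D hD => hT D (Finset.mem_of_mem_erase hD)
    have h1 := ih _ hcard (T.erase C) hT' rfl
    have h2 := ih _ (Finset.card_image_le.trans_lt hcard) ((T.erase C).image (C ∩ ·)) (by
      intro D hD
      obtain ⟨D, hD', rfl⟩ := Finset.mem_image.1 hD
      exact hinter _ _ (hT C hC) (hT' D hD')) rfl
    have hun : ⋃₀ (T : Set (Set E)) = C ∪ ⋃₀ (T.erase C : Set (Set E)) := by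
      rw [← Set.sUnion_insert, ← Finset.coe_insert, Finset.insert_erase hC]
    have hint : C ∩ ⋃₀ (T.erase C : Set (Set E)) =
        ⋃₀ (((T.erase C).image (C ∩ ·) : Finset (Set E)) : Set (Set E)) := by
      rw [Set.sUnion_eq_biUnion, Set.inter_iUnion₂, Finset.coe_image, Set.sUnion_image]
    have hCu := isUnion_of_cell (hT C hC)
    have hTu : IsUnion 𝒟 (⋃₀ (T.erase C : Set (Set E))) := ⟨_, hT', rfl⟩
    rw [hun, hf _ _ hCu hTu, hg _ _ hCu hTu, hint, h1, h2, heq C (hT C hC)]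

theorem IsConvexCone.inter {C D : Set E} (hC : IsConvexCone C) (hD : IsConvexCone D) :
    IsConvexCone (C ∩ D) := by
  obtain ⟨V, hV, hCV⟩ := hC.exists_submodule
  obtain ⟨W, hW, hDW⟩ := hD.exists_submodule
  have : FiniteDimensional ℝ (V ⊓ W : Submodule ℝ E) :=
    Submodule.finiteDimensional_of_le inf_le_left
  exact ((hC.isPolyhedronIn hCV).inter (hD.isPolyhedronIn hDW)).isConvexCone
    ⟨hC.zero_mem, hD.zero_mem⟩ fun c hc x hx => ⟨hC.smul_mem hc hx.1, hD.smul_mem hc hx.2⟩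

/-! ### Tangent cones of complexes -/

/-- A ray eventually in `Q` is frequently, hence eventually, in one of the finitely many cells of
`Q`. That cell contains `x` by closedness, hence contains `σ`. -/
theorem Adapted.mem_tangent_iff {K : Finset (Set E)} (hK : IsComplex K) {Q : Set E}
    (hQ : Adapted K Q) {σ : Set E} (hσ : σ ∈ K) {x : E} (hx : x ∈ relCore σ) {w : E} :
    w ∈ tangent Q x ↔ ∃ τ ∈ K, τ ⊆ Q ∧ σ ⊆ τ ∧ w ∈ tangent τ x := by
  constructor
  · intro hw
    by_contra! h
    have h1 : ∀ᶠ t : ℝ in 𝓝[>] 0, ∀ τ ∈ below K Q, x + t • w ∉ τ := by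
      rw [Filter.eventually_all_finset]
      intro τ hτ
      rw [mem_below] at hτ
      by_contra hf
      have hwτ := (hK.poly τ hτ.1).convex.frequently_mem_tangent (hK.poly τ hτ.1).isClosed
        hf
      exact h τ hτ.1 hτ.2 (hK.subset σ hσ τ hτ.1 x hx
        (mem_of_mem_tangent (hK.poly τ hτ.1).isClosed hwτ)) hwτ
    obtain ⟨t, h1, h2⟩ := (h1.and hw).exists
    change x + t • w ∈ Q at h2
    rw [← hQ.sUnion_below] at h2
    obtain ⟨τ, hτ, hm⟩ := h2
    exact h1 τ hτ hm
  · rintro ⟨τ, -, hτ, -, hw⟩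
    exact tangent_mono hτ x hw

theorem Adapted.tangent_eq {K : Finset (Set E)} (hK : IsComplex K) {Q : Set E}
    (hQ : Adapted K Q) {σ : Set E} (hσ : σ ∈ K) {x y : E} (hx : x ∈ relCore σ)
    (hy : y ∈ relCore σ) : tangent Q x = tangent Q y := by
  ext w
  rw [hQ.mem_tangent_iff hK hσ hx, hQ.mem_tangent_iff hK hσ hy]
  refine exists_congr fun τ => and_congr_right fun hτ => and_congr_right fun _ =>
    and_congr_right fun hστ => ?_
  rw [tangent_eq_of_mem_relCore (hK.poly τ hτ).convex hστ hx hy]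

/-- Each cell around `σ` has a tangent cone at `x` that contains the direction of `σ`. So the
tangent cone of `Q` is the product of the normal cone and this linear space. -/
theorem Adapted.tangent_add_mem {K : Finset (Set E)} (hK : IsComplex K) {Q : Set E}
    (hQ : Adapted K Q) {σ : Set E} (hσ : σ ∈ K) {x : E} (hx : x ∈ relCore σ) {w z : E}
    (hw : w ∈ tangent Q x) (hz : z ∈ vectorSpan ℝ σ) : w + z ∈ tangent Q x := by
  obtain ⟨τ, hτ, hτQ, hστ, hwτ⟩ := (hQ.mem_tangent_iff hK hσ hx).1 hw
  exact (hQ.mem_tangent_iff hK hσ hx).2 ⟨τ, hτ, hτQ, hστ, (hK.poly τ hτ).convex.tangent_add_mem hwτ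
    (tangent_mono hστ x ((hK.poly σ hσ).vectorSpan_subset_tangent hx hz))⟩

theorem Adapted.isCone_normalCone {K : Finset (Set E)} (hK : IsComplex K) {Q : Set E}
    (hQ : Adapted K Q) {σ : Set E} (hσ : σ ∈ K) {x : E} (hx : x ∈ relCore σ)
    (V : Submodule ℝ E) : IsCone (normalCone V Q σ x) := by
  classical
  refine ⟨((below K Q).filter (σ ⊆ ·)).image fun τ => normalCone V τ σ x, fun C hC => ?_, ?_⟩
  · obtain ⟨τ, hτ, rfl⟩ := Finset.mem_image.1 hC
    rw [Finset.mem_filter, mem_below] at hτ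
    exact isConvexCone_inter_tangent (hK.poly τ hτ.1.1) (hτ.2 hx.1) _
  · ext w
    simp only [normalCone_eq, Set.mem_inter_iff, hQ.mem_tangent_iff hK hσ hx, Finset.coe_image,
      Set.sUnion_image, Set.mem_iUnion, exists_prop, Finset.mem_coe, Finset.mem_filter, mem_below]
    constructor
    · rintro ⟨h1, τ, h2, h3, h4, h5⟩
      exact ⟨τ, ⟨⟨h2, h3⟩, h4⟩, h1, h5⟩
    · rintro ⟨τ, ⟨⟨h2, h3⟩, h4⟩, h1, h5⟩
      exact ⟨h1, τ, h2, h3, h4, h5⟩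

/-- Finitely many open cells cover the germ of the ray, so one is met frequently, and then
eventually. -/
theorem IsComplex.exists_eventually_mem_relCore {K : Finset (Set E)} (hK : IsComplex K) {τ : Set E}
    (hτ : τ ∈ K) {x w : E} (hw : w ∈ tangent τ x) :
    ∃ ρ ∈ K, ∀ᶠ t : ℝ in 𝓝[>] 0, x + t • w ∈ relCore ρ := by
  have h1 : ∃ ρ ∈ K, ∃ᶠ t : ℝ in 𝓝[>] 0, x + t • w ∈ relCore ρ := by
    by_contra! h
    have h2 : ∀ᶠ t : ℝ in 𝓝[>] 0, ∀ ρ ∈ K, x + t • w ∉ relCore ρ := by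
      rw [Filter.eventually_all_finset]
      exact fun ρ hρ => by simpa [Filter.Frequently] using h ρ hρ
    obtain ⟨t, h2, h3⟩ := (h2.and hw).exists
    obtain ⟨ρ, hρ, hm⟩ := hK.exists_mem_relCore τ hτ _ h3
    exact h2 ρ hρ hm
  obtain ⟨ρ, hρ, hfr⟩ := h1
  exact ⟨ρ, hρ, (hK.poly ρ hρ).eventually_mem_relCore_of_frequently hfr⟩

end Kinds

/-! ### Star sums -/

section Star

set_option linter.unusedSectionVars false

variable {E : Type u} [NormedAddCommGroup E] [InnerProductSpace ℝ E] {k : Type v} [CommRing k]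

/-- A multiplicative family of valuations of the finite unions `A` of cells that lie in a translate
of `V`. -/
structure IsValFam (𝒞 : Set E → Prop) (g : Submodule ℝ E → Set E → k) : Prop where
  map_empty : ∀ V : Submodule ℝ E, FiniteDimensional ℝ V → g V ∅ = 0
  map_union : ∀ (V : Submodule ℝ E) (A B : Set E), FiniteDimensional ℝ V → IsUnion 𝒞 A → IsUnion 𝒞 B →
    vectorSpan ℝ (A ∪ B) ≤ V → g V (A ∪ B) = g V A + g V B - g V (A ∩ B)
  map_prod : ∀ (V W : Submodule ℝ E) (A B : Set E), V ⟂ W → FiniteDimensional ℝ V → FiniteDimensional ℝ W →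
    IsUnion 𝒞 A → IsUnion 𝒞 B → vectorSpan ℝ A ≤ V → vectorSpan ℝ B ≤ W →
    g (V ⊔ W) (A + B) = g V A * g W B

/-- The value of `g` at the relative interior of `σ`. -/
noncomputable def openVal (g : Submodule ℝ E → Set E → k) (V : Submodule ℝ E) (σ : Set E) : k :=
  g V σ - g V (σ \ relCore σ)

/-- The star sum over the cells of `K` in `P`. -/
noncomputable def starOn (F g : Submodule ℝ E → Set E → k) (V : Submodule ℝ E) (P : Set E)
    (K : Finset (Set E)) (b : Set E → E) : k :=
  ∑ σ ∈ below K P, F (perpIn V σ) (normalCone V P σ (b σ)) * openVal g (vectorSpan ℝ σ) σ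

/-- A complex with cells in `𝒞` and with base points in the relative interiors of the cells. -/
structure IsPointedComplex (𝒞 : Set E → Prop) (K : Finset (Set E)) (b : Set E → E) : Prop
    extends IsComplex K where
  kind : ∀ σ ∈ K, 𝒞 σ
  base : ∀ σ ∈ K, b σ ∈ relCore σ

theorem IsComplex.exists_base {K : Finset (Set E)} (hK : IsComplex K) :
    ∃ b : Set E → E, ∀ σ ∈ K, b σ ∈ relCore σ := by
  choose! b hb using fun σ hσ => (hK.poly σ hσ).relCore_nonempty
  exact ⟨b, hb⟩

theorem IsCellKind.exists_pointed {𝒞 : Set E → Prop} (h𝒞 : IsCellKind 𝒞) {ι : Type*}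
    [Finite ι] {P : ι → Set E} (hP : ∀ i, IsUnion 𝒞 (P i)) :
    ∃ K b, IsPointedComplex 𝒞 K b ∧ ∀ i, Adapted K (P i) := by
  obtain ⟨K, hK, hK2, had⟩ := h𝒞.exists_complex_of_isUnion hP
  obtain ⟨b, hb⟩ := hK.exists_base
  exact ⟨K, b, ⟨hK, hK2, hb⟩, had⟩

theorem Adapted.trans {K K' : Finset (Set E)} (h : ∀ σ ∈ K, Adapted K' σ)
    {Q : Set E} (hQ : Adapted K Q) : Adapted K' Q where
  exists_mem_relCore x hx := by
    obtain ⟨σ, hσ, hxσ⟩ := hQ.exists_mem_relCore x hx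
    exact (h σ hσ).exists_mem_relCore x hxσ.1
  subset ρ hρ x hx hxQ := by
    obtain ⟨σ, hσ, hxσ⟩ := hQ.exists_mem_relCore x hxQ
    exact ((h σ hσ).subset ρ hρ x hx hxσ.1).trans (hQ.subset σ hσ x hxσ hxQ)

theorem finiteDimensional_perpIn (V : Submodule ℝ E) [FiniteDimensional ℝ V] (σ : Set E) :
    FiniteDimensional ℝ (perpIn V σ) := Submodule.finiteDimensional_of_le inf_le_left

theorem Submodule.inf_orthogonal_eq_sup {A B V : Submodule ℝ E} [FiniteDimensional ℝ B]
    (hAB : A ≤ B) (hBV : B ≤ V) : V ⊓ Aᗮ = (V ⊓ Bᗮ) ⊔ (B ⊓ Aᗮ) := by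
  apply le_antisymm
  · rintro x ⟨hxV, hxA⟩
    rw [← Submodule.sup_orthogonal_inf_of_hasOrthogonalProjection hBV] at hxV
    obtain ⟨y, hy, z, hz, rfl⟩ := Submodule.mem_sup.1 hxV
    have hzA : z ∈ Aᗮ := Submodule.orthogonal_le hAB hz.1
    rw [add_comm]
    exact Submodule.add_mem_sup ⟨hz.2, hz.1⟩ ⟨hy, (Submodule.add_mem_iff_left _ hzA).1 hxA⟩
  · exact sup_le (inf_le_inf le_rfl (Submodule.orthogonal_le hAB)) (inf_le_inf hBV le_rfl)

theorem Submodule.sup_inf_orthogonal {A B : Submodule ℝ E} [FiniteDimensional ℝ A]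
    (hAB : A ≤ B) : A ⊔ (B ⊓ Aᗮ) = B := by
  rw [inf_comm]
  exact Submodule.sup_orthogonal_inf_of_hasOrthogonalProjection hAB

theorem perpIn_isOrtho (V : Submodule ℝ E) (σ : Set E) : perpIn V σ ⟂ vectorSpan ℝ σ :=
  (Submodule.isOrtho_orthogonal_left _).mono_left inf_le_right

theorem normalCone_eq_empty {P : Set E} (hP : IsClosed P) {V : Submodule ℝ E} {σ : Set E} {x : E}
    (hx : x ∉ P) : normalCone V P σ x = ∅ := by
  rw [normalCone_eq, Set.eq_empty_iff_forall_notMem]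
  exact fun w hw => hx (mem_of_mem_tangent hP hw.2)

theorem isCone_empty : IsCone (∅ : Set E) := isUnion_empty

section

variable {𝒞 : Set E → Prop} {F : ConeMor E k} {g : Submodule ℝ E → Set E → k}

theorem Adapted.isConeIn_normalCone {K : Finset (Set E)} (hK : IsComplex K) {Q : Set E}
    (hQ : Adapted K Q) {σ : Set E} (hσ : σ ∈ K) {x : E} (hx : x ∈ relCore σ)
    (V : Submodule ℝ E) [FiniteDimensional ℝ V] :
    IsConeIn (perpIn V σ) (normalCone V Q σ x) :=
  ⟨finiteDimensional_perpIn V σ, hQ.isCone_normalCone hK hσ hx V, fun _ hw => hw.1⟩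

theorem Adapted.normalCone_eq {K : Finset (Set E)} (hK : IsComplex K) {Q : Set E}
    (hQ : Adapted K Q) {σ : Set E} (hσ : σ ∈ K) {x y : E} (hx : x ∈ relCore σ)
    (hy : y ∈ relCore σ) (V : Submodule ℝ E) : normalCone V Q σ x = normalCone V Q σ y := by
  rw [_root_.normalCone_eq, _root_.normalCone_eq, hQ.tangent_eq hK hσ hx hy]

/-- The multiplicativity of `F` that underlies the independence of the subdivision. -/
theorem Adapted.map_normalCone {K : Finset (Set E)} (hK : IsComplex K) {P : Set E}
    (hP : Adapted K P) {V : Submodule ℝ E} [FiniteDimensional ℝ V] {σ ρ : Set E} (hσ : σ ∈ K)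
    (hσV : vectorSpan ℝ σ ≤ V) (hρσ : vectorSpan ℝ ρ ≤ vectorSpan ℝ σ) {x : E}
    (hx : x ∈ relCore σ) :
    F.toFun (perpIn V ρ) (normalCone V P ρ x) = F.toFun (perpIn V σ) (normalCone V P σ x) *
      F.toFun (perpIn (vectorSpan ℝ σ) ρ) (perpIn (vectorSpan ℝ σ) ρ : Set E) := by
  have hfd := (hK.poly σ hσ).finiteDimensional
  have hfd2 := finiteDimensional_perpIn (vectorSpan ℝ σ) ρ
  have hperp : perpIn V ρ = perpIn V σ ⊔ perpIn (vectorSpan ℝ σ) ρ :=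
    Submodule.inf_orthogonal_eq_sup hρσ hσV
  rw [← F.map_prod (perpIn V σ) (perpIn (vectorSpan ℝ σ) ρ) _ _ ((perpIn_isOrtho V σ).mono_right inf_le_left)
    (hP.isConeIn_normalCone hK hσ hx V) (isConeIn_self _), ← hperp]
  congr 1
  -- A vector of ρ^⊥ has a part in σ^⊥ and a part in ⟨σ⟩ ∩ ρ^⊥. The latter can be removed or added
  -- freely, as the tangent cone at `x` is invariant under ⟨σ⟩.
  ext w
  rw [_root_.normalCone_eq, _root_.normalCone_eq, Set.mem_add]
  constructor
  · rintro ⟨hw, hwt⟩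
    rw [SetLike.mem_coe, hperp] at hw
    obtain ⟨y, hy, z, hz, rfl⟩ := Submodule.mem_sup.1 hw
    refine ⟨y, ⟨hy, ?_⟩, z, hz, rfl⟩
    simpa using hP.tangent_add_mem hK hσ hx hwt (neg_mem hz.1)
  · rintro ⟨y, ⟨hy, hyt⟩, z, hz, rfl⟩
    refine ⟨?_, hP.tangent_add_mem hK hσ hx hyt hz.1⟩
    rw [SetLike.mem_coe, hperp]
    exact Submodule.add_mem_sup hy hz

/-- Enlarging the ambient space by `W` amounts to taking the product with the point 0 of `W`. -/
theorem IsValFam.openVal_sup (h𝒞 : IsCellKind 𝒞) (hg : IsValFam 𝒞 g) {K : Finset (Set E)}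
    (hK : IsComplex K) (hK𝒞 : ∀ σ ∈ K, 𝒞 σ) {ρ : Set E} (hρ : ρ ∈ K) {V W : Submodule ℝ E}
    [FiniteDimensional ℝ V] [FiniteDimensional ℝ W] (hV : vectorSpan ℝ ρ ≤ V) (hVW : V ⟂ W) :
    openVal g (V ⊔ W) ρ = openVal g V ρ * g W {0} := by
  have key : ∀ A, IsUnion 𝒞 A → A ⊆ ρ → g (V ⊔ W) A = g V A * g W {0} := by
    intro A hA hAρ
    have := hg.map_prod V W A {0} hVW inferInstance inferInstance hA (isUnion_of_cell h𝒞.zero)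
      ((vectorSpan_mono ℝ hAρ).trans hV) (by simp)
    simpa using this
  rw [openVal, openVal, key _ (isUnion_of_cell (hK𝒞 ρ hρ)) subset_rfl,
    key _ ((hK.adapted_boundary hρ).isUnion hK𝒞) Set.sdiff_subset, sub_mul]

theorem IsValFam.eq_sum_openVal (hg : IsValFam 𝒞 g) {K : Finset (Set E)}
    (hK : IsComplex K) (hK𝒞 : ∀ σ ∈ K, 𝒞 σ) {V : Submodule ℝ E} [FiniteDimensional ℝ V] {Q : Set E}
    (hQ : Adapted K Q) (hQV : vectorSpan ℝ Q ≤ V) :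
    g V Q = ∑ σ ∈ below K Q, openVal g V σ :=
  hQ.valuation_eq_sum (f := g V) (hg.map_empty V inferInstance) hK fun A B hA hB hAQ hBQ =>
    hg.map_union V A B inferInstance (hA.isUnion hK𝒞) (hB.isUnion hK𝒞)
      ((vectorSpan_mono ℝ (Set.union_subset hAQ hBQ)).trans hQV)

/-- The star sum does not change under subdivision. -/
theorem starOn_subdivision (h𝒞 : IsCellKind 𝒞) (hg : IsValFam 𝒞 g)
    (hFg : ∀ W : Submodule ℝ E, FiniteDimensional ℝ W → F.toFun W (W : Set E) = g W {0})
    {V : Submodule ℝ E} [FiniteDimensional ℝ V] {P : Set E} (hPV : vectorSpan ℝ P ≤ V)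
    {K K' : Finset (Set E)} {b b' : Set E → E}
    (hK : IsPointedComplex 𝒞 K b) (hK' : IsPointedComplex 𝒞 K' b') (hP : Adapted K P)
    (href : ∀ σ ∈ K, Adapted K' σ) :
    starOn F.toFun g V P K b = starOn F.toFun g V P K' b' := by
  classical
  have hP' : Adapted K' P := hP.trans href
  -- The terms of the finer sum are grouped by the open cell of the coarser complex in which they
  -- lie.
  have hs : ∀ ρ ∈ below K' P, ∃ σ ∈ below K P, b' ρ ∈ relCore σ := by
    intro ρ hρ
    rw [mem_below] at hρ
    have hbP := hρ.2 (hK'.base ρ hρ.1).1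
    obtain ⟨σ, hσ, h⟩ := hP.exists_mem_relCore _ hbP
    exact ⟨σ, mem_below.2 ⟨hσ, hP.subset σ hσ _ h hbP⟩, h⟩
  choose! s hsK hsb using hs
  rw [starOn, starOn, ← Finset.sum_fiberwise_of_maps_to (g := s) hsK]
  refine Finset.sum_congr rfl fun σ hσ => ?_
  obtain ⟨hσK, hσP⟩ := mem_below.1 hσ
  have hbd : Adapted K' (σ \ relCore σ) := (hK.adapted_boundary hσK).trans href
  have hfd := (hK.poly σ hσK).finiteDimensional
  have hσV : vectorSpan ℝ σ ≤ V := (vectorSpan_mono ℝ hσP).trans hPV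
  have hfib : (below K' P).filter (fun ρ => s ρ = σ) =
      below K' σ \ below K' (σ \ relCore σ) := by
    ext ρ
    rw [Finset.mem_filter, Finset.mem_sdiff]
    constructor
    · rintro ⟨hρ, rfl⟩
      obtain ⟨hρK, hρP⟩ := mem_below.1 hρ
      have h1 := hsb ρ hρ
      refine ⟨mem_below.2 ⟨hρK, (href _ hσK).subset ρ hρK _ (hK'.base ρ hρK) h1.1⟩, fun h => ?_⟩
      exact ((mem_below.1 h).2 (hK'.base ρ hρK).1).2 h1
    · rintro ⟨hρ, hρ2⟩
      obtain ⟨hρK, hρσ⟩ := mem_below.1 hρ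
      have hρP : ρ ∈ below K' P := mem_below.2 ⟨hρK, hρσ.trans hσP⟩
      refine ⟨hρP, ?_⟩
      have hbσ : b' ρ ∈ relCore σ := by
        by_contra h
        exact hρ2 (mem_below.2 ⟨hρK, hbd.subset ρ hρK _ (hK'.base ρ hρK)
          ⟨hρσ (hK'.base ρ hρK).1, h⟩⟩)
      exact hK.eq_of_mem (mem_below.1 (hsK ρ hρP)).1 hσK (hsb ρ hρP) hbσ
  have hsum : openVal g (vectorSpan ℝ σ) σ =
      ∑ ρ ∈ (below K' P).filter (fun ρ => s ρ = σ), openVal g (vectorSpan ℝ σ) ρ := by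
    have hsub : below K' (σ \ relCore σ) ⊆ below K' σ := fun ρ hρ => by
      rw [mem_below] at hρ ⊢
      exact ⟨hρ.1, hρ.2.trans Set.sdiff_subset⟩
    rw [hfib, Finset.sum_sdiff_eq_sub hsub, ← hg.eq_sum_openVal hK'.toIsComplex hK'.kind hbd
      (vectorSpan_mono ℝ Set.sdiff_subset), ← hg.eq_sum_openVal hK'.toIsComplex hK'.kind
      (href σ hσK) le_rfl, openVal]
  rw [hsum, Finset.mul_sum]
  refine Finset.sum_congr rfl fun ρ hρ => ?_
  have hρP := (Finset.mem_filter.1 hρ).1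
  have hbσ : b' ρ ∈ relCore σ := (Finset.mem_filter.1 hρ).2 ▸ hsb ρ hρP
  have hρσ : ρ ⊆ σ := by
    rw [hfib] at hρ
    exact (mem_below.1 (Finset.mem_sdiff.1 hρ).1).2
  have hspan := vectorSpan_mono ℝ hρσ
  have hρK := (mem_below.1 hρP).1
  have hfdρ := (hK'.poly ρ hρK).finiteDimensional
  have hfdW := finiteDimensional_perpIn (vectorSpan ℝ σ) ρ
  rw [hP.map_normalCone hK.toIsComplex hσK hσV hspan hbσ, hFg _ hfdW,
    hP.normalCone_eq hK.toIsComplex hσK (hK.base σ hσK) hbσ, mul_assoc]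
  congr 1
  -- With W = ⟨σ⟩ ∩ ρ^⊥, the factor F_W(W) = g_W(0) turns the value at int ρ in ⟨ρ⟩ into the value
  -- in ⟨σ⟩ = ⟨ρ⟩ + W.
  have h1 := hg.openVal_sup h𝒞 hK'.toIsComplex hK'.kind hρK le_rfl
    (perpIn_isOrtho (vectorSpan ℝ σ) ρ).symm
  rw [perpIn, Submodule.sup_inf_orthogonal hspan] at h1
  rw [h1, mul_comm]
  rfl

/-- Both sums agree with the sum over a common refinement of the two complexes. -/
theorem starOn_eq (h𝒞 : IsCellKind 𝒞) (hg : IsValFam 𝒞 g)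
    (hFg : ∀ W : Submodule ℝ E, FiniteDimensional ℝ W → F.toFun W (W : Set E) = g W {0})
    {V : Submodule ℝ E} [FiniteDimensional ℝ V] {P : Set E} (hPV : vectorSpan ℝ P ≤ V)
    {K K' : Finset (Set E)} {b b' : Set E → E}
    (hK : IsPointedComplex 𝒞 K b) (hK' : IsPointedComplex 𝒞 K' b') (hP : Adapted K P)
    (hP' : Adapted K' P) : starOn F.toFun g V P K b = starOn F.toFun g V P K' b' := by
  obtain ⟨L, c, hL, had⟩ := h𝒞.exists_pointed (P := fun i : K ⊕ K' =>
    Sum.elim (fun σ : K => (σ : Set E)) (fun σ : K' => (σ : Set E)) i) (by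
      rintro (σ | σ)
      · exact isUnion_of_cell (hK.kind σ σ.2)
      · exact isUnion_of_cell (hK'.kind σ σ.2))
  rw [starOn_subdivision h𝒞 hg hFg hPV hK hL hP fun σ hσ => had (Sum.inl ⟨σ, hσ⟩),
    starOn_subdivision h𝒞 hg hFg hPV hK' hL hP' fun σ hσ => had (Sum.inr ⟨σ, hσ⟩)]

/-- Cells outside `P` have empty normal cones and contribute 0. Thus the sums for several sets
adapted to one complex share an index set. -/
theorem starOn_eq_sum {F : ConeMor E k} {V : Submodule ℝ E} [FiniteDimensional ℝ V] {P : Set E}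
    {K : Finset (Set E)} {b : Set E → E} (hK : IsPointedComplex 𝒞 K b) (hP : Adapted K P)
    (hPcl : IsClosed P) : starOn F.toFun g V P K b =
      ∑ σ ∈ K, F.toFun (perpIn V σ) (normalCone V P σ (b σ)) * openVal g (vectorSpan ℝ σ) σ := by
  refine Finset.sum_subset (below_subset K P) fun σ hσ hσP => ?_
  have : b σ ∉ P := fun h => hσP (mem_below.2 ⟨hσ, hP.subset σ hσ _ (hK.base σ hσ) h⟩)
  rw [normalCone_eq_empty hPcl this, F.map_empty _ (finiteDimensional_perpIn V σ), zero_mul]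

variable (𝒞) in
open Classical in
/-- The star product, computed with a chosen complex. -/
noncomputable def starVal (F g : Submodule ℝ E → Set E → k) (V : Submodule ℝ E) (P : Set E) : k :=
  if h : ∃ K b, IsPointedComplex 𝒞 K b ∧ Adapted K P then
    starOn F g V P h.choose h.choose_spec.choose else 0

theorem starVal_eq (h𝒞 : IsCellKind 𝒞) (hg : IsValFam 𝒞 g)
    (hFg : ∀ W : Submodule ℝ E, FiniteDimensional ℝ W → F.toFun W (W : Set E) = g W {0})
    {V : Submodule ℝ E} [FiniteDimensional ℝ V] {P : Set E} (hPV : vectorSpan ℝ P ≤ V)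
    {K : Finset (Set E)} {b : Set E → E}
    (hK : IsPointedComplex 𝒞 K b) (hP : Adapted K P) :
    starVal 𝒞 F.toFun g V P = starOn F.toFun g V P K b := by
  have h : ∃ K b, IsPointedComplex 𝒞 K b ∧ Adapted K P := ⟨K, b, hK, hP⟩
  rw [starVal, dif_pos h]
  exact starOn_eq h𝒞 hg hFg hPV h.choose_spec.choose_spec.1 hK h.choose_spec.choose_spec.2 hP

theorem starVal_empty (h𝒞 : IsCellKind 𝒞) (hg : IsValFam 𝒞 g)
    (hFg : ∀ W : Submodule ℝ E, FiniteDimensional ℝ W → F.toFun W (W : Set E) = g W {0})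
    {V : Submodule ℝ E} [FiniteDimensional ℝ V] : starVal 𝒞 F.toFun g V ∅ = 0 := by
  rw [starVal_eq (K := ∅) (b := fun _ => 0) h𝒞 hg hFg (by simp)
    ⟨⟨by simp, by simp, by simp⟩, by simp, by simp⟩ ⟨by simp, by simp⟩]
  rw [starOn, Finset.sum_eq_zero]
  intro σ hσ
  simp at hσ

/-- Over a complex adapted to both sets the identity holds cell by cell: normal cones commute with
unions and intersections, and F is a valuation. -/
theorem starVal_union (h𝒞 : IsCellKind 𝒞) (hg : IsValFam 𝒞 g)
    (hFg : ∀ W : Submodule ℝ E, FiniteDimensional ℝ W → F.toFun W (W : Set E) = g W {0})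
    {V : Submodule ℝ E} [FiniteDimensional ℝ V] {P Q : Set E} (hP : IsUnion 𝒞 P)
    (hQ : IsUnion 𝒞 Q) (hPQV : vectorSpan ℝ (P ∪ Q) ≤ V) :
    starVal 𝒞 F.toFun g V (P ∪ Q) = starVal 𝒞 F.toFun g V P + starVal 𝒞 F.toFun g V Q -
      starVal 𝒞 F.toFun g V (P ∩ Q) := by
  obtain ⟨K, b, hK, had⟩ := h𝒞.exists_pointed (P := fun b : Bool => cond b P Q)
    (by intro b; cases b <;> assumption)
  have hPK : Adapted K P := had true
  have hQK : Adapted K Q := had false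
  have hPV := (vectorSpan_mono ℝ Set.subset_union_left).trans hPQV
  have hQV := (vectorSpan_mono ℝ Set.subset_union_right).trans hPQV
  have hcP := hP.isClosed h𝒞
  have hcQ := hQ.isClosed h𝒞
  rw [starVal_eq h𝒞 hg hFg hPQV hK (hPK.union hQK), starVal_eq h𝒞 hg hFg hPV hK hPK,
    starVal_eq h𝒞 hg hFg hQV hK hQK, starVal_eq h𝒞 hg hFg
      ((vectorSpan_mono ℝ Set.inter_subset_left).trans hPV) hK (hPK.inter hQK),
    starOn_eq_sum hK hPK hcP, starOn_eq_sum hK hQK hcQ,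
    starOn_eq_sum hK (hPK.union hQK) (hcP.union hcQ),
    starOn_eq_sum hK (hPK.inter hQK) (hcP.inter hcQ), ← Finset.sum_add_distrib,
    ← Finset.sum_sub_distrib]
  refine Finset.sum_congr rfl fun σ hσ => ?_
  rw [← add_mul, ← sub_mul]
  congr 1
  have hinter : normalCone V (P ∩ Q) σ (b σ) =
      normalCone V P σ (b σ) ∩ normalCone V Q σ (b σ) := by
    rw [normalCone_eq, normalCone_eq, normalCone_eq, tangent_inter, Set.inter_inter_distrib_left]
  have hunion : normalCone V (P ∪ Q) σ (b σ) =
      normalCone V P σ (b σ) ∪ normalCone V Q σ (b σ) := by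
    rw [normalCone_eq, normalCone_eq, normalCone_eq, ← Set.inter_union_distrib_left]
    congr 1
    apply Set.Subset.antisymm
    · intro w hw
      -- The germ of the ray lies in a single cell `τ`, and a cell in P ∪ Q lies in P or in Q.
      obtain ⟨τ, hτ, hτPQ, hστ, hwτ⟩ :=
        ((hPK.union hQK).mem_tangent_iff hK.toIsComplex hσ (hK.base σ hσ)).1 hw
      have hbτ := hK.base τ hτ
      rcases hτPQ hbτ.1 with h | h
      · exact Or.inl (tangent_mono (hPK.subset τ hτ _ hbτ h) _ hwτ)
      · exact Or.inr (tangent_mono (hQK.subset τ hτ _ hbτ h) _ hwτ)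
    · exact Set.union_subset (tangent_mono Set.subset_union_left _)
        (tangent_mono Set.subset_union_right _)
  rw [hinter, hunion]
  exact F.map_union _ _ _ (hPK.isConeIn_normalCone hK.toIsComplex hσ (hK.base σ hσ) V)
    (hQK.isConeIn_normalCone hK.toIsComplex hσ (hK.base σ hσ) V)

end

end Star

/-! ### Orthogonal products -/

section Product

set_option linter.unusedSectionVars false

variable {E : Type u} [NormedAddCommGroup E] [InnerProductSpace ℝ E] {k : Type v} [CommRing k]

theorem Submodule.IsOrtho.add_eq_add_iff {V W : Submodule ℝ E} (h : V ⟂ W) {x x' y y' : E}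
    (hx : x - x' ∈ V) (hy : y - y' ∈ W) (heq : x + y = x' + y') : x = x' ∧ y = y' := by
  have h1 : x - x' = -(y - y') := by
    rw [neg_sub, sub_eq_sub_iff_add_eq_add, heq, add_comm]
  have h2 : x - x' ∈ V ⊓ W := ⟨hx, h1 ▸ neg_mem hy⟩
  rw [h.disjoint.eq_bot, Submodule.mem_bot] at h2
  rw [h2, eq_comm, neg_eq_zero] at h1
  exact ⟨sub_eq_zero.1 h2, sub_eq_zero.1 h1⟩

theorem vectorSpan_add {A B : Set E} (hA : A.Nonempty) (hB : B.Nonempty) :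
    vectorSpan ℝ (A + B) = vectorSpan ℝ A ⊔ vectorSpan ℝ B := by
  apply le_antisymm
  · refine vectorSpan_le_iff.2 ?_
    rintro _ ⟨a, ha, b, hb, rfl⟩ _ ⟨a', ha', b', hb', rfl⟩
    rw [add_sub_add_comm]
    exact Submodule.add_mem_sup (sub_mem_vectorSpan ha ha') (sub_mem_vectorSpan hb hb')
  · obtain ⟨a, ha⟩ := hA
    obtain ⟨b, hb⟩ := hB
    refine sup_le (vectorSpan_le_iff.2 fun x hx y hy => ?_)
      (vectorSpan_le_iff.2 fun x hx y hy => ?_)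
    · have := sub_mem_vectorSpan (Set.add_mem_add hx hb) (Set.add_mem_add hy hb)
      rwa [add_sub_add_right_eq_sub] at this
    · have := sub_mem_vectorSpan (Set.add_mem_add ha hx) (Set.add_mem_add ha hy)
      rwa [add_sub_add_left_eq_sub] at this

theorem vectorSpan_add_le {A B : Set E} {V W : Submodule ℝ E} (hA : vectorSpan ℝ A ≤ V)
    (hB : vectorSpan ℝ B ≤ W) : vectorSpan ℝ (A + B) ≤ V ⊔ W := by
  refine vectorSpan_le_iff.2 ?_
  rintro _ ⟨a, ha, b, hb, rfl⟩ _ ⟨a', ha', b', hb', rfl⟩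
  rw [add_sub_add_comm]
  exact Submodule.add_mem_sup (hA (sub_mem_vectorSpan ha ha')) (hB (sub_mem_vectorSpan hb hb'))

theorem mem_relCore_iff_sub_mem_tangent {P : Set E} (hP : Convex ℝ P) {x : E} :
    x ∈ relCore P ↔ x ∈ P ∧ ∀ y ∈ P, x - y ∈ tangent P x :=
  and_congr_right fun hx => forall₂_congr fun _ _ => (hP.mem_tangent_iff hx).symm

section

variable {V W : Submodule ℝ E} (hVW : V ⟂ W) {A B : Set E} (hA : vectorSpan ℝ A ≤ V)
  (hB : vectorSpan ℝ B ≤ W)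

include hVW hA hB

theorem add_mem_add_iff {x y x' y' : E} (hx : x ∈ A) (hy : y ∈ B) (hx' : x' - x ∈ V)
    (hy' : y' - y ∈ W) : x' + y' ∈ A + B ↔ x' ∈ A ∧ y' ∈ B := by
  constructor
  · rintro ⟨a, ha, b, hb, hab⟩
    obtain ⟨rfl, rfl⟩ := hVW.add_eq_add_iff (x := a) (x' := x') (y := b) (y' := y')
      (by simpa using V.sub_mem (hA (sub_mem_vectorSpan ha hx)) hx')
      (by simpa using W.sub_mem (hB (sub_mem_vectorSpan hb hy)) hy') hab
    exact ⟨ha, hb⟩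
  · rintro ⟨h1, h2⟩
    exact Set.add_mem_add h1 h2

theorem add_mem_tangent_add_iff {x y w z : E} (hx : x ∈ A) (hy : y ∈ B) (hw : w ∈ V)
    (hz : z ∈ W) : w + z ∈ tangent (A + B) (x + y) ↔ w ∈ tangent A x ∧ z ∈ tangent B y := by
  rw [mem_tangent, mem_tangent, mem_tangent, ← eventually_and]
  refine eventually_congr (Eventually.of_forall fun t => ?_)
  rw [smul_add, add_add_add_comm]
  exact add_mem_add_iff hVW hA hB hx hy (by simpa using V.smul_mem t hw)
    (by simpa using W.smul_mem t hz)

theorem add_mem_relCore_add_iff (hcA : Convex ℝ A) (hcB : Convex ℝ B) {x y : E} (hx : x ∈ A)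
    (hy : y ∈ B) : x + y ∈ relCore (A + B) ↔ x ∈ relCore A ∧ y ∈ relCore B := by
  rw [mem_relCore_iff_sub_mem_tangent hcA, mem_relCore_iff_sub_mem_tangent hcB,
    mem_relCore_iff_sub_mem_tangent (hcA.add hcB)]
  have key : ∀ a ∈ A, ∀ b ∈ B, x + y - (a + b) ∈ tangent (A + B) (x + y) ↔
      x - a ∈ tangent A x ∧ y - b ∈ tangent B y := by
    intro a ha b hb
    rw [add_sub_add_comm]
    exact add_mem_tangent_add_iff hVW hA hB hx hy (hA (sub_mem_vectorSpan hx ha))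
      (hB (sub_mem_vectorSpan hy hb))
  constructor
  · rintro ⟨-, h⟩
    exact ⟨⟨hx, fun a ha => ((key a ha y hy).1 (h _ (Set.add_mem_add ha hy))).1⟩,
      ⟨hy, fun b hb => ((key x hx b hb).1 (h _ (Set.add_mem_add hx hb))).2⟩⟩
  · rintro ⟨⟨-, h1⟩, -, h2⟩
    refine ⟨Set.add_mem_add hx hy, ?_⟩
    rintro _ ⟨a, ha, b, hb, rfl⟩
    exact (key a ha b hb).2 ⟨h1 a ha, h2 b hb⟩

theorem add_sdiff_relCore_add (hcA : Convex ℝ A) (hcB : Convex ℝ B) :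
    (A + B) \ relCore (A + B) = (A \ relCore A + B) ∪ (A + B \ relCore B) := by
  ext z
  constructor
  · rintro ⟨⟨x, hx, y, hy, rfl⟩, h⟩
    change x + y ∉ _ at h
    rw [add_mem_relCore_add_iff hVW hA hB hcA hcB hx hy, not_and_or] at h
    exact h.imp (fun h => Set.add_mem_add ⟨hx, h⟩ hy) (fun h => Set.add_mem_add hx ⟨hy, h⟩)
  · rintro (⟨x, hx, y, hy, rfl⟩ | ⟨x, hx, y, hy, rfl⟩)
    · exact ⟨Set.add_mem_add hx.1 hy,
        fun h => hx.2 ((add_mem_relCore_add_iff hVW hA hB hcA hcB hx.1 hy).1 h).1⟩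
    · exact ⟨Set.add_mem_add hx hy.1,
        fun h => hy.2 ((add_mem_relCore_add_iff hVW hA hB hcA hcB hx hy.1).1 h).2⟩

theorem add_inter_add {A' B' : Set E} (hA' : A' ⊆ A) (hB' : B' ⊆ B) :
    (A' + B) ∩ (A + B') = A' + B' := by
  apply Set.Subset.antisymm
  · rintro _ ⟨⟨x, hx, y, hy, rfl⟩, h⟩
    -- The reference point in `B'` is the second summand provided by `h` itself.
    rw [add_mem_add_iff hVW hA ((vectorSpan_mono ℝ hB').trans hB) (x := x)
      (y := (h.choose_spec.2).choose) (hA' hx) (h.choose_spec.2.choose_spec.1) (by simp)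
      (hB (sub_mem_vectorSpan hy (hB' h.choose_spec.2.choose_spec.1)))] at h
    exact Set.add_mem_add hx h.2
  · exact Set.subset_inter (Set.add_subset_add_left hB') (Set.add_subset_add_right hA')

end

theorem Submodule.IsOrtho.sup_inf_orthogonal_sup {A B V W : Submodule ℝ E} (hVW : V ⟂ W)
    (hA : A ≤ V) (hB : B ≤ W) : (V ⊔ W) ⊓ (A ⊔ B)ᗮ = (V ⊓ Aᗮ) ⊔ (W ⊓ Bᗮ) := by
  rw [← Submodule.inf_orthogonal]
  have hAW : W ≤ Aᗮ := (hVW.mono_left hA).symm.le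
  have hBV : V ≤ Bᗮ := (hVW.mono_right hB).le
  apply le_antisymm
  · rintro x ⟨hx, hxA, hxB⟩
    obtain ⟨v, hv, w, hw, rfl⟩ := Submodule.mem_sup.1 hx
    exact Submodule.add_mem_sup ⟨hv, (Submodule.add_mem_iff_left _ (hAW hw)).1 hxA⟩
      ⟨hw, (Submodule.add_mem_iff_right _ (hBV hv)).1 hxB⟩
  · exact sup_le (le_inf (inf_le_left.trans le_sup_left)
      (le_inf inf_le_right (inf_le_left.trans hBV)))
      (le_inf (inf_le_left.trans le_sup_right)
        (le_inf (inf_le_left.trans hAW) inf_le_right))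

theorem perpIn_add {V W : Submodule ℝ E} (hVW : V ⟂ W) {σ τ : Set E} (hσ : σ.Nonempty)
    (hτ : τ.Nonempty) (hσV : vectorSpan ℝ σ ≤ V) (hτW : vectorSpan ℝ τ ≤ W) :
    perpIn (V ⊔ W) (σ + τ) = perpIn V σ ⊔ perpIn W τ := by
  rw [perpIn, vectorSpan_add hσ hτ]
  exact hVW.sup_inf_orthogonal_sup hσV hτW

theorem normalCone_add {V W : Submodule ℝ E} (hVW : V ⟂ W) {P Q σ τ : Set E}
    (hPV : vectorSpan ℝ P ≤ V) (hQW : vectorSpan ℝ Q ≤ W)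
    (hσP : σ ⊆ P) (hτQ : τ ⊆ Q) {x y : E} (hx : x ∈ σ) (hy : y ∈ τ) :
    normalCone (V ⊔ W) (P + Q) (σ + τ) (x + y) = normalCone V P σ x + normalCone W Q τ y := by
  have hperp := perpIn_add hVW ⟨x, hx⟩ ⟨y, hy⟩ ((vectorSpan_mono ℝ hσP).trans hPV)
    ((vectorSpan_mono ℝ hτQ).trans hQW)
  ext u
  simp only [normalCone_eq, hperp, Set.mem_add, Set.mem_inter_iff, SetLike.mem_coe,
    Submodule.mem_sup]
  constructor
  · rintro ⟨⟨w, hw, z, hz, rfl⟩, h⟩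
    have := (add_mem_tangent_add_iff hVW hPV hQW (hσP hx) (hτQ hy) hw.1 hz.1).1 h
    exact ⟨w, ⟨hw, this.1⟩, z, ⟨hz, this.2⟩, rfl⟩
  · rintro ⟨w, ⟨hw, hwt⟩, z, ⟨hz, hzt⟩, rfl⟩
    exact ⟨⟨w, hw, z, hz, rfl⟩,
      (add_mem_tangent_add_iff hVW hPV hQW (hσP hx) (hτQ hy) hw.1 hz.1).2 ⟨hwt, hzt⟩⟩

variable {𝒞 : Set E → Prop} {F : ConeMor E k} {g : Submodule ℝ E → Set E → k}

/-- The boundary of σ × τ is ∂σ × τ ∪ σ × ∂τ, with intersection ∂σ × ∂τ; inclusion-exclusion gives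
the factorization. -/
theorem IsValFam.openVal_add (h𝒞 : IsCellKind 𝒞) (hg : IsValFam 𝒞 g) {V W : Submodule ℝ E}
    [FiniteDimensional ℝ V] [FiniteDimensional ℝ W] (hVW : V ⟂ W) {K K' : Finset (Set E)}
    (hK : IsComplex K) (hK𝒞 : ∀ σ ∈ K, 𝒞 σ) (hK' : IsComplex K') (hK𝒞' : ∀ σ ∈ K', 𝒞 σ)
    {σ τ : Set E} (hσ : σ ∈ K) (hτ : τ ∈ K') (hσV : vectorSpan ℝ σ ≤ V)
    (hτW : vectorSpan ℝ τ ≤ W) :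
    openVal g (V ⊔ W) (σ + τ) = openVal g V σ * openVal g W τ := by
  have hσu := isUnion_of_cell (hK𝒞 σ hσ)
  have hτu := isUnion_of_cell (hK𝒞' τ hτ)
  have hbσ := (hK.adapted_boundary hσ).isUnion hK𝒞
  have hbτ := (hK'.adapted_boundary hτ).isUnion hK𝒞'
  have hbσV := (vectorSpan_mono ℝ (Set.sdiff_subset (s := σ) (t := relCore σ))).trans hσV
  have hbτW := (vectorSpan_mono ℝ (Set.sdiff_subset (s := τ) (t := relCore τ))).trans hτW
  have hfd : FiniteDimensional ℝ (V ⊔ W : Submodule ℝ E) := inferInstance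
  rw [openVal, add_sdiff_relCore_add hVW hσV hτW (hK.poly σ hσ).convex (hK'.poly τ hτ).convex,
    hg.map_union _ _ _ hfd (hbσ.add h𝒞 hτu) (hσu.add h𝒞 hbτ)
      ((vectorSpan_mono ℝ (Set.union_subset (Set.add_subset_add_right Set.sdiff_subset)
        (Set.add_subset_add_left Set.sdiff_subset))).trans (vectorSpan_add_le hσV hτW)),
    add_inter_add hVW hσV hτW Set.sdiff_subset Set.sdiff_subset,
    hg.map_prod V W _ _ hVW inferInstance inferInstance hσu hτu hσV hτW,
    hg.map_prod V W _ _ hVW inferInstance inferInstance hbσ hτu hbσV hτW,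
    hg.map_prod V W _ _ hVW inferInstance inferInstance hσu hbτ hσV hbτW,
    hg.map_prod V W _ _ hVW inferInstance inferInstance hbσ hbτ hbσV hbτW, openVal, openVal]
  ring

open Classical in
/-- The sums of the cells of two complexes. -/
noncomputable def productCells (K K' : Finset (Set E)) : Finset (Set E) :=
  (K ×ˢ K').image fun p => p.1 + p.2

theorem mem_productCells {K K' : Finset (Set E)} {ρ : Set E} :
    ρ ∈ productCells K K' ↔ ∃ σ ∈ K, ∃ τ ∈ K', σ + τ = ρ := by
  classical
  simp [productCells, and_assoc]

section

variable (h𝒞 : IsCellKind 𝒞) {V W : Submodule ℝ E} (hVW : V ⟂ W) {P Q : Set E}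
  (hPV : vectorSpan ℝ P ≤ V) (hQW : vectorSpan ℝ Q ≤ W) {K K' : Finset (Set E)}
  (hK : IsComplex K) (hK' : IsComplex K') (hKP : ∀ σ ∈ K, σ ⊆ P) (hKQ : ∀ σ ∈ K', σ ⊆ Q)

include hVW hPV hQW hK hK' hKP hKQ

theorem mem_relCore_productCell {σ τ : Set E} (hσ : σ ∈ K) (hτ : τ ∈ K') {x y : E} (hx : x ∈ σ)
    (hy : y ∈ τ) : x + y ∈ relCore (σ + τ) ↔ x ∈ relCore σ ∧ y ∈ relCore τ :=
  add_mem_relCore_add_iff hVW ((vectorSpan_mono ℝ (hKP σ hσ)).trans hPV)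
    ((vectorSpan_mono ℝ (hKQ τ hτ)).trans hQW) (hK.poly σ hσ).convex (hK'.poly τ hτ).convex hx hy

theorem isComplex_productCells (hpoly : ∀ σ ∈ K, ∀ τ ∈ K', IsPolyhedron (σ + τ)) :
    IsComplex (productCells K K') where
  poly ρ hρ := by
    obtain ⟨σ, hσ, τ, hτ, rfl⟩ := mem_productCells.1 hρ
    exact hpoly σ hσ τ hτ
  exists_mem_relCore ρ hρ z hz := by
    obtain ⟨σ, hσ, τ, hτ, rfl⟩ := mem_productCells.1 hρ
    obtain ⟨x, hx, y, hy, rfl⟩ := hz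
    obtain ⟨σ', hσ', hx'⟩ := hK.exists_mem_relCore σ hσ x hx
    obtain ⟨τ', hτ', hy'⟩ := hK'.exists_mem_relCore τ hτ y hy
    exact ⟨σ' + τ', mem_productCells.2 ⟨σ', hσ', τ', hτ', rfl⟩,
      (mem_relCore_productCell hVW hPV hQW hK hK' hKP hKQ hσ' hτ' hx'.1 hy'.1).2 ⟨hx', hy'⟩⟩
  subset ρ hρ ρ' hρ' z hz hz' := by
    obtain ⟨σ, hσ, τ, hτ, rfl⟩ := mem_productCells.1 hρ
    obtain ⟨σ', hσ', τ', hτ', rfl⟩ := mem_productCells.1 hρ'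
    obtain ⟨x, hx, y, hy, rfl⟩ := hz.1
    obtain ⟨x', hx', y', hy', heq⟩ := hz'
    obtain ⟨rfl, rfl⟩ := hVW.add_eq_add_iff
      (hPV (sub_mem_vectorSpan (hKP σ' hσ' hx') (hKP σ hσ hx)))
      (hQW (sub_mem_vectorSpan (hKQ τ' hτ' hy') (hKQ τ hτ hy))) heq
    have h := (mem_relCore_productCell hVW hPV hQW hK hK' hKP hKQ hσ hτ hx hy).1 hz
    exact Set.add_subset_add (hK.subset σ hσ σ' hσ' _ h.1 hx') (hK'.subset τ hτ τ' hτ' _ h.2 hy')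

/-- Distinct pairs give distinct product cells, so a sum over the product cells is a double sum. -/
theorem injOn_productCells :
    Set.InjOn (fun p : Set E × Set E => p.1 + p.2) (K ×ˢ K' : Finset (Set E × Set E)) := by
  have key : ∀ σ ∈ K, ∀ τ ∈ K', ∀ σ' ∈ K, ∀ τ' ∈ K', σ + τ = σ' + τ' → σ ⊆ σ' ∧ τ ⊆ τ' := by
    intro σ hσ τ hτ σ' hσ' τ' hτ' heq
    have h : ∀ x ∈ σ, ∀ y ∈ τ, x ∈ σ' ∧ y ∈ τ' := by
      intro x hx y hy
      have hmem : x + y ∈ σ' + τ' := heq ▸ Set.add_mem_add hx hy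
      obtain ⟨x', hx', y', hy', h⟩ := hmem
      obtain ⟨rfl, rfl⟩ := hVW.add_eq_add_iff
        (hPV (sub_mem_vectorSpan (hKP σ' hσ' hx') (hKP σ hσ hx)))
        (hQW (sub_mem_vectorSpan (hKQ τ' hτ' hy') (hKQ τ hτ hy))) h
      exact ⟨hx', hy'⟩
    obtain ⟨x, hx⟩ := (hK.poly σ hσ).1
    obtain ⟨y, hy⟩ := (hK'.poly τ hτ).1
    exact ⟨fun z hz => (h z hz y hy).1, fun z hz => (h x hx z hz).2⟩
  rintro ⟨σ, τ⟩ h ⟨σ', τ'⟩ h' heq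
  obtain ⟨hσ, hτ⟩ := Finset.mem_product.1 h
  obtain ⟨hσ', hτ'⟩ := Finset.mem_product.1 h'
  have h1 := key σ hσ τ hτ σ' hσ' τ' hτ' heq
  have h2 := key σ' hσ' τ' hτ' σ hσ τ hτ heq.symm
  exact Prod.ext (h1.1.antisymm h2.1) (h1.2.antisymm h2.2)

end

/-- Computed with the product complex, the term of σ × τ factors: both the normal cone and the open
cell are orthogonal products. -/
theorem starVal_add (h𝒞 : IsCellKind 𝒞) (hg : IsValFam 𝒞 g)
    (hFg : ∀ W : Submodule ℝ E, FiniteDimensional ℝ W → F.toFun W (W : Set E) = g W {0})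
    {V W : Submodule ℝ E} [FiniteDimensional ℝ V] [FiniteDimensional ℝ W] (hVW : V ⟂ W)
    {P Q : Set E} (hP : IsUnion 𝒞 P) (hQ : IsUnion 𝒞 Q) (hPV : vectorSpan ℝ P ≤ V)
    (hQW : vectorSpan ℝ Q ≤ W) :
    starVal 𝒞 F.toFun g (V ⊔ W) (P + Q) =
      starVal 𝒞 F.toFun g V P * starVal 𝒞 F.toFun g W Q := by
  classical
  obtain ⟨K₀, b, hK₀, had⟩ := h𝒞.exists_pointed (P := fun b : Bool => cond b P Q)
    (by intro b; cases b <;> assumption)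
  have hP₀ : Adapted K₀ P := had true
  have hQ₀ : Adapted K₀ Q := had false
  have hK := hK₀.below P
  have hK' := hK₀.below Q
  have hKP : ∀ σ ∈ below K₀ P, σ ⊆ P := fun σ hσ => (mem_below.1 hσ).2
  have hKQ : ∀ σ ∈ below K₀ Q, σ ⊆ Q := fun σ hσ => (mem_below.1 hσ).2
  have hK𝒞 : ∀ σ ∈ below K₀ P, 𝒞 σ := fun σ hσ => hK₀.kind σ (mem_below.1 hσ).1
  have hK𝒞' : ∀ σ ∈ below K₀ Q, 𝒞 σ := fun σ hσ => hK₀.kind σ (mem_below.1 hσ).1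
  have hL := isComplex_productCells hVW hPV hQW hK hK' hKP hKQ fun σ hσ τ hτ =>
    h𝒞.poly _ (h𝒞.add σ τ (hK𝒞 σ hσ) (hK𝒞' τ hτ))
  obtain ⟨c, hc⟩ := hL.exists_base
  have hL2 : IsPointedComplex 𝒞 (productCells (below K₀ P) (below K₀ Q)) c := by
    refine ⟨hL, fun ρ hρ => ?_, hc⟩
    obtain ⟨σ, hσ, τ, hτ, rfl⟩ := mem_productCells.1 hρ
    exact h𝒞.add σ τ (hK𝒞 σ hσ) (hK𝒞' τ hτ)
  have hPQ : ⋃₀ (productCells (below K₀ P) (below K₀ Q) : Set (Set E)) = P + Q := by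
    ext z
    constructor
    · rintro ⟨ρ, hρ, hz⟩
      obtain ⟨σ, hσ, τ, hτ, rfl⟩ := mem_productCells.1 hρ
      exact Set.add_subset_add (hKP σ hσ) (hKQ τ hτ) hz
    · rintro ⟨x, hx, y, hy, rfl⟩
      rw [← hP₀.sUnion_below] at hx
      rw [← hQ₀.sUnion_below] at hy
      obtain ⟨σ, hσ, hx⟩ := hx
      obtain ⟨τ, hτ, hy⟩ := hy
      exact ⟨σ + τ, mem_productCells.2 ⟨σ, hσ, τ, hτ, rfl⟩, Set.add_mem_add hx hy⟩
  have hLPQ : Adapted (productCells (below K₀ P) (below K₀ Q)) (P + Q) := hPQ ▸ hL.adapted_sUnion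
  have hbelow : below (productCells (below K₀ P) (below K₀ Q)) (P + Q) =
      productCells (below K₀ P) (below K₀ Q) := by
    refine (below_subset _ _).antisymm fun ρ hρ => mem_below.2 ⟨hρ, ?_⟩
    rw [← hPQ]
    exact Set.subset_sUnion_of_mem hρ
  rw [starVal_eq h𝒞 hg hFg (vectorSpan_add_le hPV hQW) hL2 hLPQ, starVal_eq h𝒞 hg hFg hPV hK₀ hP₀,
    starVal_eq h𝒞 hg hFg hQW hK₀ hQ₀, starOn, hbelow, starOn, starOn, Finset.sum_mul_sum,
    ← Finset.sum_product', productCells,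
    Finset.sum_image (injOn_productCells hVW hPV hQW hK hK' hKP hKQ)]
  refine Finset.sum_congr rfl fun ⟨σ, τ⟩ hp => ?_
  obtain ⟨hσ, hτ⟩ := Finset.mem_product.1 hp
  change σ ∈ _ at hσ
  change τ ∈ _ at hτ
  change F.toFun (perpIn (V ⊔ W) (σ + τ)) (normalCone (V ⊔ W) (P + Q) (σ + τ) (c (σ + τ))) *
    openVal g (vectorSpan ℝ (σ + τ)) (σ + τ) =
    F.toFun (perpIn V σ) (normalCone V P σ (b σ)) * openVal g (vectorSpan ℝ σ) σ *
      (F.toFun (perpIn W τ) (normalCone W Q τ (b τ)) * openVal g (vectorSpan ℝ τ) τ)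
  -- The base point of σ × τ splits into interior points x of σ and y of τ, which may replace b σ
  -- and b τ in the normal cones.
  have hcm := hc _ (mem_productCells.2 ⟨σ, hσ, τ, hτ, rfl⟩)
  obtain ⟨x, hx, y, hy, hxy⟩ := hcm.1
  change x + y = _ at hxy
  rw [← hxy] at hcm ⊢
  have hxy' := (mem_relCore_productCell hVW hPV hQW hK hK' hKP hKQ hσ hτ hx hy).1 hcm
  have hσne := (hK.poly σ hσ).1
  have hτne := (hK'.poly τ hτ).1
  have hσV := (vectorSpan_mono ℝ (hKP σ hσ)).trans hPV
  have hτW := (vectorSpan_mono ℝ (hKQ τ hτ)).trans hQW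
  have hσ₀ := (mem_below.1 hσ).1
  have hτ₀ := (mem_below.1 hτ).1
  have hfdσ := (hK.poly σ hσ).finiteDimensional
  have hfdτ := (hK'.poly τ hτ).finiteDimensional
  rw [normalCone_add hVW hPV hQW (hKP σ hσ) (hKQ τ hτ) hx hy, perpIn_add hVW hσne hτne hσV hτW,
    F.map_prod (perpIn V σ) (perpIn W τ) _ _ ((hVW.mono_left inf_le_left).mono_right inf_le_left)
      (hP₀.isConeIn_normalCone hK₀.toIsComplex hσ₀ hxy'.1 V)
      (hQ₀.isConeIn_normalCone hK₀.toIsComplex hτ₀ hxy'.2 W), vectorSpan_add hσne hτne,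
    hg.openVal_add h𝒞 ((hVW.mono_left hσV).mono_right hτW) hK hK𝒞 hK' hK𝒞' hσ hτ le_rfl le_rfl,
    hP₀.normalCone_eq hK₀.toIsComplex hσ₀ hxy'.1 (hK₀.base σ hσ₀),
    hQ₀.normalCone_eq hK₀.toIsComplex hτ₀ hxy'.2 (hK₀.base τ hτ₀)]
  ring

/-- The star product can therefore again serve as the second factor of a star product. -/
theorem isValFam_starVal (h𝒞 : IsCellKind 𝒞) (hg : IsValFam 𝒞 g)
    (hFg : ∀ W : Submodule ℝ E, FiniteDimensional ℝ W → F.toFun W (W : Set E) = g W {0}) :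
    IsValFam 𝒞 (starVal 𝒞 F.toFun g) where
  map_empty _ _ := starVal_empty h𝒞 hg hFg
  map_union _ _ _ _ hA hB h := starVal_union h𝒞 hg hFg hA hB h
  map_prod _ _ _ _ hVW _ _ hA hB hAV hBW := starVal_add h𝒞 hg hFg hVW hA hB hAV hBW

end Product

/-! ### Links -/

section Link

set_option linter.unusedSectionVars false

variable {E : Type u} [NormedAddCommGroup E] [InnerProductSpace ℝ E] {k : Type v} [CommRing k]

open Classical in
/-- The normal cones at `σ` of the cells of `K` that lie in `P` and contain `σ`. -/
noncomputable def link (K : Finset (Set E)) (V : Submodule ℝ E) (P σ : Set E) (x : E) :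
    Finset (Set E) :=
  ((below K P).filter (σ ⊆ ·)).image fun τ => normalCone V τ σ x

theorem mem_link {K : Finset (Set E)} {V : Submodule ℝ E} {P σ : Set E} {x : E} {ρ : Set E} :
    ρ ∈ link K V P σ x ↔ ∃ τ ∈ K, τ ⊆ P ∧ σ ⊆ τ ∧ normalCone V τ σ x = ρ := by
  classical
  simp [link, and_assoc]

section

variable {V : Submodule ℝ E} {σ τ : Set E} (hσ : IsPolyhedron σ) (hτ : IsPolyhedron τ)
  (hστ : σ ⊆ τ) (hτV : vectorSpan ℝ τ ≤ V) {x : E} (hx : x ∈ relCore σ)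

include hσ hτ hστ hτV hx

theorem isConvexCone_normalCone : IsConvexCone (normalCone V τ σ x) :=
  isConvexCone_inter_tangent hτ (hστ hx.1) _

/-- The interior of ν(σ,τ) consists of the directions that enter int τ. As the tangent cone of `τ`
is the product of ν(σ,τ) and ⟨σ⟩, an interior point of ν(σ,τ) is interior to the tangent cone. -/
theorem mem_relCore_normalCone_iff {y : E} (hy : y ∈ perpIn V σ) :
    y ∈ relCore (normalCone V τ σ x) ↔ ∀ᶠ t : ℝ in 𝓝[>] 0, x + t • y ∈ relCore τ := by
  have hxτ := hστ hx.1
  have hfd := hσ.finiteDimensional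
  constructor
  · intro h
    refine mem_relCore_add_smul hτ.convex hxτ ⟨h.1.2, fun q hq => ?_⟩
    have hqV := hτV (tangent_subset_vectorSpan hxτ hq)
    have hσV := (vectorSpan_mono ℝ hστ).trans hτV
    rw [← Submodule.sup_orthogonal_inf_of_hasOrthogonalProjection hσV] at hqV
    obtain ⟨q₂, hq₂, q₁, hq₁, rfl⟩ := Submodule.mem_sup.1 hqV
    have hlin : ∀ z ∈ vectorSpan ℝ σ, z ∈ tangent τ x := fun z hz =>
      tangent_mono hστ x (hσ.vectorSpan_subset_tangent hx hz)
    have hq₁t : q₁ ∈ tangent τ x := by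
      simpa using hτ.convex.tangent_add_mem hq (hlin _ (neg_mem hq₂))
    obtain ⟨ε, hε, hm⟩ := h.2 q₁ ⟨⟨hq₁.2, hq₁.1⟩, hq₁t⟩
    refine ⟨ε, hε, ?_⟩
    convert hτ.convex.tangent_add_mem hm.2 (hlin _ (Submodule.smul_mem _ (-ε) hq₂)) using 1
    module
  · intro h
    refine ⟨⟨hy, h.mono fun t ht => ht.1⟩, fun q hq => ?_⟩
    obtain ⟨t, ⟨h1, h2⟩, ht⟩ := ((h.and (mem_tangent.1 hq.2)).and self_mem_nhdsWithin).exists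
    have ht : 0 < t := ht
    obtain ⟨ε, hε, hm⟩ := h1.2 _ h2
    refine ⟨ε, hε, Submodule.add_mem _ hy (Submodule.smul_mem _ _ (Submodule.sub_mem _ hy hq.1)),
      (hτ.convex.mem_tangent_iff hxτ).2 ⟨t, ht, ?_⟩⟩
    convert hm using 1
    module

/-- From a point of int τ in a direction interior to ν(σ,τ) one can move a little along any vector
of ⟨τ⟩ ∩ σ^⊥. -/
theorem vectorSpan_normalCone : vectorSpan ℝ (normalCone V τ σ x) = perpIn (vectorSpan ℝ τ) σ := by
  have hxτ := hστ hx.1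
  apply le_antisymm
  · exact vectorSpan_le_of_subset fun w hw => ⟨tangent_subset_vectorSpan hxτ hw.2, hw.1.2⟩
  · rintro u ⟨huτ, huσ⟩
    have hcone := isConvexCone_normalCone hσ hτ hστ hτV hx
    obtain ⟨y, hy⟩ := hcone.isPolyhedron.relCore_nonempty
    have hev := (mem_relCore_normalCone_iff hσ hτ hστ hτV hx hy.1.1).1 hy
    obtain ⟨t, h1, ht⟩ := (hev.and self_mem_nhdsWithin).exists
    have ht : 0 < t := ht
    obtain ⟨s, h2, hs⟩ := ((mem_tangent.1 (hτ.vectorSpan_subset_tangent h1 huτ)).and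
      self_mem_nhdsWithin).exists
    have hs : 0 < s := hs
    have h3 : t • y + s • u ∈ normalCone V τ σ x := by
      refine ⟨Submodule.add_mem _ (Submodule.smul_mem _ _ hy.1.1)
        (Submodule.smul_mem _ _ ⟨hτV huτ, huσ⟩), (hτ.convex.mem_tangent_iff hxτ).2 ⟨1, one_pos, ?_⟩⟩
      convert h2 using 1
      module
    have h4 := sub_mem_vectorSpan h3 (hcone.smul_mem ht.le hy.1)
    rw [add_sub_cancel_left] at h4
    exact (Submodule.smul_mem_iff _ hs.ne').1 h4

theorem perpIn_normalCone : perpIn (perpIn V σ) (normalCone V τ σ x) = perpIn V τ := by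
  have hfd := hσ.finiteDimensional
  rw [perpIn, vectorSpan_normalCone hσ hτ hστ hτV hx, perpIn, perpIn, perpIn, inf_assoc,
    Submodule.inf_orthogonal, Submodule.sup_inf_orthogonal (vectorSpan_mono ℝ hστ)]

theorem normalCone_vectorSpan : normalCone (vectorSpan ℝ τ) τ σ x = normalCone V τ σ x := by
  ext w
  exact ⟨fun h => ⟨⟨hτV h.1.1, h.1.2⟩, h.2⟩,
    fun h => ⟨⟨tangent_subset_vectorSpan (hστ hx.1) h.2, h.1.2⟩, h.2⟩⟩

/-- A ray in `τ` either eventually lies in int τ or eventually avoids it, so normal cones commute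
with taking the boundary. -/
theorem normalCone_boundary : normalCone (vectorSpan ℝ τ) (τ \ relCore τ) σ x =
    normalCone V τ σ x \ relCore (normalCone V τ σ x) := by
  ext w
  constructor
  · intro h
    have h1 : w ∈ normalCone V τ σ x :=
      ⟨⟨hτV h.1.1, h.1.2⟩, tangent_mono Set.sdiff_subset x h.2⟩
    refine ⟨h1, fun h2 => ?_⟩
    rw [mem_relCore_normalCone_iff hσ hτ hστ hτV hx h1.1] at h2
    obtain ⟨t, h3, h4⟩ := (h2.and (mem_tangent.1 h.2)).exists
    exact h4.2 h3
  · rintro ⟨h, h2⟩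
    rw [mem_relCore_normalCone_iff hσ hτ hστ hτV hx h.1] at h2
    refine ⟨⟨tangent_subset_vectorSpan (hστ hx.1) h.2, h.1.2⟩, ?_⟩
    have h3 : ∀ᶠ t : ℝ in 𝓝[>] 0, x + t • w ∉ relCore τ := by
      by_contra h4
      exact h2 (hτ.eventually_mem_relCore_of_frequently h4)
    exact (h3.and (mem_tangent.1 h.2)).mono fun t ht => ⟨ht.2, ht.1⟩

end

section

variable {K : Finset (Set E)} (hK : IsComplex K) {V : Submodule ℝ E} {P σ : Set E} {x : E}
  (hP : Adapted K P) (hPV : vectorSpan ℝ P ≤ V) (hσ : σ ∈ K) (hx : x ∈ relCore σ)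

include hK hPV hσ hx

/-- Some point x + t y is interior to `τ` and lies in `ρ`, so the inclusion is inherited from `K`.
-/
theorem relCore_normalCone_subset {τ ρ : Set E} (hτ : τ ∈ K) (hτP : τ ⊆ P) (hστ : σ ⊆ τ)
    (hρ : ρ ∈ K) {y : E} (hy : y ∈ relCore (normalCone V τ σ x))
    (hyρ : y ∈ normalCone V ρ σ x) : τ ⊆ ρ := by
  have h1 := (mem_relCore_normalCone_iff (hK.poly σ hσ) (hK.poly τ hτ) hστ
    ((vectorSpan_mono ℝ hτP).trans hPV) hx hy.1.1).1 hy
  obtain ⟨t, h1, h2⟩ := (h1.and (mem_tangent.1 hyρ.2)).exists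
  exact hK.subset τ hτ ρ hρ _ h1 h2

include hP

/-- A direction in a normal cone enters a definite open cell of `K`; this cell contains `σ`, and its
normal cone has the direction in its interior. -/
theorem isComplex_link : IsComplex (link K V P σ x) where
  poly ρ hρ := by
    obtain ⟨τ, hτ, hτP, hστ, rfl⟩ := mem_link.1 hρ
    exact (isConvexCone_normalCone (hK.poly σ hσ) (hK.poly τ hτ) hστ
      ((vectorSpan_mono ℝ hτP).trans hPV) hx).isPolyhedron
  exists_mem_relCore ρ hρ y hy := by
    obtain ⟨τ, hτ, hτP, hστ, rfl⟩ := mem_link.1 hρ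
    obtain ⟨ρ, hρ, hev⟩ := hK.exists_eventually_mem_relCore hτ hy.2
    have hyρ : y ∈ tangent ρ x := hev.mono fun t ht => ht.1
    have hσρ := hK.subset σ hσ ρ hρ x hx (mem_of_mem_tangent (hK.poly ρ hρ).isClosed hyρ)
    obtain ⟨t, h1, h2⟩ := (hev.and (mem_tangent.1 hy.2)).exists
    have hρP := hP.subset ρ hρ _ h1 (hτP h2)
    exact ⟨_, mem_link.2 ⟨ρ, hρ, hρP, hσρ, rfl⟩, (mem_relCore_normalCone_iff (hK.poly σ hσ)
      (hK.poly ρ hρ) hσρ ((vectorSpan_mono ℝ hρP).trans hPV) hx hy.1).2 hev⟩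
  subset ρ hρ ρ' hρ' y hy hy' := by
    obtain ⟨τ, hτ, hτP, hστ, rfl⟩ := mem_link.1 hρ
    obtain ⟨τ', hτ', hτP', hστ', rfl⟩ := mem_link.1 hρ'
    have h := relCore_normalCone_subset hK hPV hσ hx hτ hτP hστ hτ' hy hy'
    exact Set.inter_subset_inter_right _ (tangent_mono h x)

theorem sUnion_link : ⋃₀ (link K V P σ x : Set (Set E)) = normalCone V P σ x := by
  ext w
  constructor
  · rintro ⟨ρ, hρ, hw⟩
    obtain ⟨τ, hτ, hτP, hστ, rfl⟩ := mem_link.1 hρ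
    exact ⟨hw.1, tangent_mono hτP x hw.2⟩
  · rintro ⟨hw, hwt⟩
    obtain ⟨τ, hτ, hτP, hστ, hwτ⟩ := (hP.mem_tangent_iff hK hσ hx).1 hwt
    exact ⟨_, mem_link.2 ⟨τ, hτ, hτP, hστ, rfl⟩, hw, hwτ⟩

/-- For small s > 0 the point x + s y lies in int τ, and P near this point looks, along τ^⊥, like
ν(σ,P) near y. Only the cells ρ ⊇ τ matter on either side. -/
theorem normalCone_normalCone {τ : Set E} (hτ : τ ∈ K) (hτP : τ ⊆ P) (hστ : σ ⊆ τ) {y z : E}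
    (hy : y ∈ relCore (normalCone V τ σ x)) (hz : z ∈ relCore τ) :
    normalCone (perpIn V σ) (normalCone V P σ x) (normalCone V τ σ x) y = normalCone V P τ z := by
  have hτV := (vectorSpan_mono ℝ hτP).trans hPV
  have hσp := hK.poly σ hσ
  have hτp := hK.poly τ hτ
  have hL := isComplex_link hK hP hPV hσ hx
  have hLad : Adapted (link K V P σ x) (normalCone V P σ x) := by
    rw [← sUnion_link hK hP hPV hσ hx]
    exact hL.adapted_sUnion
  have hlk : normalCone V τ σ x ∈ link K V P σ x := mem_link.2 ⟨τ, hτ, hτP, hστ, rfl⟩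
  have hev := (mem_relCore_normalCone_iff hσp hτp hστ hτV hx hy.1.1).1 hy
  rw [normalCone_eq (perpIn V σ) (normalCone V P σ x) (normalCone V τ σ x) y,
    perpIn_normalCone hσp hτp hστ hτV hx, normalCone_eq V P τ z]
  ext w
  refine and_congr_right fun hw => ?_
  have hwσ : w ∈ perpIn V σ := ⟨hw.1, Submodule.orthogonal_le (vectorSpan_mono ℝ hστ) hw.2⟩
  rw [hLad.mem_tangent_iff hL hlk hy]
  constructor
  · rintro ⟨ρ, hρ, -, -, hwρ⟩
    obtain ⟨ρ, hρK, hρP, hσρ, rfl⟩ := mem_link.1 hρ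
    obtain ⟨t, h1, ht⟩ := ((mem_tangent.1 hwρ).and self_mem_nhdsWithin).exists
    have ht : 0 < t := ht
    obtain ⟨s, ⟨h2, h3⟩, hs⟩ :=
      ((hev.and (mem_tangent.1 h1.2)).and self_mem_nhdsWithin).exists
    have hs : 0 < s := hs
    have hτρ : τ ⊆ ρ := by
      have hyρ : y ∈ normalCone V ρ σ x := mem_of_mem_tangent
        (isConvexCone_normalCone hσp (hK.poly ρ hρK) hσρ
          ((vectorSpan_mono ℝ hρP).trans hPV) hx).isPolyhedron.isClosed hwρ
      exact relCore_normalCone_subset hK hPV hσ hx hτ hτP hστ hρK hy hyρ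
    -- The tangent cone of P is constant along int τ, so the base point `z` may be replaced by x + s
    -- y.
    rw [hP.tangent_eq hK hτ hz h2]
    refine tangent_mono hρP _ (((hK.poly ρ hρK).convex.mem_tangent_iff (hτρ h2.1)).2
      ⟨s * t, mul_pos hs ht, ?_⟩)
    convert h3 using 1
    module
  · intro hwP
    obtain ⟨s, h2, hs⟩ := (hev.and self_mem_nhdsWithin).exists
    have hs : 0 < s := hs
    rw [hP.tangent_eq hK hτ hz h2] at hwP
    obtain ⟨ρ, hρK, hρP, hτρ, hwρ⟩ := (hP.mem_tangent_iff hK hτ h2).1 hwP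
    have hσρ := hστ.trans hτρ
    have hcv := (hK.poly ρ hρK).convex
    obtain ⟨t, ht, h1⟩ := (hcv.mem_tangent_iff (hτρ h2.1)).1 hwρ
    have hcone := isConvexCone_normalCone hσp (hK.poly ρ hρK) hσρ
      ((vectorSpan_mono ℝ hρP).trans hPV) hx
    have hsub : normalCone V τ σ x ⊆ normalCone V ρ σ x :=
      Set.inter_subset_inter_right _ (tangent_mono hτρ x)
    have hlkρ : normalCone V ρ σ x ∈ link K V P σ x := mem_link.2 ⟨ρ, hρK, hρP, hσρ, rfl⟩
    refine ⟨_, hlkρ, ?_, hsub, ?_⟩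
    · exact Set.inter_subset_inter_right _ (tangent_mono hρP x)
    · refine (hcone.isPolyhedron.convex.mem_tangent_iff (hsub hy.1)).2 ⟨t / s, div_pos ht hs,
        Submodule.add_mem _ hy.1.1 (Submodule.smul_mem _ _ hwσ), ?_⟩
      refine (hcv.mem_tangent_iff (hσρ hx.1)).2 ⟨s, hs, ?_⟩
      rw [smul_add, smul_smul, mul_div_cancel₀ _ hs.ne', ← add_assoc]
      exact h1

-- The cell `τ` can be recovered from ν(σ,τ), so nothing is counted twice when the link is indexed
-- by cells of `K`.
open Classical in
theorem sum_link {M : Type*} [AddCommMonoid M] (f : Set E → M) :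
    ∑ ρ ∈ link K V P σ x, f ρ = ∑ τ ∈ (below K P).filter (σ ⊆ ·), f (normalCone V τ σ x) := by
  rw [link, Finset.sum_image]
  · intro τ hτ τ' hτ' heq
    rw [Finset.mem_coe, Finset.mem_filter, mem_below] at hτ hτ'
    have heq : normalCone V τ σ x = normalCone V τ' σ x := heq
    have hcone := isConvexCone_normalCone (hK.poly σ hσ) (hK.poly τ hτ.1.1) hτ.2
      ((vectorSpan_mono ℝ hτ.1.2).trans hPV) hx
    obtain ⟨y, hy⟩ := hcone.isPolyhedron.relCore_nonempty
    exact (relCore_normalCone_subset hK hPV hσ hx hτ.1.1 hτ.1.2 hτ.2 hτ'.1.1 hy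
      (heq ▸ hy.1)).antisymm (relCore_normalCone_subset hK hPV hσ hx hτ'.1.1 hτ'.1.2 hτ'.2 hτ.1.1
        (heq ▸ hy) hy.1)

end

end Link

/-! ### Associativity -/

section Assoc

set_option linter.unusedSectionVars false

variable {E : Type u} [NormedAddCommGroup E] [InnerProductSpace ℝ E] {k : Type v} [CommRing k]

theorem ConeMor.isValFam (F : ConeMor E k) : IsValFam IsConvexCone F.toFun where
  map_empty := F.map_empty
  map_union V A B hV hA hB h := F.map_union V A B
    ⟨hV, hA, IsCone.vectorSpan_le_iff hA |>.1 ((vectorSpan_mono ℝ Set.subset_union_left).trans h)⟩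
    ⟨hV, hB, IsCone.vectorSpan_le_iff hB |>.1 ((vectorSpan_mono ℝ Set.subset_union_right).trans h)⟩
  map_prod V W A B hVW hV hW hA hB hAV hBW := F.map_prod V W A B hVW
    ⟨hV, hA, IsCone.vectorSpan_le_iff hA |>.1 hAV⟩ ⟨hW, hB, IsCone.vectorSpan_le_iff hB |>.1 hBW⟩

variable {𝒞 : Set E → Prop} {F G : ConeMor E k} {h : Submodule ℝ E → Set E → k}

-- The star sum of ν(σ,P) is computed with the link of `σ` as complex; the normal cone at its cell
-- ν(σ,τ) is ν(τ,P).
open Classical in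
theorem starVal_normalCone (hFG : ∀ W : Submodule ℝ E, FiniteDimensional ℝ W →
      F.toFun W (W : Set E) = G.toFun W {0})
    {V : Submodule ℝ E} [FiniteDimensional ℝ V] {P : Set E} {K : Finset (Set E)}
    {b : Set E → E} (hK : IsPointedComplex 𝒞 K b) (hP : Adapted K P) (hPV : vectorSpan ℝ P ≤ V)
    {σ : Set E} (hσ : σ ∈ K) :
    starVal IsConvexCone F.toFun G.toFun (perpIn V σ) (normalCone V P σ (b σ)) =
      ∑ τ ∈ (below K P).filter (σ ⊆ ·), F.toFun (perpIn V τ) (normalCone V P τ (b τ)) *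
        openVal G.toFun (perpIn (vectorSpan ℝ τ) σ) (normalCone V τ σ (b σ)) := by
  have hKc := hK.toIsComplex
  have hx := hK.base σ hσ
  have hfd := finiteDimensional_perpIn V σ
  have hL := isComplex_link hKc hP hPV hσ hx
  have hU := sUnion_link hKc hP hPV hσ hx
  obtain ⟨c, hc⟩ := hL.exists_base
  have hLp : IsPointedComplex IsConvexCone (link K V P σ (b σ)) c := by
    refine ⟨hL, fun ρ hρ => ?_, hc⟩
    obtain ⟨τ, hτ, hτP, hστ, rfl⟩ := mem_link.1 hρ
    exact isConvexCone_normalCone (hK.poly σ hσ) (hK.poly τ hτ) hστ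
      ((vectorSpan_mono ℝ hτP).trans hPV) hx
  have hbelow : below (link K V P σ (b σ)) (normalCone V P σ (b σ)) = link K V P σ (b σ) := by
    refine (below_subset _ _).antisymm fun ρ hρ => mem_below.2 ⟨hρ, ?_⟩
    rw [← hU]
    exact Set.subset_sUnion_of_mem hρ
  rw [starVal_eq isCellKind_convexCone G.isValFam hFG
    (vectorSpan_le_of_subset fun w hw => hw.1) hLp (hU ▸ hL.adapted_sUnion), starOn, hbelow,
    sum_link hKc hP hPV hσ hx]
  refine Finset.sum_congr rfl fun τ hτ => ?_
  rw [Finset.mem_filter, mem_below] at hτ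
  obtain ⟨⟨hτK, hτP⟩, hστ⟩ := hτ
  have hτV := (vectorSpan_mono ℝ hτP).trans hPV
  have hlk : normalCone V τ σ (b σ) ∈ link K V P σ (b σ) :=
    mem_link.2 ⟨τ, hτK, hτP, hστ, rfl⟩
  rw [normalCone_normalCone hKc hP hPV hσ hx hτK hτP hστ (hc _ hlk) (hK.base τ hτK),
    perpIn_normalCone (hK.poly σ hσ) (hK.poly τ hτK) hστ hτV hx,
    vectorSpan_normalCone (hK.poly σ hσ) (hK.poly τ hτK) hστ hτV hx]

/-- The star sums of τ and ∂τ run over the same cells. Subtracting them termwise replaces G(ν(σ,τ))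
by its value at the interior of ν(σ,τ). -/
theorem openVal_starVal (h𝒞 : IsCellKind 𝒞) (hh : IsValFam 𝒞 h)
    (hGh : ∀ W : Submodule ℝ E, FiniteDimensional ℝ W → G.toFun W (W : Set E) = h W {0})
    {V : Submodule ℝ E} {K : Finset (Set E)} {b : Set E → E} (hK : IsPointedComplex 𝒞 K b)
    {τ : Set E} (hτ : τ ∈ K) (hτV : vectorSpan ℝ τ ≤ V) :
    openVal (starVal 𝒞 G.toFun h) (vectorSpan ℝ τ) τ =
      ∑ σ ∈ below K τ, openVal G.toFun (perpIn (vectorSpan ℝ τ) σ) (normalCone V τ σ (b σ)) *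
        openVal h (vectorSpan ℝ σ) σ := by
  have hfd := (hK.poly τ hτ).finiteDimensional
  have hKτ : IsPointedComplex 𝒞 (below K τ) b := ⟨hK.below τ,
    fun σ hσ => hK.kind σ (mem_below.1 hσ).1, fun σ hσ => hK.base σ (mem_below.1 hσ).1⟩
  have hττ : τ ∈ below K τ := mem_below.2 ⟨hτ, subset_rfl⟩
  have had := hKτ.adapted_cell hττ
  have hbd := hKτ.adapted_boundary hττ
  rw [openVal, starVal_eq h𝒞 hh hGh le_rfl hKτ had, starVal_eq h𝒞 hh hGh
    (vectorSpan_mono ℝ Set.sdiff_subset) hKτ hbd, starOn_eq_sum hKτ had (hK.poly τ hτ).isClosed,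
    starOn_eq_sum hKτ hbd ((hbd.isUnion hKτ.kind).isClosed h𝒞), ← Finset.sum_sub_distrib]
  refine Finset.sum_congr rfl fun σ hσ => ?_
  obtain ⟨hσK, hστ⟩ := mem_below.1 hσ
  rw [← sub_mul, normalCone_boundary (hK.poly σ hσK) (hK.poly τ hτ) hστ hτV (hK.base σ hσK),
    normalCone_vectorSpan (hK.poly σ hσK) (hK.poly τ hτ) hστ hτV (hK.base σ hσK)]
  rfl

theorem starVal_assoc (h𝒞 : IsCellKind 𝒞) (hh : IsValFam 𝒞 h) {FG : ConeMor E k}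
    (hFG : ∀ V P, IsConeIn V P →
      FG.toFun V P = starVal IsConvexCone F.toFun G.toFun V P)
    (hFGs : ∀ W : Submodule ℝ E, FiniteDimensional ℝ W → F.toFun W (W : Set E) = G.toFun W {0})
    (hGh : ∀ W : Submodule ℝ E, FiniteDimensional ℝ W → G.toFun W (W : Set E) = h W {0})
    (hFh : ∀ W : Submodule ℝ E, FiniteDimensional ℝ W → FG.toFun W (W : Set E) = h W {0})
    (hFGh : ∀ W : Submodule ℝ E, FiniteDimensional ℝ W →
      F.toFun W (W : Set E) = starVal 𝒞 G.toFun h W {0})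
    {V : Submodule ℝ E} [FiniteDimensional ℝ V] {P : Set E} (hP : IsUnion 𝒞 P)
    (hPV : vectorSpan ℝ P ≤ V) :
    starVal 𝒞 FG.toFun h V P = starVal 𝒞 F.toFun (starVal 𝒞 G.toFun h) V P := by
  classical
  obtain ⟨K, b, hK, had⟩ := h𝒞.exists_pointed (P := fun _ : Unit => P) fun _ => hP
  have hPK := had ()
  rw [starVal_eq h𝒞 hh hFh hPV hK hPK,
    starVal_eq h𝒞 (isValFam_starVal h𝒞 hh hGh) hFGh hPV hK hPK, starOn, starOn]
  have h1 : ∀ σ ∈ below K P, FG.toFun (perpIn V σ) (normalCone V P σ (b σ)) *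
      openVal h (vectorSpan ℝ σ) σ = ∑ τ ∈ (below K P).filter (σ ⊆ ·),
        F.toFun (perpIn V τ) (normalCone V P τ (b τ)) *
        openVal G.toFun (perpIn (vectorSpan ℝ τ) σ) (normalCone V τ σ (b σ)) *
        openVal h (vectorSpan ℝ σ) σ := by
    intro σ hσ
    have hσK := (mem_below.1 hσ).1
    rw [hFG _ _ (hPK.isConeIn_normalCone hK.toIsComplex hσK (hK.base σ hσK) V),
      starVal_normalCone hFGs hK hPK hPV hσK, Finset.sum_mul]
  have h2 : ∀ τ ∈ below K P, F.toFun (perpIn V τ) (normalCone V P τ (b τ)) *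
      openVal (starVal 𝒞 G.toFun h) (vectorSpan ℝ τ) τ = ∑ σ ∈ below K τ,
        F.toFun (perpIn V τ) (normalCone V P τ (b τ)) *
        openVal G.toFun (perpIn (vectorSpan ℝ τ) σ) (normalCone V τ σ (b σ)) *
        openVal h (vectorSpan ℝ σ) σ := by
    intro τ hτ
    obtain ⟨hτK, hτP⟩ := mem_below.1 hτ
    rw [openVal_starVal h𝒞 hh hGh hK hτK ((vectorSpan_mono ℝ hτP).trans hPV), Finset.mul_sum]
    exact Finset.sum_congr rfl fun σ _ => (mul_assoc _ _ _).symm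
  rw [Finset.sum_congr rfl h1, Finset.sum_congr rfl h2]
  -- Both sides are now sums of the same terms over the pairs of cells σ ⊆ τ ⊆ P.
  refine Finset.sum_comm' fun σ τ => ?_
  simp only [Finset.mem_filter, mem_below]
  constructor
  · rintro ⟨⟨h1, h2⟩, ⟨h3, h4⟩, h5⟩
    exact ⟨⟨h1, h5⟩, h3, h4⟩
  · rintro ⟨⟨h1, h5⟩, h3, h4⟩
    exact ⟨⟨h1, h5.trans h4⟩, ⟨h3, h4⟩, h5⟩

end Assoc

/-! ### Morphisms and polytope invariants as families of valuations -/

section Families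

variable {E : Type u} [NormedAddCommGroup E] [InnerProductSpace ℝ E] {k : Type v} [CommRing k]

theorem IsConeIn.isUnion {V : Submodule ℝ E} {P : Set E} (h : IsConeIn V P) :
    IsUnion IsConvexCone P := h.2.1

theorem IsConeIn.vectorSpan_le {V : Submodule ℝ E} {P : Set E} (h : IsConeIn V P) :
    vectorSpan ℝ P ≤ V := vectorSpan_le_of_subset h.2.2

theorem IsConeIn.union {V : Submodule ℝ E} {P Q : Set E} (hP : IsConeIn V P) (hQ : IsConeIn V Q) :
    IsConeIn V (P ∪ Q) :=
  ⟨hP.1, hP.isUnion.union hQ.isUnion, Set.union_subset hP.2.2 hQ.2.2⟩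

theorem IsConeIn.inter {V : Submodule ℝ E} {P Q : Set E} (hP : IsConeIn V P) (hQ : IsConeIn V Q) :
    IsConeIn V (P ∩ Q) :=
  ⟨hP.1, hP.isUnion.inter isCellKind_convexCone hQ.isUnion, Set.inter_subset_left.trans hP.2.2⟩

theorem IsConeIn.add {V W : Submodule ℝ E} {P Q : Set E} (hP : IsConeIn V P) (hQ : IsConeIn W Q) :
    IsConeIn (V ⊔ W) (P + Q) := by
  have := hP.1
  have := hQ.1
  refine ⟨inferInstance, hP.isUnion.add isCellKind_convexCone hQ.isUnion, ?_⟩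
  rw [Submodule.coe_sup]
  exact Set.add_subset_add hP.2.2 hQ.2.2

theorem isConeIn_empty (V : Submodule ℝ E) [hV : FiniteDimensional ℝ V] : IsConeIn V ∅ :=
  ⟨hV, isCone_empty, Set.empty_subset _⟩

theorem IsPolytopeIn.isUnion {V : Submodule ℝ E} {P : Set E} (h : IsPolytopeIn V P) :
    IsUnion IsConvexPolytope P := h.2.1

theorem IsPolytopeIn.vectorSpan_le {V : Submodule ℝ E} {P : Set E} (h : IsPolytopeIn V P) :
    vectorSpan ℝ P ≤ V := vectorSpan_le_of_subset h.2.2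

theorem IsPolytopeIn.union {V : Submodule ℝ E} {P Q : Set E} (hP : IsPolytopeIn V P)
    (hQ : IsPolytopeIn V Q) : IsPolytopeIn V (P ∪ Q) :=
  ⟨hP.1, hP.isUnion.union hQ.isUnion, Set.union_subset hP.2.2 hQ.2.2⟩

theorem IsPolytopeIn.inter {V : Submodule ℝ E} {P Q : Set E} (hP : IsPolytopeIn V P)
    (hQ : IsPolytopeIn V Q) : IsPolytopeIn V (P ∩ Q) :=
  ⟨hP.1, hP.isUnion.inter isCellKind_convexPolytope hQ.isUnion,
    Set.inter_subset_left.trans hP.2.2⟩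

theorem IsPolytopeIn.add {V W : Submodule ℝ E} {P Q : Set E} (hP : IsPolytopeIn V P)
    (hQ : IsPolytopeIn W Q) : IsPolytopeIn (V ⊔ W) (P + Q) := by
  have := hP.1
  have := hQ.1
  refine ⟨inferInstance, hP.isUnion.add isCellKind_convexPolytope hQ.isUnion, ?_⟩
  rw [Submodule.coe_sup]
  exact Set.add_subset_add hP.2.2 hQ.2.2

theorem isConvexPolytope_singleton (x : E) : IsConvexPolytope ({x} : Set E) := ⟨{x}, by simp⟩

theorem IsUnion.vadd {A : Set E} (hA : IsUnion IsConvexPolytope A) (x : E) :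
    IsUnion IsConvexPolytope (x +ᵥ A) := by
  have := (isUnion_of_cell (isConvexPolytope_singleton x)).add isCellKind_convexPolytope hA
  rwa [Set.singleton_add] at this

theorem IsPolytopeIn.vadd {V : Submodule ℝ E} {P : Set E} (hP : IsPolytopeIn V P) {x : E}
    (hx : x ∈ V) : IsPolytopeIn V (x +ᵥ P) := by
  refine ⟨hP.1, hP.isUnion.vadd x, ?_⟩
  rintro _ ⟨y, hy, rfl⟩
  exact V.add_mem hx (hP.2.2 hy)

open Classical in
/-- The morphism given by a multiplicative family of valuations. -/
noncomputable def ConeMor.ofValFam (g : Submodule ℝ E → Set E → k) (hg : IsValFam IsConvexCone g)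
    (h0 : g ⊥ {0} = 1) : ConeMor E k where
  toFun V P := if IsConeIn V P then g V P else 0
  junk V P h := if_neg h
  map_empty V hV := by rw [if_pos (isConeIn_empty V), hg.map_empty V hV]
  map_union V P Q hP hQ := by
    rw [if_pos hP, if_pos hQ, if_pos (hP.union hQ), if_pos (hP.inter hQ)]
    exact hg.map_union V P Q hP.1 hP.isUnion hQ.isUnion (hP.union hQ).vectorSpan_le
  map_prod V W P Q hVW hP hQ := by
    rw [if_pos hP, if_pos hQ, if_pos (hP.add hQ)]
    exact hg.map_prod V W P Q hVW hP.1 hQ.1 hP.isUnion hQ.isUnion hP.vectorSpan_le hQ.vectorSpan_le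
  map_zero := by rw [if_pos (isConeIn_zero ⊥), h0]

theorem ConeMor.ofValFam_apply {g : Submodule ℝ E → Set E → k} (hg : IsValFam IsConvexCone g)
    (h0 : g ⊥ {0} = 1) {V : Submodule ℝ E} {P : Set E} (hP : IsConeIn V P) :
    (ConeMor.ofValFam g hg h0).toFun V P = g V P := by
  classical
  exact if_pos hP

theorem ConeMor.ext_of_isConeIn {F G : ConeMor E k}
    (h : ∀ V P, IsConeIn V P → F.toFun V P = G.toFun V P) : F = G := by
  ext V P
  by_cases hP : IsConeIn V P
  · exact h V P hP
  · rw [F.junk V P hP, G.junk V P hP]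

theorem PolyInv.ext_of_isPolytopeIn {F G : PolyInv E k}
    (h : ∀ V P, IsPolytopeIn V P → F.toFun V P = G.toFun V P) : F = G := by
  ext V P
  by_cases hP : IsPolytopeIn V P
  · exact h V P hP
  · rw [F.junk V P hP, G.junk V P hP]

theorem VectObj.ext_of_finiteDimensional {A B : VectObj E k}
    (h : ∀ V : Submodule ℝ E, FiniteDimensional ℝ V → A.toFun V = B.toFun V) : A = B := by
  ext V
  by_cases hV : FiniteDimensional ℝ V
  · exact h V hV
  · rw [A.junk V hV, B.junk V hV]

open Classical in
/-- The polytope invariant given by a multiplicative family of valuations. -/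
noncomputable def PolyInv.ofValFam (g : Submodule ℝ E → Set E → k)
    (hg : IsValFam IsConvexPolytope g) (h1 : ∀ x, g ⊥ {x} = 1) : PolyInv E k where
  toFun V P := if IsPolytopeIn V P then g V P else 0
  junk V P h := if_neg h
  map_empty V hV := by rw [hg.map_empty V hV, ite_self]
  map_union V P Q hP hQ := by
    rw [if_pos hP, if_pos hQ, if_pos (hP.union hQ), if_pos (hP.inter hQ)]
    exact hg.map_union V P Q hP.1 hP.isUnion hQ.isUnion (hP.union hQ).vectorSpan_le
  map_translate V P hP x hx := by
    have := hP.1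
    rw [if_pos hP, if_pos (hP.vadd hx)]
    -- Translation by `x` is the product with the point `x`, which lies in a translate of the zero
    -- subspace.
    have h := hg.map_prod ⊥ V {x} P Submodule.isOrtho_bot_left inferInstance hP.1
      (isUnion_of_cell (isConvexPolytope_singleton x)) hP.isUnion (by simp) hP.vectorSpan_le
    rwa [bot_sup_eq, h1, one_mul, Set.singleton_add] at h
  map_prod V W P Q hVW hP hQ := by
    rw [if_pos hP, if_pos hQ, if_pos (hP.add hQ)]
    exact hg.map_prod V W P Q hVW hP.1 hQ.1 hP.isUnion hQ.isUnion hP.vectorSpan_le hQ.vectorSpan_le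
  map_zero := by rw [if_pos (isPolytopeIn_zero ⊥), h1]

theorem PolyInv.ofValFam_apply {g : Submodule ℝ E → Set E → k} (hg : IsValFam IsConvexPolytope g)
    (h1 : ∀ x, g ⊥ {x} = 1) {V : Submodule ℝ E} {P : Set E} (hP : IsPolytopeIn V P) :
    (PolyInv.ofValFam g hg h1).toFun V P = g V P := by
  classical
  exact if_pos hP

open Classical in
/-- The value of a polytope invariant at a polytope in a translate of `V`. -/
noncomputable def PolyInv.val (G : PolyInv E k) (V : Submodule ℝ E) (A : Set E) : k :=
  if h : A.Nonempty then G.toFun V (-h.some +ᵥ A) else 0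

/-- Two translations that bring `A` into `V` differ by a vector of `V`, so translation invariance
makes the choice irrelevant. -/
theorem PolyInv.val_eq (G : PolyInv E k) {V : Submodule ℝ E} {A : Set E} {y : E}
    (h : IsPolytopeIn V (-y +ᵥ A)) : G.val V A = G.toFun V (-y +ᵥ A) := by
  rw [PolyInv.val]
  split_ifs with hA
  · have hmem : y - hA.some ∈ V := by
      have := V.neg_mem (h.2.2 (Set.vadd_mem_vadd_set hA.some_mem))
      rwa [vadd_eq_add, neg_add, neg_neg, ← sub_eq_add_neg] at this
    rw [← G.map_translate V _ h _ hmem, vadd_vadd]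
    congr 2
    abel
  · rw [Set.not_nonempty_iff_eq_empty.1 hA, Set.vadd_set_empty, G.map_empty V h.1]

theorem isPolytopeIn_neg_vadd {V : Submodule ℝ E} [hV : FiniteDimensional ℝ V] {A : Set E} {y : E}
    (hA : IsUnion IsConvexPolytope A) (h : ∀ x ∈ A, x - y ∈ V) : IsPolytopeIn V (-y +ᵥ A) := by
  refine ⟨hV, hA.vadd _, ?_⟩
  rintro _ ⟨x, hx, rfl⟩
  change -y + x ∈ V
  rw [neg_add_eq_sub]
  exact h x hx

theorem PolyInv.val_eq_toFun (G : PolyInv E k) {V : Submodule ℝ E} {A : Set E}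
    (h : IsPolytopeIn V A) : G.val V A = G.toFun V A := by
  have := G.val_eq (V := V) (A := A) (y := 0)
  rw [neg_zero, zero_vadd] at this
  exact this h

theorem PolyInv.val_singleton (G : PolyInv E k) (V : Submodule ℝ E) [FiniteDimensional ℝ V]
    (x : E) : G.val V {x} = G.toFun V {0} := by
  rw [G.val_eq (y := x) (isPolytopeIn_neg_vadd (isUnion_of_cell (isConvexPolytope_singleton x))
    (by simp))]
  simp

theorem PolyInv.isValFam (G : PolyInv E k) : IsValFam IsConvexPolytope G.val where
  map_empty V hV := by simp [PolyInv.val]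
  map_union V A B hV hA hB h := by
    rcases (A ∪ B).eq_empty_or_nonempty with h0 | ⟨y, hy⟩
    · rw [Set.union_empty_iff] at h0
      simp [h0.1, h0.2, PolyInv.val]
    · have hm : ∀ x ∈ A ∪ B, x - y ∈ V := fun x hx => h (sub_mem_vectorSpan hx hy)
      have h1 := isPolytopeIn_neg_vadd hA fun x hx => hm x (Or.inl hx)
      have h2 := isPolytopeIn_neg_vadd hB fun x hx => hm x (Or.inr hx)
      have h3 := h1.union h2
      have h4 := h1.inter h2
      rw [← Set.vadd_set_union] at h3
      rw [← Set.vadd_set_inter] at h4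
      rw [G.val_eq h1, G.val_eq h2, G.val_eq h3, G.val_eq h4, Set.vadd_set_union,
        Set.vadd_set_inter]
      exact G.map_union V _ _ h1 h2
  map_prod V W A B hVW hV hW hA hB hAV hBW := by
    rcases A.eq_empty_or_nonempty with rfl | ⟨y, hy⟩
    · simp [PolyInv.val]
    rcases B.eq_empty_or_nonempty with rfl | ⟨z, hz⟩
    · simp [PolyInv.val]
    have h1 := isPolytopeIn_neg_vadd hA fun x hx => hAV (sub_mem_vectorSpan hx hy)
    have h2 := isPolytopeIn_neg_vadd hB fun x hx => hBW (sub_mem_vectorSpan hx hz)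
    have h3 : -(y + z) +ᵥ (A + B) = (-y +ᵥ A) + (-z +ᵥ B) := by
      rw [← Set.singleton_vadd, ← Set.singleton_vadd, ← Set.singleton_vadd, vadd_eq_add,
        vadd_eq_add, vadd_eq_add, neg_add, ← Set.singleton_add_singleton, add_add_add_comm]
    have h4 := h1.add h2
    rw [← h3] at h4
    rw [G.val_eq h1, G.val_eq h2, G.val_eq h4, h3]
    exact G.map_prod V W _ _ hVW h1 h2

end Families

/-! ### Special values of the star product -/

section Special

set_option linter.unusedSectionVars false

variable {E : Type u} [NormedAddCommGroup E] [InnerProductSpace ℝ E] {k : Type v} [CommRing k]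
  {𝒞 : Set E → Prop} {F : ConeMor E k} {g : Submodule ℝ E → Set E → k}

/-- A cell without boundary is a complex by itself, with normal cone 0. The cases of a point and of
a subspace give target, location and source. -/
theorem starVal_of_relCore_eq (h𝒞 : IsCellKind 𝒞) (hg : IsValFam 𝒞 g)
    (hFg : ∀ W : Submodule ℝ E, FiniteDimensional ℝ W → F.toFun W (W : Set E) = g W {0})
    {V : Submodule ℝ E} [FiniteDimensional ℝ V] {σ : Set E} (hσ : 𝒞 σ) (hc : relCore σ = σ)
    (hσV : vectorSpan ℝ σ ≤ V) :
    starVal 𝒞 F.toFun g V σ = F.toFun (perpIn V σ) {0} * g (vectorSpan ℝ σ) σ := by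
  have hp := h𝒞.poly σ hσ
  obtain ⟨x, hx⟩ := hp.relCore_nonempty
  have hK : IsPointedComplex 𝒞 {σ} fun _ => x := by
    refine ⟨⟨by simpa using hp, ?_, ?_⟩, by simpa using hσ, by simpa using hx⟩
    · simp [hc]
    · simp
  have hb : below {σ} σ = {σ} := by
    ext ρ
    simp only [mem_below, Finset.mem_singleton, and_iff_left_iff_imp]
    rintro rfl
    exact subset_rfl
  rw [starVal_eq h𝒞 hg hFg hσV hK (hK.adapted_cell (Finset.mem_singleton_self σ)), starOn, hb,
    Finset.sum_singleton, openVal, hc, sdiff_self, Set.bot_eq_empty,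
    hg.map_empty _ hp.finiteDimensional, sub_zero]
  congr 2
  ext w
  rw [Set.mem_singleton_iff]
  constructor
  · intro hw
    have h1 : w ∈ vectorSpan ℝ σ := tangent_subset_vectorSpan hx.1 hw.2
    exact inner_self_eq_zero.1 ((Submodule.mem_orthogonal _ _).1 hw.1.2 w h1)
  · rintro rfl
    exact ⟨Submodule.zero_mem _, zero_mem_tangent hx.1⟩

theorem relCore_singleton (x : E) : relCore ({x} : Set E) = {x} := by
  refine (relCore_subset _).antisymm ?_
  rintro _ rfl
  refine ⟨rfl, ?_⟩
  rintro _ rfl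
  exact ⟨1, one_pos, by simp⟩

theorem relCore_submodule (V : Submodule ℝ E) : relCore (V : Set E) = V :=
  (relCore_subset _).antisymm fun _ hx => ⟨hx, fun _ hy =>
    ⟨1, one_pos, V.add_mem hx (V.smul_mem _ (V.sub_mem hx hy))⟩⟩

theorem vectorSpan_submodule (V : Submodule ℝ E) : vectorSpan ℝ (V : Set E) = V := by
  refine le_antisymm (vectorSpan_le_of_subset subset_rfl) fun x hx => ?_
  have h := sub_mem_vectorSpan (show x ∈ (V : Set E) from hx) V.zero_mem
  rwa [sub_zero] at h

theorem perpIn_singleton (V : Submodule ℝ E) (x : E) : perpIn V {x} = V := by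
  rw [perpIn, vectorSpan_singleton, Submodule.bot_orthogonal_eq_top, inf_top_eq]

theorem perpIn_self (V : Submodule ℝ E) : perpIn V (V : Set E) = ⊥ := by
  rw [perpIn, vectorSpan_submodule, Submodule.inf_orthogonal_eq_bot]

theorem starVal_singleton (h𝒞 : IsCellKind 𝒞) (hg : IsValFam 𝒞 g)
    (hFg : ∀ W : Submodule ℝ E, FiniteDimensional ℝ W → F.toFun W (W : Set E) = g W {0})
    (V : Submodule ℝ E) [FiniteDimensional ℝ V] {x : E} (hx : 𝒞 {x}) :
    starVal 𝒞 F.toFun g V {x} = F.toFun V {0} * g ⊥ {x} := by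
  rw [starVal_of_relCore_eq h𝒞 hg hFg hx (relCore_singleton x) (by simp), perpIn_singleton,
    vectorSpan_singleton]

theorem starVal_self (hg : IsValFam IsConvexCone g)
    (hFg : ∀ W : Submodule ℝ E, FiniteDimensional ℝ W → F.toFun W (W : Set E) = g W {0})
    (V : Submodule ℝ E) [FiniteDimensional ℝ V] :
    starVal IsConvexCone F.toFun g V V = g V V := by
  rw [starVal_of_relCore_eq isCellKind_convexCone hg hFg (isConvexCone_submodule V)
    (relCore_submodule V) (vectorSpan_submodule V).le, perpIn_self, vectorSpan_submodule,
    F.map_zero, one_mul]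

theorem starVal_congr {g' : Submodule ℝ E → Set E → k}
    (h : ∀ (V : Submodule ℝ E) (A : Set E), FiniteDimensional ℝ V → IsUnion 𝒞 A →
      vectorSpan ℝ A ≤ V → g V A = g' V A) (F : Submodule ℝ E → Set E → k) (V : Submodule ℝ E)
    (P : Set E) : starVal 𝒞 F g V P = starVal 𝒞 F g' V P := by
  rw [starVal, starVal]
  split_ifs with hP
  · obtain ⟨hK, -⟩ := hP.choose_spec.choose_spec
    refine Finset.sum_congr rfl fun σ hσ => ?_
    have hσK := (mem_below.1 hσ).1
    have hfd := (hK.poly σ hσK).finiteDimensional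
    rw [openVal, openVal, h _ _ hfd (isUnion_of_cell (hK.kind σ hσK)) le_rfl, h _ _ hfd
      ((hK.adapted_boundary hσK).isUnion hK.kind) (vectorSpan_mono ℝ Set.sdiff_subset)]
  · rfl

/-! ### Identity morphisms and the unit laws. -/

open Classical in
/-- The identity morphism of an object. -/
noncomputable def ConeMor.one (O : VectObj E k) : ConeMor E k where
  toFun V P := if IsConeIn V P ∧ P.Nonempty then O.toFun V else 0
  junk V P h := if_neg fun h' => h h'.1
  map_empty V hV := if_neg fun h => Set.not_nonempty_empty h.2
  map_union V P Q hP hQ := by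
    rcases P.eq_empty_or_nonempty with rfl | hP0
    · simp
    rcases Q.eq_empty_or_nonempty with rfl | hQ0
    · simp
    rw [if_pos ⟨hP.union hQ, hP0.mono Set.subset_union_left⟩, if_pos ⟨hP, hP0⟩, if_pos ⟨hQ, hQ0⟩,
      if_pos ⟨hP.inter hQ, 0, hP.2.1.zero_mem hP0, hQ.2.1.zero_mem hQ0⟩, add_sub_cancel_right]
  map_prod V W P Q hVW hP hQ := by
    rcases P.eq_empty_or_nonempty with rfl | hP0
    · simp
    rcases Q.eq_empty_or_nonempty with rfl | hQ0
    · simp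
    rw [if_pos ⟨hP.add hQ, hP0.add hQ0⟩, if_pos ⟨hP, hP0⟩, if_pos ⟨hQ, hQ0⟩,
      O.map_prod V W hP.1 hQ.1 hVW]
  map_zero := by rw [if_pos ⟨isConeIn_zero ⊥, Set.singleton_nonempty 0⟩, O.map_bot]

theorem ConeMor.one_apply (O : VectObj E k) {V : Submodule ℝ E} {P : Set E} (hP : IsConeIn V P)
    (hP0 : P.Nonempty) : (ConeMor.one O).toFun V P = O.toFun V := by
  classical
  exact if_pos ⟨hP, hP0⟩

theorem ConeMor.source_one (O : VectObj E k) : (ConeMor.one O).source = O :=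
  VectObj.ext_of_finiteDimensional fun V _ => ConeMor.one_apply O (isConeIn_self V) ⟨0, V.zero_mem⟩

theorem ConeMor.target_one (O : VectObj E k) : (ConeMor.one O).target = O :=
  VectObj.ext_of_finiteDimensional fun V _ =>
    ConeMor.one_apply O (isConeIn_zero V) (Set.singleton_nonempty 0)

/-- The factor of the identity at σ^⊥ is the value of `g` at a point of σ^⊥, which turns g_⟨σ⟩(int
σ) into g_V(int σ); additivity sums these values to g_V(P). -/
theorem starVal_one_left (h𝒞 : IsCellKind 𝒞) (hg : IsValFam 𝒞 g) {O : VectObj E k}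
    (hO : ∀ W : Submodule ℝ E, FiniteDimensional ℝ W → O.toFun W = g W {0})
    {V : Submodule ℝ E} [FiniteDimensional ℝ V] {P : Set E} (hP : IsUnion 𝒞 P)
    (hPV : vectorSpan ℝ P ≤ V) : starVal 𝒞 (ConeMor.one O).toFun g V P = g V P := by
  obtain ⟨K, b, hK, had⟩ := h𝒞.exists_pointed (P := fun _ : Unit => P) fun _ => hP
  have hPK := had ()
  rw [starVal_eq h𝒞 hg (fun W hW => (ConeMor.one_apply O (isConeIn_self W) ⟨0, W.zero_mem⟩).trans
    (hO W hW)) hPV hK hPK, hg.eq_sum_openVal hK.toIsComplex hK.kind hPK hPV]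
  refine Finset.sum_congr rfl fun σ hσ => ?_
  obtain ⟨hσK, hσP⟩ := mem_below.1 hσ
  have hσV := (vectorSpan_mono ℝ hσP).trans hPV
  have hfd := (hK.poly σ hσK).finiteDimensional
  have hfd2 := finiteDimensional_perpIn V σ
  have hb := hK.base σ hσK
  have h1 := hg.openVal_sup h𝒞 hK.toIsComplex hK.kind hσK le_rfl (perpIn_isOrtho V σ).symm
  rw [perpIn, Submodule.sup_inf_orthogonal hσV] at h1
  rw [ConeMor.one_apply O (hPK.isConeIn_normalCone hK.toIsComplex hσK hb V)
    ⟨0, Submodule.zero_mem _, zero_mem_tangent (hσP hb.1)⟩, hO _ hfd2, h1, mul_comm]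
  rfl

theorem IsCone.smul_mem {P : Set E} (hP : IsCone P) {c : ℝ} (hc : 0 ≤ c) {x : E} (hx : x ∈ P) :
    c • x ∈ P := by
  obtain ⟨T, hT, rfl⟩ := hP
  obtain ⟨C, hC, hx⟩ := hx
  exact ⟨C, hC, (hT C hC).smul_mem hc hx⟩

theorem IsCone.tangent_zero {P : Set E} (hP : IsCone P) : tangent P 0 = P := by
  ext w
  rw [mem_tangent]
  constructor
  · intro h
    obtain ⟨t, h1, ht⟩ := (h.and self_mem_nhdsWithin).exists
    have ht : 0 < t := ht
    have := hP.smul_mem (inv_nonneg.2 ht.le) h1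
    rwa [zero_add, smul_smul, inv_mul_cancel₀ ht.ne', one_smul] at this
  · intro h
    filter_upwards [self_mem_nhdsWithin] with t ht
    rw [zero_add]
    exact hP.smul_mem (le_of_lt ht) h

/-- Only the cell with 0 in its interior contributes: for any other cell, both the cell and its
boundary contain 0, and the two values of the identity cancel. At the remaining cell σ the cone `P`
is the product of ν(σ,P) and ⟨σ⟩. -/
theorem starVal_one_right {O : VectObj E k} (hO : F.source = O) {V : Submodule ℝ E} {P : Set E}
    (hP : IsConeIn V P) :
    starVal IsConvexCone F.toFun (ConeMor.one O).toFun V P = F.toFun V P := by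
  subst hO
  have hfdV := hP.1
  have hg := (ConeMor.one F.source).isValFam
  have hFg : ∀ W : Submodule ℝ E, FiniteDimensional ℝ W →
      F.toFun W (W : Set E) = (ConeMor.one F.source).toFun W {0} := fun W hW =>
    (ConeMor.one_apply F.source (isConeIn_zero W) (Set.singleton_nonempty 0)).symm
  rcases P.eq_empty_or_nonempty with rfl | hP0
  · rw [starVal_empty isCellKind_convexCone hg hFg, F.map_empty V hP.1]
  obtain ⟨K, b, hK, had⟩ := isCellKind_convexCone.exists_pointed (P := fun _ : Unit => P)
    fun _ => hP.isUnion
  have hPK := had ()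
  have h0P := hP.2.1.zero_mem hP0
  obtain ⟨σ, hσ, h0⟩ := hPK.exists_mem_relCore 0 h0P
  have hσP := hPK.subset σ hσ 0 h0 h0P
  have hspan : ∀ ρ ∈ K, ρ ⊆ vectorSpan ℝ ρ := fun ρ hρ =>
    (hK.kind ρ hρ).isCone.vectorSpan_le_iff.1 le_rfl
  have hbd : ∀ ρ ∈ K, IsConeIn (vectorSpan ℝ ρ) (ρ \ relCore ρ) := fun ρ hρ =>
    ⟨(hK.poly ρ hρ).finiteDimensional, (hK.adapted_boundary hρ).isUnion hK.kind,
      Set.sdiff_subset.trans (hspan ρ hρ)⟩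
  have hin : ∀ ρ ∈ K, IsConeIn (vectorSpan ℝ ρ) ρ := fun ρ hρ =>
    ⟨(hK.poly ρ hρ).finiteDimensional, (hK.kind ρ hρ).isCone, hspan ρ hρ⟩
  have hfd := (hK.poly σ hσ).finiteDimensional
  rw [starVal_eq isCellKind_convexCone hg hFg hP.vectorSpan_le hK hPK, starOn,
    Finset.sum_eq_single σ]
  -- The boundary of σ is a cone, so if nonempty it would contain 0, which is interior.
  · have hemp : σ \ relCore σ = ∅ := by
      by_contra hne
      exact ((hbd σ hσ).2.1.zero_mem (Set.nonempty_iff_ne_empty.2 hne)).2 h0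
    -- For ρ = {0} the normal cone at 0 is `P` itself.
    have h1 := hPK.map_normalCone (F := F) hK.toIsComplex hσ
      ((vectorSpan_mono ℝ hσP).trans hP.vectorSpan_le) (ρ := {0}) (by simp) h0
    rw [perpIn_singleton, perpIn_singleton, normalCone_eq, perpIn_singleton, hP.2.1.tangent_zero,
      Set.inter_eq_right.2 hP.2.2] at h1
    rw [h1, openVal, hemp, ConeMor.map_empty _ _ hfd, sub_zero, ConeMor.one_apply _ (hin σ hσ)
      ⟨0, h0.1⟩, hPK.normalCone_eq hK.toIsComplex hσ (hK.base σ hσ) h0]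
    rfl
  · intro ρ hρ hne
    have hρK := (mem_below.1 hρ).1
    have h0ρ := (hK.kind ρ hρK).zero_mem
    rw [openVal, ConeMor.one_apply _ (hin ρ hρK) ⟨0, h0ρ⟩, ConeMor.one_apply _ (hbd ρ hρK)
      ⟨0, h0ρ, fun h => hne (hK.eq_of_mem hρK hσ h h0)⟩, sub_self, mul_zero]
  · exact fun h => absurd (mem_below.2 ⟨hσ, hσP⟩) h

end Special

/-! ### The star product of morphisms and of polytope invariants -/

section StarProduct

variable {E : Type u} [NormedAddCommGroup E] [InnerProductSpace ℝ E] {k : Type v} [CommRing k]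

theorem ConeMor.apply_self_eq {F G : ConeMor E k} (h : F.source = G.target) (W : Submodule ℝ E) :
    F.toFun W (W : Set E) = G.toFun W {0} :=
  congrFun (congrArg VectObj.toFun h) W

theorem ConeMor.apply_self_eq_val {F : ConeMor E k} {G : PolyInv E k} (h : F.source = G.location)
    (W : Submodule ℝ E) [FiniteDimensional ℝ W] : F.toFun W (W : Set E) = G.val W {0} :=
  (congrFun (congrArg VectObj.toFun h) W).trans (G.val_singleton W 0).symm

/-- The star product of two morphisms. -/
noncomputable def ConeMor.star (F G : ConeMor E k) (h : F.source = G.target) : ConeMor E k :=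
  ConeMor.ofValFam (starVal IsConvexCone F.toFun G.toFun)
    (isValFam_starVal isCellKind_convexCone G.isValFam fun W _ => ConeMor.apply_self_eq h W)
    (by rw [starVal_singleton isCellKind_convexCone G.isValFam
      (fun W _ => ConeMor.apply_self_eq h W) ⊥ isConvexCone_zero, F.map_zero, G.map_zero, one_mul])

theorem ConeMor.star_apply {F G : ConeMor E k} (h : F.source = G.target) {V : Submodule ℝ E}
    {P : Set E} (hP : IsConeIn V P) :
    (F.star G h).toFun V P = starVal IsConvexCone F.toFun G.toFun V P :=
  ConeMor.ofValFam_apply _ _ hP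

theorem ConeMor.source_star {F G : ConeMor E k} (h : F.source = G.target) :
    (F.star G h).source = G.source :=
  VectObj.ext_of_finiteDimensional fun V _ => (ConeMor.star_apply h (isConeIn_self V)).trans
    (starVal_self G.isValFam (fun W _ => ConeMor.apply_self_eq h W) V)

theorem ConeMor.target_star {F G : ConeMor E k} (h : F.source = G.target) :
    (F.star G h).target = F.target :=
  VectObj.ext_of_finiteDimensional fun V _ => (ConeMor.star_apply h (isConeIn_zero V)).trans <| by
    rw [starVal_singleton isCellKind_convexCone G.isValFam
      (fun W _ => ConeMor.apply_self_eq h W) V isConvexCone_zero, G.map_zero, mul_one]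
    rfl

/-- The star product of a morphism and a polytope invariant. -/
noncomputable def ConeMor.act (F : ConeMor E k) (G : PolyInv E k) (h : F.source = G.location) :
    PolyInv E k :=
  PolyInv.ofValFam (starVal IsConvexPolytope F.toFun G.val)
    (isValFam_starVal isCellKind_convexPolytope G.isValFam fun W _ => ConeMor.apply_self_eq_val h W)
    (fun x => by rw [starVal_singleton isCellKind_convexPolytope G.isValFam
      (fun W _ => ConeMor.apply_self_eq_val h W) ⊥ (isConvexPolytope_singleton x), F.map_zero,
      G.val_singleton, G.map_zero, one_mul])

theorem ConeMor.act_apply {F : ConeMor E k} {G : PolyInv E k} (h : F.source = G.location)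
    {V : Submodule ℝ E} {P : Set E} (hP : IsPolytopeIn V P) :
    (F.act G h).toFun V P = starVal IsConvexPolytope F.toFun G.val V P :=
  PolyInv.ofValFam_apply _ _ hP

theorem ConeMor.location_act {F : ConeMor E k} {G : PolyInv E k} (h : F.source = G.location) :
    (F.act G h).location = F.target :=
  VectObj.ext_of_finiteDimensional fun V _ =>
    (ConeMor.act_apply h (isPolytopeIn_zero V)).trans <| by
      rw [starVal_singleton isCellKind_convexPolytope G.isValFam
        (fun W _ => ConeMor.apply_self_eq_val h W) V (isConvexPolytope_singleton 0),
        G.val_singleton, G.map_zero, mul_one]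
      rfl

/-- The star value is translation invariant, by multiplicativity with a point, so it agrees with the
extension of the new invariant to translates of `V`. -/
theorem ConeMor.val_act {F : ConeMor E k} {G : PolyInv E k} (h : F.source = G.location)
    {V : Submodule ℝ E} [FiniteDimensional ℝ V] {A : Set E} (hA : IsUnion IsConvexPolytope A)
    (hAV : vectorSpan ℝ A ≤ V) :
    (F.act G h).val V A = starVal IsConvexPolytope F.toFun G.val V A := by
  have hs := isValFam_starVal isCellKind_convexPolytope G.isValFam
    fun W _ => ConeMor.apply_self_eq_val h W
  rcases A.eq_empty_or_nonempty with rfl | ⟨y, hy⟩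
  · rw [hs.map_empty V inferInstance]
    simp [PolyInv.val]
  have hy' := isPolytopeIn_neg_vadd hA fun x hx => hAV (sub_mem_vectorSpan hx hy)
  rw [PolyInv.val_eq _ hy', ConeMor.act_apply h hy']
  have h1 := hs.map_prod ⊥ V {-y} A Submodule.isOrtho_bot_left inferInstance inferInstance
    (isUnion_of_cell (isConvexPolytope_singleton _)) hA (by simp) hAV
  rw [bot_sup_eq, Set.singleton_add, starVal_singleton isCellKind_convexPolytope G.isValFam
    (fun W _ => ConeMor.apply_self_eq_val h W) ⊥ (isConvexPolytope_singleton _), F.map_zero,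
    G.val_singleton, G.map_zero, one_mul, one_mul] at h1
  exact h1

theorem ConeMor.one_star {G : ConeMor E k} {O : VectObj E k} (h : (ConeMor.one O).source = G.target) :
    (ConeMor.one O).star G h = G := by
  refine ConeMor.ext_of_isConeIn fun V P hP => ?_
  have := hP.1
  rw [ConeMor.star_apply h hP, starVal_one_left isCellKind_convexCone G.isValFam (fun W _ => ?_)
    hP.isUnion hP.vectorSpan_le]
  rw [ConeMor.source_one] at h
  rw [h]
  rfl

theorem ConeMor.star_one {F : ConeMor E k} {O : VectObj E k} (h : F.source = (ConeMor.one O).target) :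
    F.star (ConeMor.one O) h = F := by
  refine ConeMor.ext_of_isConeIn fun V P hP => ?_
  rw [ConeMor.star_apply h hP, starVal_one_right (h.trans (ConeMor.target_one O)) hP]

theorem ConeMor.one_act {G : PolyInv E k} {O : VectObj E k}
    (h : (ConeMor.one O).source = G.location) : (ConeMor.one O).act G h = G := by
  refine PolyInv.ext_of_isPolytopeIn fun V P hP => ?_
  have := hP.1
  rw [ConeMor.act_apply h hP, starVal_one_left isCellKind_convexPolytope G.isValFam (fun W hW => ?_)
    hP.isUnion hP.vectorSpan_le, G.val_eq_toFun hP]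
  rw [ConeMor.source_one] at h
  rw [h, G.val_singleton]
  rfl

theorem ConeMor.star_assoc {F G H : ConeMor E k} (hFG : F.source = G.target)
    (hGH : G.source = H.target) :
    (F.star G hFG).star H ((ConeMor.source_star hFG).trans hGH) =
      F.star (G.star H hGH) (hFG.trans (ConeMor.target_star hGH).symm) := by
  refine ConeMor.ext_of_isConeIn fun V P hP => ?_
  have := hP.1
  rw [ConeMor.star_apply _ hP, ConeMor.star_apply _ hP, starVal_assoc isCellKind_convexCone
    H.isValFam (fun V P hP => ConeMor.star_apply hFG hP)
    (fun W _ => ConeMor.apply_self_eq hFG W) (fun W _ => ConeMor.apply_self_eq hGH W)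
    (fun W _ => ConeMor.apply_self_eq ((ConeMor.source_star hFG).trans hGH) W)
    (fun W _ => ?_) hP.isUnion hP.vectorSpan_le]
  · refine starVal_congr (fun W A hW hA hAW => ?_) _ _ _
    exact (ConeMor.star_apply hGH ⟨hW, hA, IsCone.vectorSpan_le_iff hA |>.1 hAW⟩).symm
  · rw [ConeMor.apply_self_eq (hFG.trans (ConeMor.target_star hGH).symm) W,
      ConeMor.star_apply hGH (isConeIn_zero W)]

theorem ConeMor.star_act {F G : ConeMor E k} {H : PolyInv E k} (hFG : F.source = G.target)
    (hGH : G.source = H.location) :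
    (F.star G hFG).act H ((ConeMor.source_star hFG).trans hGH) =
      F.act (G.act H hGH) (hFG.trans (ConeMor.location_act hGH).symm) := by
  refine PolyInv.ext_of_isPolytopeIn fun V P hP => ?_
  have := hP.1
  rw [ConeMor.act_apply _ hP, ConeMor.act_apply _ hP, starVal_assoc isCellKind_convexPolytope
    H.isValFam (fun V P hP => ConeMor.star_apply hFG hP)
    (fun W _ => ConeMor.apply_self_eq hFG W) (fun W _ => ConeMor.apply_self_eq_val hGH W)
    (fun W _ => ConeMor.apply_self_eq_val ((ConeMor.source_star hFG).trans hGH) W)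
    (fun W _ => ?_) hP.isUnion hP.vectorSpan_le]
  · exact starVal_congr
      (fun W A hW hA hAW => (ConeMor.val_act hGH hA hAW).symm) _ _ _
  · rw [ConeMor.apply_self_eq_val (hFG.trans (ConeMor.location_act hGH).symm) W,
      ConeMor.val_act hGH (isUnion_of_cell (isConvexPolytope_singleton 0)) (by simp)]

/-! ### Comparison with the star sums over cell structures. -/

theorem IsCellStructure.adapted {𝒞 : Set E → Prop} {K : Finset (Set E)} {P : Set E}
    (h : IsCellStructure 𝒞 K P) (h𝒞 : ∀ σ, 𝒞 σ → IsPolyhedron σ) : Adapted K P :=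
  h.union ▸ (h.isComplex h𝒞).adapted_sUnion

theorem IsCellStructure.isPointedComplex {𝒞 : Set E → Prop} {K : Finset (Set E)} {P : Set E}
    (h : IsCellStructure 𝒞 K P) (h𝒞 : ∀ σ, 𝒞 σ → IsPolyhedron σ) {b : Set E → E}
    (hb : IsBasePoint K b) : IsPointedComplex 𝒞 K b :=
  ⟨h.isComplex h𝒞, h.cell, fun σ hσ => (h𝒞 σ (h.cell σ hσ)).intrinsicInterior_eq ▸ hb σ hσ⟩

theorem IsCellStructure.below_eq {𝒞 : Set E → Prop} {K : Finset (Set E)} {P : Set E}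
    (h : IsCellStructure 𝒞 K P) : below K P = K :=
  (below_subset K P).antisymm fun _ hσ => mem_below.2 ⟨hσ, h.union ▸ Set.subset_sUnion_of_mem hσ⟩

theorem IsCellKind.exists_isCellStructure {𝒞 : Set E → Prop} (h𝒞 : IsCellKind 𝒞) {P : Set E}
    (hP : IsUnion 𝒞 P) : ∃ K b, IsCellStructure 𝒞 K P ∧ IsBasePoint K b := by
  obtain ⟨K, b, hK, had⟩ := h𝒞.exists_pointed (P := fun _ : Unit => P) fun _ => hP
  refine ⟨below K P, b, ?_, fun σ hσ => ?_⟩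
  · have := (hK.below P).isCellStructure fun σ hσ => hK.kind σ (mem_below.1 hσ).1
    rwa [(had ()).sUnion_below] at this
  · have hσK := (mem_below.1 hσ).1
    rw [(hK.poly σ hσK).intrinsicInterior_eq]
    exact hK.base σ hσK

theorem ConeMor.isConeStar_star {F G : ConeMor E k} (h : F.source = G.target) :
    IsConeStar F G (F.star G h) := by
  intro V P hP K b hK hb
  have := hP.1
  have hp : ∀ σ, IsConvexCone σ → IsPolyhedron (σ : Set E) := fun _ => IsConvexCone.isPolyhedron
  rw [ConeMor.star_apply h hP, starVal_eq isCellKind_convexCone G.isValFam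
    (fun W _ => ConeMor.apply_self_eq h W) hP.vectorSpan_le (hK.isPointedComplex hp hb)
    (hK.adapted hp), starOn, hK.below_eq]
  refine Finset.sum_congr rfl fun σ hσ => ?_
  rw [openVal, (hp σ (hK.cell σ hσ)).intrinsicInterior_eq]

theorem ConeMor.isPolyStar_act {F : ConeMor E k} {G : PolyInv E k} (h : F.source = G.location) :
    IsPolyStar F G (F.act G h) := by
  intro V P hP K b hK hb
  have := hP.1
  have hp : ∀ σ, IsConvexPolytope σ → IsPolyhedron (σ : Set E) :=
    fun _ => IsConvexPolytope.isPolyhedron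
  have hpc := hK.isPointedComplex hp hb
  rw [ConeMor.act_apply h hP, starVal_eq isCellKind_convexPolytope G.isValFam
    (fun W _ => ConeMor.apply_self_eq_val h W) hP.vectorSpan_le hpc
    (hK.adapted hp), starOn, hK.below_eq]
  refine Finset.sum_congr rfl fun σ hσ => ?_
  have hfd := (hpc.poly σ hσ).finiteDimensional
  have hm : ∀ x ∈ σ, x - b σ ∈ vectorSpan ℝ σ := fun x hx =>
    sub_mem_vectorSpan hx (hpc.base σ hσ).1
  rw [openVal, (hp σ (hK.cell σ hσ)).intrinsicInterior_eq,
    G.val_eq (isPolytopeIn_neg_vadd (isUnion_of_cell (hK.cell σ hσ)) hm),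
    G.val_eq (isPolytopeIn_neg_vadd ((hpc.adapted_boundary hσ).isUnion hpc.kind)
      fun x hx => hm x hx.1)]

end StarProduct

/-! ### Extension of valuations of convex sets -/

section Extension

set_option linter.unusedSectionVars false

variable {E : Type u} [NormedAddCommGroup E] [InnerProductSpace ℝ E] {k : Type v} [CommRing k]

/-- A class of closed convex sets that is stable under cutting by linear half spaces. -/
structure IsCutStable (𝒟 : Set E → Prop) : Prop where
  empty : 𝒟 ∅
  convex : ∀ C, 𝒟 C → Convex ℝ C
  isClosed : ∀ C, 𝒟 C → IsClosed C
  inter_nonneg : ∀ C, 𝒟 C → ∀ a : StrongDual ℝ E, 𝒟 (C ∩ {x | 0 ≤ a x})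

theorem IsCutStable.inter_nonpos {𝒟 : Set E → Prop} (h𝒟 : IsCutStable 𝒟) {C : Set E} (hC : 𝒟 C)
    (a : StrongDual ℝ E) : 𝒟 (C ∩ {x | a x ≤ 0}) := by
  simpa using h𝒟.inter_nonneg C hC (-a)

theorem IsCutStable.inter_zero {𝒟 : Set E → Prop} (h𝒟 : IsCutStable 𝒟) {C : Set E} (hC : 𝒟 C)
    (a : StrongDual ℝ E) : 𝒟 (C ∩ {x | a x = 0}) := by
  have := h𝒟.inter_nonpos (h𝒟.inter_nonneg C hC a) a
  convert this using 1
  rw [Set.inter_assoc]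
  congr 1
  ext x
  exact ⟨fun h => ⟨h.ge, h.le⟩, fun h => le_antisymm h.2 h.1⟩

/-- A function on `𝒟` that is additive under cuts and that depends only on the part of its argument
in `U`. -/
structure IsCutAdditive (𝒟 : Set E → Prop) (U : Set E) (f : Set E → k) : Prop where
  map_empty : f ∅ = 0
  map_cut : ∀ C, 𝒟 C → ∀ a : StrongDual ℝ E,
    f C = f (C ∩ {x | 0 ≤ a x}) + f (C ∩ {x | a x ≤ 0}) - f (C ∩ {x | a x = 0})
  congr : ∀ C C', 𝒟 C → 𝒟 C' → C ∩ U = C' ∩ U → f C = f C'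

variable {𝒟 : Set E → Prop} {U : Set E} {f : Set E → k}

theorem IsCutAdditive.inter_zero (h𝒟 : IsCutStable 𝒟) (hf : IsCutAdditive 𝒟 U f)
    (a : StrongDual ℝ E) :
    IsCutAdditive 𝒟 (U ∩ {x | a x = 0}) fun C => f (C ∩ {x | a x = 0}) where
  map_empty := by simpa using hf.map_empty
  map_cut C hC b := by
    simp only [Set.inter_right_comm _ _ {x | a x = 0}]
    exact hf.map_cut _ (h𝒟.inter_zero hC a) b
  congr C C' hC hC' h := by
    refine hf.congr _ _ (h𝒟.inter_zero hC a) (h𝒟.inter_zero hC' a) ?_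
    rwa [Set.inter_assoc, Set.inter_assoc, Set.inter_comm _ U]

/-- The difference plays the role of the value at the open half a > 0. -/
theorem IsCutAdditive.inter_pos (h𝒟 : IsCutStable 𝒟) (hU : Convex ℝ U)
    (hf : IsCutAdditive 𝒟 U f) (a : StrongDual ℝ E) :
    IsCutAdditive 𝒟 (U ∩ {x | 0 < a x})
      fun C => f (C ∩ {x | 0 ≤ a x}) - f (C ∩ {x | a x = 0}) where
  map_empty := by simp [hf.map_empty]
  map_cut C hC b := by
    simp only [Set.inter_right_comm _ _ {x | a x = 0}, Set.inter_right_comm _ _ {x | 0 ≤ a x}]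
    rw [hf.map_cut _ (h𝒟.inter_zero hC a) b, hf.map_cut _ (h𝒟.inter_nonneg C hC a) b]
    ring
  congr C C' hC hC' h := by
    -- If the sets agree where a > 0 and contain a point p there, they agree on a ≥ 0 within U: a
    -- point y of either set is the limit of points of the segment from y to p, at which a > 0.
    have hsub : ∀ C C', 𝒟 C → 𝒟 C' → C ∩ (U ∩ {x | 0 < a x}) = C' ∩ (U ∩ {x | 0 < a x}) →
        (C ∩ (U ∩ {x | 0 < a x})).Nonempty → C' ∩ {x | 0 ≤ a x} ∩ U ⊆ C := by
      rintro C C' hC hC' h ⟨p, hp⟩ y ⟨⟨hy, hya⟩, hyU⟩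
      have hp' := h ▸ hp
      have h1 : Tendsto (fun t : ℝ => y + t • (p - y)) (𝓝[>] 0) (𝓝 y) := by
        have : Continuous fun t : ℝ => y + t • (p - y) := by fun_prop
        exact (this.tendsto' 0 y (by simp)).mono_left nhdsWithin_le_nhds
      refine (h𝒟.isClosed C hC).mem_of_tendsto h1 ?_
      filter_upwards [Ioc_mem_nhdsGT (zero_lt_one' ℝ)] with t ht
      have h2 : y + t • (p - y) ∈ C' ∩ (U ∩ {x | 0 < a x}) := by
        refine ⟨(h𝒟.convex C' hC').add_smul_sub_mem hy hp'.1 ⟨ht.1.le, ht.2⟩,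
          hU.add_smul_sub_mem hyU hp.2.1 ⟨ht.1.le, ht.2⟩, ?_⟩
        have h3 : 0 < a p := hp.2.2
        have h4 : 0 ≤ a y := hya
        have h5 : a (y + t • (p - y)) = (1 - t) * a y + t * a p := by
          rw [map_add, map_smul, map_sub, smul_eq_mul]; ring
        rw [Set.mem_ofPred_eq, h5]
        exact add_pos_of_nonneg_of_pos (mul_nonneg (sub_nonneg.2 ht.2) h4) (mul_pos ht.1 h3)
      rw [← h] at h2
      exact h2.1
    rcases (C ∩ (U ∩ {x | 0 < a x})).eq_empty_or_nonempty with h0 | hne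
    -- If there is no such point, the parts a ≥ 0 and a = 0 agree on U and the difference is 0.
    · have hz : ∀ C, 𝒟 C → C ∩ (U ∩ {x | 0 < a x}) = ∅ →
          f (C ∩ {x | 0 ≤ a x}) - f (C ∩ {x | a x = 0}) = 0 := by
        intro C hC h0
        rw [sub_eq_zero]
        refine hf.congr _ _ (h𝒟.inter_nonneg C hC a) (h𝒟.inter_zero hC a) ?_
        ext x
        refine ⟨fun ⟨⟨h1, h2⟩, h3⟩ => ⟨⟨h1, ?_⟩, h3⟩, fun ⟨⟨h1, h2⟩, h3⟩ => ⟨⟨h1, h2.ge⟩, h3⟩⟩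
        by_contra h4
        have : x ∈ C ∩ (U ∩ {x | 0 < a x}) := ⟨h1, h3, lt_of_le_of_ne h2 (Ne.symm h4)⟩
        rw [h0] at this
        exact this
      rw [hz C hC h0, hz C' hC' (h ▸ h0)]
    · have h1 := hsub C C' hC hC' h hne
      have h2 := hsub C' C hC' hC h.symm (h ▸ hne)
      congr 1
      · refine hf.congr _ _ (h𝒟.inter_nonneg C hC a) (h𝒟.inter_nonneg C' hC' a) ?_
        exact Set.Subset.antisymm (fun x hx => ⟨⟨h2 hx, hx.1.2⟩, hx.2⟩)
          fun x hx => ⟨⟨h1 hx, hx.1.2⟩, hx.2⟩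
      · refine hf.congr _ _ (h𝒟.inter_zero hC a) (h𝒟.inter_zero hC' a) ?_
        exact Set.Subset.antisymm
          (fun x hx => ⟨⟨h2 ⟨⟨hx.1.1, hx.1.2.ge⟩, hx.2⟩, hx.1.2⟩, hx.2⟩)
          fun x hx => ⟨⟨h1 ⟨⟨hx.1.1, hx.1.2.ge⟩, hx.2⟩, hx.1.2⟩, hx.2⟩

/-- Each form in `l` splits `f` into its parts on a > 0, a = 0 and a < 0, which are again cut
additive. Once `l` is exhausted, each C i contains U or misses it, and the claim is the given
relation at one point of U. -/
theorem IsCutAdditive.sum_eq_zero {ι : Type*} (h𝒟 : IsCutStable 𝒟) {s : Finset ι} {c : ι → k}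
    {C : ι → Set E} (hC : ∀ i ∈ s, 𝒟 (C i)) (l : List (StrongDual ℝ E)) {U : Set E}
    {f : Set E → k} (hU : Convex ℝ U) (hf : IsCutAdditive 𝒟 U f)
    (hl : ∀ i ∈ s, ∀ x ∈ U, ∀ y ∈ U, (∀ a ∈ l, SignType.sign (a x) = SignType.sign (a y)) →
      x ∈ C i → y ∈ C i)
    (hsum : ∀ x ∈ U, ∑ i ∈ s, c i * (C i).indicator 1 x = 0) : ∑ i ∈ s, c i * f (C i) = 0 := by
  classical
  induction l generalizing U f with
  | nil =>
    rcases U.eq_empty_or_nonempty with rfl | ⟨x, hx⟩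
    · refine Finset.sum_eq_zero fun i hi => ?_
      rw [hf.congr (C i) ∅ (hC i hi) h𝒟.empty (by simp), hf.map_empty, mul_zero]
    -- All C i that contain x have the same trace U on U, hence one common value `v`; the others
    -- have the value of the empty set.
    · obtain ⟨v, hv⟩ : ∃ v, ∀ i ∈ s, f (C i) = (C i).indicator 1 x * v := by
        have h0 : ∀ i ∈ s, x ∉ C i → f (C i) = 0 := by
          intro i hi hxi
          rw [← hf.map_empty]
          refine hf.congr _ _ (hC i hi) h𝒟.empty ?_
          rw [Set.empty_inter, Set.eq_empty_iff_forall_notMem]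
          exact fun y hy => hxi (hl i hi y hy.2 x hx (by simp) hy.1)
        by_cases h : ∃ j ∈ s, x ∈ C j
        · obtain ⟨j, hj, hxj⟩ := h
          refine ⟨f (C j), fun i hi => ?_⟩
          by_cases hxi : x ∈ C i
          · rw [Set.indicator_of_mem hxi, Pi.one_apply, one_mul]
            have hall : ∀ i ∈ s, x ∈ C i → C i ∩ U = U := fun i hi hxi =>
              Set.inter_eq_right.2 fun y hy => hl i hi x hx y hy (by simp) hxi
            exact hf.congr _ _ (hC i hi) (hC j hj) ((hall i hi hxi).trans (hall j hj hxj).symm)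
          · rw [Set.indicator_of_notMem hxi, zero_mul, h0 i hi hxi]
        · push Not at h
          exact ⟨0, fun i hi => by rw [h0 i hi (h i hi), mul_zero]⟩
      rw [Finset.sum_congr rfl fun i hi => by rw [hv i hi, ← mul_assoc], ← Finset.sum_mul,
        hsum x hx, zero_mul]
  | cons a l ih =>
    have hpos : ∀ b : StrongDual ℝ E, (b = a ∨ b = -a) →
        ∑ i ∈ s, c i * (f (C i ∩ {x | 0 ≤ b x}) - f (C i ∩ {x | b x = 0})) = 0 := by
      intro b hb
      refine ih (hU.inter (convex_halfSpace_gt b.isLinear 0)) (hf.inter_pos h𝒟 hU b) ?_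
        fun x hx => hsum x hx.1
      intro i hi x hx y hy hxy
      refine hl i hi x hx.1 y hy.1 fun a' ha' => ?_
      rcases List.mem_cons.1 ha' with rfl | ha'
      · have h1 : 0 < b x := hx.2
        have h2 : 0 < b y := hy.2
        rcases hb with rfl | rfl
        · rw [sign_pos h1, sign_pos h2]
        · rw [neg_apply, neg_pos] at h1 h2
          rw [sign_neg h1, sign_neg h2]
      · exact hxy a' ha'
    have hzero : ∑ i ∈ s, c i * f (C i ∩ {x | a x = 0}) = 0 := by
      refine ih (hU.inter (convex_hyperplane a.isLinear 0)) (hf.inter_zero h𝒟 a) ?_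
        fun x hx => hsum x hx.1
      intro i hi x hx y hy hxy
      refine hl i hi x hx.1 y hy.1 fun a' ha' => ?_
      rcases List.mem_cons.1 ha' with rfl | ha'
      · have h1 : a' x = 0 := hx.2
        have h2 : a' y = 0 := hy.2
        rw [h1, h2]
      · exact hxy a' ha'
    have h1 := hpos a (Or.inl rfl)
    have h2 := hpos (-a) (Or.inr rfl)
    have h3 : ∀ i ∈ s, c i * f (C i) =
        c i * (f (C i ∩ {x | 0 ≤ a x}) - f (C i ∩ {x | a x = 0})) +
        c i * f (C i ∩ {x | a x = 0}) +
        c i * (f (C i ∩ {x | 0 ≤ (-a) x}) - f (C i ∩ {x | (-a) x = 0})) := by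
      intro i hi
      have h4 : {x : E | 0 ≤ (-a) x} = {x | a x ≤ 0} := by ext; simp
      have h5 : {x : E | (-a) x = 0} = {x | a x = 0} := by ext; simp
      rw [h4, h5, hf.map_cut (C i) (hC i hi) a]
      ring
    rw [Finset.sum_congr rfl h3, Finset.sum_add_distrib, Finset.sum_add_distrib, h1, h2, hzero]
    simp

/-- The relation between indicator functions and values generated by `f`. -/
def extensionGraph (𝒟 : Set E → Prop) (f : Set E → k) : Submodule k ((E → k) × k) :=
  Submodule.span k ((fun C : Set E => (C.indicator 1, f C)) '' {C | 𝒟 C})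

theorem mem_extensionGraph {C : Set E} (hC : 𝒟 C) : (C.indicator 1, f C) ∈ extensionGraph 𝒟 f :=
  Submodule.subset_span ⟨C, hC, rfl⟩

theorem extensionGraph_union {P Q : Set E} {p q r : k}
    (hP : (P.indicator 1, p) ∈ extensionGraph 𝒟 f) (hQ : (Q.indicator 1, q) ∈ extensionGraph 𝒟 f)
    (hPQ : ((P ∩ Q).indicator 1, r) ∈ extensionGraph 𝒟 f) :
    ((P ∪ Q).indicator 1, p + q - r) ∈ extensionGraph 𝒟 f := by
  have := Submodule.sub_mem _ (Submodule.add_mem _ hP hQ) hPQ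
  convert this using 1
  refine Prod.ext ?_ rfl
  have h := Set.indicator_union_add_inter (1 : E → k) P Q
  exact eq_sub_of_add_eq h

theorem exists_mem_extensionGraph (h0 : 𝒟 ∅) (hinter : ∀ A B, 𝒟 A → 𝒟 B → 𝒟 (A ∩ B))
    {P : Set E} (hP : IsUnion 𝒟 P) : ∃ v, (P.indicator 1, v) ∈ extensionGraph 𝒟 f := by
  classical
  obtain ⟨T, hT, rfl⟩ := hP
  generalize hn : T.card = n
  induction n using Nat.strong_induction_on generalizing T with
  | _ n ih =>
    rcases T.eq_empty_or_nonempty with rfl | ⟨C, hC⟩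
    · exact ⟨_, by simpa using mem_extensionGraph (f := f) h0⟩
    have hlt : (T.erase C).card < n := hn ▸ Finset.card_erase_lt_of_mem hC
    obtain ⟨q, hq⟩ := ih _ hlt (T.erase C) (fun D hD => hT D (Finset.mem_of_mem_erase hD)) rfl
    obtain ⟨r, hr⟩ := ih _ (Finset.card_image_le.trans_lt hlt) ((T.erase C).image (C ∩ ·))
      (fun D hD => by
        obtain ⟨D', hD', rfl⟩ := Finset.mem_image.1 hD
        exact hinter C D' (hT C hC) (hT D' (Finset.mem_of_mem_erase hD'))) rfl
    have h1 : ⋃₀ (((T.erase C).image (C ∩ ·) : Finset (Set E)) : Set (Set E)) =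
        C ∩ ⋃₀ ((T.erase C : Finset (Set E)) : Set (Set E)) := by
      rw [Finset.coe_image, Set.sUnion_image, Set.sUnion_eq_biUnion, Set.inter_iUnion₂]
    rw [h1] at hr
    have h2 := extensionGraph_union (mem_extensionGraph (f := f) (hT C hC)) hq hr
    rw [← Set.sUnion_insert, ← Finset.coe_insert, Finset.insert_erase hC] at h2
    exact ⟨_, h2⟩

/-- The difference of the two elements is a linear relation between indicator functions, which `f`
respects; finitely many forms separate all the sets involved. -/
theorem extensionGraph_unique (h𝒟 : IsCutStable 𝒟) (hU : Convex ℝ U) (hf : IsCutAdditive 𝒟 U f)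
    (hres : ∀ C, 𝒟 C → ∃ S : Set (StrongDual ℝ E), S.Finite ∧ ∀ x ∈ U, ∀ y ∈ U,
      (∀ a ∈ S, SignType.sign (a x) = SignType.sign (a y)) → x ∈ C → y ∈ C)
    {g : E → k} {v w : k} (hv : (g, v) ∈ extensionGraph 𝒟 f) (hw : (g, w) ∈ extensionGraph 𝒟 f) :
    v = w := by
  have h := Submodule.sub_mem _ hv hw
  rw [Prod.mk_sub_mk, sub_self] at h
  rw [← sub_eq_zero]
  generalize v - w = d at h
  obtain ⟨n, c, D, hD⟩ := Submodule.mem_span_set'.1 h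
  choose C hC hCD using fun i => (D i).2
  have hC : ∀ i, 𝒟 (C i) := hC
  choose S hS hSC using fun i => hres (C i) (hC i)
  have hfin : (⋃ i, S i).Finite := Set.finite_iUnion hS
  have hz := hf.sum_eq_zero h𝒟 (s := Finset.univ) (c := c) (C := C) (fun i _ => hC i)
    hfin.toFinset.toList hU (fun i _ x hx y hy hxy => hSC i x hx y hy fun a ha =>
      hxy a (Finset.mem_toList.2 (hfin.mem_toFinset.2 (Set.mem_iUnion_of_mem i ha)))) ?_
  · have h1 := congrArg Prod.snd hD
    rw [Prod.snd_sum] at h1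
    refine h1.symm.trans (Eq.trans ?_ hz)
    exact Finset.sum_congr rfl fun i _ => by rw [← hCD i]; rfl
  · intro x _
    have h1 := congrFun (congrArg Prod.fst hD) x
    rw [Prod.fst_sum, Finset.sum_apply] at h1
    refine Eq.trans ?_ h1
    exact Finset.sum_congr rfl fun i _ => by rw [← hCD i]; rfl

end Extension

/-! ### Duality -/

section Duality

set_option linter.unusedSectionVars false

variable {E : Type u} [NormedAddCommGroup E] [InnerProductSpace ℝ E] {k : Type v} [CommRing k]

/-- The convex cones in `V`, and the empty set. -/
def IsConvexConeOrEmpty (V : Submodule ℝ E) (C : Set E) : Prop :=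
  C = ∅ ∨ IsConvexCone C ∧ C ⊆ V

theorem IsConvexConeOrEmpty.inter {V : Submodule ℝ E} {C D : Set E} (hC : IsConvexConeOrEmpty V C)
    (hD : IsConvexConeOrEmpty V D) : IsConvexConeOrEmpty V (C ∩ D) := by
  rcases hC with rfl | hC
  · exact Or.inl (Set.empty_inter D)
  rcases hD with rfl | hD
  · exact Or.inl (Set.inter_empty C)
  exact Or.inr ⟨hC.1.inter hD.1, Set.inter_subset_left.trans hC.2⟩

theorem isPolyhedronIn_halfSpace (V : Submodule ℝ E) (a : StrongDual ℝ E) :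
    IsPolyhedronIn V (V ∩ {x | 0 ≤ a x}) := by
  refine ⟨{(-a, 0)}, Set.finite_singleton _, ?_⟩
  ext x
  simp

theorem isCutStable_isConvexConeOrEmpty (V : Submodule ℝ E) [FiniteDimensional ℝ V] :
    IsCutStable (IsConvexConeOrEmpty V) where
  empty := Or.inl rfl
  convex C hC := by
    rcases hC with rfl | hC
    · exact convex_empty
    · exact hC.1.isPolyhedron.convex
  isClosed C hC := by
    rcases hC with rfl | hC
    · exact isClosed_empty
    · exact hC.1.isPolyhedron.isClosed
  inter_nonneg C hC a := by
    rcases hC with rfl | ⟨hC, hCV⟩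
    · exact Or.inl (Set.empty_inter _)
    refine Or.inr ⟨?_, Set.inter_subset_left.trans hCV⟩
    have h1 := (hC.isPolyhedronIn hCV).inter (isPolyhedronIn_halfSpace V a)
    rw [← Set.inter_assoc, Set.inter_eq_left.2 hCV] at h1
    rw [inf_idem] at h1
    refine h1.isConvexCone ⟨hC.zero_mem, by simp⟩ fun c hc x hx => ⟨hC.smul_mem hc hx.1, ?_⟩
    rw [Set.mem_ofPred_eq, map_smul]
    exact mul_nonneg hc hx.2

open Classical in
/-- The value at the dual of a convex cone. -/
noncomputable def ConeMor.convexDual (F : ConeMor E k) (V : Submodule ℝ E) (C : Set E) : k :=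
  if C = ∅ then 0 else F.toFun V (dualCone V C)

theorem ConeMor.convexDual_apply (F : ConeMor E k) (V : Submodule ℝ E) {C : Set E}
    (hC : IsConvexCone C) : F.convexDual V C = F.toFun V (dualCone V C) := by
  classical
  exact if_neg hC.nonempty.ne_empty

theorem IsConvexCone.isConeIn {V : Submodule ℝ E} [hV : FiniteDimensional ℝ V] {C : Set E}
    (hC : IsConvexCone C) (hCV : C ⊆ V) : IsConeIn V C := ⟨hV, hC.isCone, hCV⟩

theorem IsConvexCone.isConeIn_dualCone {V : Submodule ℝ E} [FiniteDimensional ℝ V] {C : Set E}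
    (hC : IsConvexCone C) (hCV : C ⊆ V) : IsConeIn V (dualCone V C) :=
  (hC.dual hCV).isConeIn (dualCone_subset V C)

/-- The duals of the two halves of C meet in the dual of C, and their union is the dual of the
common hyperplane section; the valuation property of F is then the cut formula. -/
theorem isCutAdditive_convexDual (F : ConeMor E k) (V : Submodule ℝ E) [FiniteDimensional ℝ V] :
    IsCutAdditive (IsConvexConeOrEmpty V) V (F.convexDual V) where
  map_empty := by simp [ConeMor.convexDual]
  map_cut C hC a := by
    have h𝒟 := isCutStable_isConvexConeOrEmpty V
    have hnn := h𝒟.inter_nonneg C hC a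
    have hnp := h𝒟.inter_nonpos hC a
    have hz := h𝒟.inter_zero hC a
    rcases hC with rfl | ⟨hC, hCV⟩
    · simp [ConeMor.convexDual]
    have h0 := hC.zero_mem
    have hnn := (hnn.resolve_left (Set.nonempty_iff_ne_empty.1 ⟨0, h0, by simp⟩)).1
    have hnp := (hnp.resolve_left (Set.nonempty_iff_ne_empty.1 ⟨0, h0, by simp⟩)).1
    have hz := (hz.resolve_left (Set.nonempty_iff_ne_empty.1 ⟨0, h0, by simp⟩)).1
    rw [F.convexDual_apply V hC, F.convexDual_apply V hnn, F.convexDual_apply V hnp,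
      F.convexDual_apply V hz]
    have h1 : dualCone V (C ∩ {x | 0 ≤ a x}) ∩ dualCone V (C ∩ {x | a x ≤ 0}) = dualCone V C := by
      ext w
      refine ⟨fun h => ⟨h.1.1, fun x hx => ?_⟩, fun h =>
        ⟨⟨h.1, fun x hx => h.2 x hx.1⟩, h.1, fun x hx => h.2 x hx.1⟩⟩
      rcases le_total 0 (a x) with hx' | hx'
      · exact h.1.2 x ⟨hx, hx'⟩
      · exact h.2.2 x ⟨hx, hx'⟩
    have h2 : dualCone V (C ∩ {x | 0 ≤ a x}) ∪ dualCone V (C ∩ {x | a x ≤ 0}) =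
        dualCone V (C ∩ {x | a x = 0}) := by
      apply Set.Subset.antisymm
      · rintro w (h | h)
        · exact ⟨h.1, fun x hx => h.2 x ⟨hx.1, hx.2.ge⟩⟩
        · exact ⟨h.1, fun x hx => h.2 x ⟨hx.1, hx.2.le⟩⟩
      · intro w hw
        by_contra h
        rw [Set.mem_union, not_or] at h
        have h3 : ∃ x ∈ C ∩ {x | 0 ≤ a x}, 0 < inner ℝ w x := by
          by_contra! h4
          exact h.1 ⟨hw.1, h4⟩
        have h4 : ∃ x ∈ C ∩ {x | a x ≤ 0}, 0 < inner ℝ w x := by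
          by_contra! h4
          exact h.2 ⟨hw.1, h4⟩
        obtain ⟨x, ⟨hx, hxa⟩, hwx⟩ := h3
        obtain ⟨y, ⟨hy, hya⟩, hwy⟩ := h4
        have hxa : 0 ≤ a x := hxa
        have hya : a y ≤ 0 := hya
        rcases hxa.eq_or_lt with hxa | hxa
        · exact hwx.not_ge (hw.2 x ⟨hx, hxa.symm⟩)
        -- If `w` were in neither dual, it would be positive at some x and y on opposite sides; this
        -- combination of them lies on the hyperplane, and `w` is positive there too.
        have h5 := hw.2 ((-a y) • x + a x • y)
          ⟨hC.add_mem (hC.smul_mem (neg_nonneg.2 hya) hx) (hC.smul_mem hxa.le hy), by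
            rw [Set.mem_ofPred_eq, map_add, map_smul, map_smul, smul_eq_mul, smul_eq_mul]; ring⟩
        rw [inner_add_right, inner_smul_right, inner_smul_right] at h5
        have h6 := mul_pos hxa hwy
        have h7 := mul_nonneg (neg_nonneg.2 hya) hwx.le
        linarith
    have h3 := F.map_union V _ _ (hnn.isConeIn_dualCone (Set.inter_subset_left.trans hCV))
      (hnp.isConeIn_dualCone (Set.inter_subset_left.trans hCV))
    rw [h1, h2] at h3
    rw [h3]
    ring
  congr C C' hC hC' h := by
    have hsub : ∀ C, IsConvexConeOrEmpty V C → C ∩ V = C := by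
      rintro C (rfl | hC)
      · exact Set.empty_inter _
      · exact Set.inter_eq_left.2 hC.2
    rw [hsub C hC, hsub C' hC'] at h
    rw [h]

theorem IsConvexConeOrEmpty.exists_sign {V : Submodule ℝ E} [FiniteDimensional ℝ V] {C : Set E}
    (hC : IsConvexConeOrEmpty V C) : ∃ S : Set (StrongDual ℝ E), S.Finite ∧ ∀ x ∈ (V : Set E),
      ∀ y ∈ (V : Set E), (∀ a ∈ S, SignType.sign (a x) = SignType.sign (a y)) → x ∈ C → y ∈ C := by
  rcases hC with rfl | ⟨hC, hCV⟩
  · exact ⟨∅, Set.finite_empty, fun _ _ _ _ _ h => h⟩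
  obtain ⟨S, hS, rfl⟩ := (hC.isPolyhedronIn hCV).exists_homogeneous hC.zero_mem
    fun c hc x hx => hC.smul_mem hc hx
  refine ⟨S, hS, fun x _ y hy h hx => ⟨hy, fun a ha => ?_⟩⟩
  rw [← sign_nonpos_iff, ← h a ha, sign_nonpos_iff]
  exact hx.2 a ha

open Classical in
/-- The valuation of cones that extends the values of `F` at the duals of the convex cones. -/
noncomputable def ConeMor.dualVal (F : ConeMor E k) (V : Submodule ℝ E) (P : Set E) : k :=
  if h : ∃ v, (P.indicator 1, v) ∈ extensionGraph (IsConvexConeOrEmpty V) (F.convexDual V) then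
    h.choose else 0

theorem ConeMor.dualVal_eq (F : ConeMor E k) {V : Submodule ℝ E} [FiniteDimensional ℝ V] {P : Set E}
    {v : k} (h : (P.indicator 1, v) ∈ extensionGraph (IsConvexConeOrEmpty V) (F.convexDual V)) :
    F.dualVal V P = v := by
  have h' : ∃ v, (P.indicator 1, v) ∈ extensionGraph (IsConvexConeOrEmpty V) (F.convexDual V) :=
    ⟨v, h⟩
  rw [ConeMor.dualVal, dif_pos h']
  exact extensionGraph_unique (isCutStable_isConvexConeOrEmpty V) V.convex
    (isCutAdditive_convexDual F V) (fun _ hC => hC.exists_sign) h'.choose_spec h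

theorem ConeMor.dualVal_mem (F : ConeMor E k) {V : Submodule ℝ E} {P : Set E} (hP : IsConeIn V P) :
    (P.indicator 1, F.dualVal V P) ∈ extensionGraph (IsConvexConeOrEmpty V) (F.convexDual V) := by
  have := hP.1
  obtain ⟨T, hT, hPT⟩ := hP.2.1
  have hP' : IsUnion (IsConvexConeOrEmpty V) P := ⟨T, fun C hC => Or.inr ⟨hT C hC,
    (Set.subset_sUnion_of_mem hC).trans (hPT ▸ hP.2.2)⟩, hPT⟩
  obtain ⟨v, hv⟩ := exists_mem_extensionGraph (k := k) (f := F.convexDual V)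
    (Or.inl rfl) (fun A B hA hB => hA.inter hB) hP'
  rwa [F.dualVal_eq hv]

theorem ConeMor.dualVal_convex (F : ConeMor E k) {V : Submodule ℝ E} [FiniteDimensional ℝ V]
    {C : Set E} (hC : IsConvexCone C) (hCV : C ⊆ V) :
    F.dualVal V C = F.toFun V (dualCone V C) := by
  rw [← F.convexDual_apply V hC]
  exact F.dualVal_eq (mem_extensionGraph (Or.inr ⟨hC, hCV⟩))

theorem ConeMor.dualVal_empty (F : ConeMor E k) {V : Submodule ℝ E} [FiniteDimensional ℝ V] :
    F.dualVal V ∅ = 0 := by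
  rw [← (isCutAdditive_convexDual F V).map_empty]
  exact F.dualVal_eq (mem_extensionGraph (Or.inl rfl))

theorem ConeMor.dualVal_union (F : ConeMor E k) {V : Submodule ℝ E} {P Q : Set E}
    (hP : IsConeIn V P) (hQ : IsConeIn V Q) :
    F.dualVal V (P ∪ Q) = F.dualVal V P + F.dualVal V Q - F.dualVal V (P ∩ Q) :=
  have := hP.1
  F.dualVal_eq (extensionGraph_union (F.dualVal_mem hP) (F.dualVal_mem hQ)
    (F.dualVal_mem (hP.inter hQ)))

theorem IsConeIn.isUnion_convexCone {V : Submodule ℝ E} {P : Set E} (hP : IsConeIn V P) :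
    IsUnion (fun C => IsConvexCone C ∧ C ⊆ (V : Set E)) P := by
  obtain ⟨T, hT, hPT⟩ := hP.2.1
  exact ⟨T, fun C hC => ⟨hT C hC, (Set.subset_sUnion_of_mem hC).trans (hPT ▸ hP.2.2)⟩, hPT⟩

theorem isConeIn_of_isUnion {V : Submodule ℝ E} [hV : FiniteDimensional ℝ V] {P : Set E}
    (hP : IsUnion (fun C => IsConvexCone C ∧ C ⊆ (V : Set E)) P) : IsConeIn V P := by
  obtain ⟨T, hT, rfl⟩ := hP
  exact ⟨hV, ⟨T, fun C hC => (hT C hC).1, rfl⟩, Set.sUnion_subset fun C hC => (hT C hC).2⟩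

/-- Valuations of the cones in `V` are determined by their values at the convex cones. -/
theorem valuation_eq_of_isConeIn {V : Submodule ℝ E} {f g : Set E → k} (h0 : f ∅ = g ∅)
    (hf : ∀ P Q, IsConeIn V P → IsConeIn V Q → f (P ∪ Q) = f P + f Q - f (P ∩ Q))
    (hg : ∀ P Q, IsConeIn V P → IsConeIn V Q → g (P ∪ Q) = g P + g Q - g (P ∩ Q))
    (heq : ∀ C, IsConvexCone C → C ⊆ V → f C = g C) {P : Set E} (hP : IsConeIn V P) : f P = g P :=
  have := hP.1
  valuation_eq_of_isUnion (𝒟 := fun C => IsConvexCone C ∧ C ⊆ (V : Set E))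
    (fun _ _ hA hB => ⟨hA.1.inter hB.1, Set.inter_subset_left.trans hA.2⟩) h0
    (fun _ _ hP hQ => hf _ _ (isConeIn_of_isUnion hP) (isConeIn_of_isUnion hQ))
    (fun _ _ hP hQ => hg _ _ (isConeIn_of_isUnion hP) (isConeIn_of_isUnion hQ))
    (fun C hC => heq C hC.1 hC.2) hP.isUnion_convexCone

theorem ConeMor.ext_of_isConvexCone {F G : ConeMor E k}
    (h : ∀ (V : Submodule ℝ E) (C : Set E), FiniteDimensional ℝ V → IsConvexCone C → C ⊆ V →
      F.toFun V C = G.toFun V C) : F = G :=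
  ConeMor.ext_of_isConeIn fun V _ hP => valuation_eq_of_isConeIn
    ((F.map_empty V hP.1).trans (G.map_empty V hP.1).symm) (F.map_union V) (G.map_union V)
    (fun C => h V C hP.1) hP

/-! ### Multiplicativity of the dual valuation, and the dual morphism. -/

theorem Submodule.IsOrtho.inter_add {V W : Submodule ℝ E} (hVW : V ⟂ W) {P P' Q : Set E}
    (hP : P ⊆ V) (hP' : P' ⊆ V) (hQ : Q ⊆ W) : (P ∩ P') + Q = (P + Q) ∩ (P' + Q) := by
  refine Set.inter_add_subset.antisymm ?_
  rintro _ ⟨⟨x, hx, y, hy, rfl⟩, x', hx', y', hy', heq⟩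
  obtain ⟨rfl, rfl⟩ := hVW.add_eq_add_iff (V.sub_mem (hP' hx') (hP hx))
    (W.sub_mem (hQ hy') (hQ hy)) heq
  exact ⟨_, ⟨hx, hx'⟩, _, hy, rfl⟩

theorem dualCone_add {V W : Submodule ℝ E} (hVW : V ⟂ W) {P Q : Set E} (hP : P ⊆ V) (hQ : Q ⊆ W)
    (hP0 : (0 : E) ∈ P) (hQ0 : (0 : E) ∈ Q) :
    dualCone (V ⊔ W) (P + Q) = dualCone V P + dualCone W Q := by
  have key : ∀ v ∈ V, ∀ w ∈ W, ∀ x ∈ P, ∀ y ∈ Q,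
      inner ℝ (v + w) (x + y) = inner ℝ v x + inner ℝ w y := by
    intro v hv w hw x hx y hy
    rw [inner_add_left, inner_add_right, inner_add_right, hVW.inner_eq hv (hQ hy),
      hVW.symm.inner_eq hw (hP hx), add_zero, zero_add]
  ext z
  constructor
  · rintro ⟨hz, h⟩
    obtain ⟨v, hv, w, hw, rfl⟩ := Submodule.mem_sup.1 hz
    refine ⟨v, ⟨hv, fun x hx => ?_⟩, w, ⟨hw, fun y hy => ?_⟩, rfl⟩
    · have := h _ (Set.add_mem_add hx hQ0)
      rwa [key v hv w hw x hx 0 hQ0, inner_zero_right, add_zero] at this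
    · have := h _ (Set.add_mem_add hP0 hy)
      rwa [key v hv w hw 0 hP0 y hy, inner_zero_right, zero_add] at this
  · rintro ⟨v, hv, w, hw, rfl⟩
    refine ⟨Submodule.add_mem_sup hv.1 hw.1, ?_⟩
    rintro _ ⟨x, hx, y, hy, rfl⟩
    rw [key v hv.1 w hw.1 x hx y hy]
    exact add_nonpos (hv.2 x hx) (hw.2 y hy)

/-- For convex factors the dual of a product is the product of the duals. Each side is a valuation
in each factor separately, so the convex case extends one factor at a time. -/
theorem ConeMor.dualVal_add (F : ConeMor E k) {V W : Submodule ℝ E} (hVW : V ⟂ W) {P Q : Set E}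
    (hP : IsConeIn V P) (hQ : IsConeIn W Q) :
    F.dualVal (V ⊔ W) (P + Q) = F.dualVal V P * F.dualVal W Q := by
  have := hP.1
  have := hQ.1
  have h1 : ∀ {C D : Set E}, IsConvexCone C → C ⊆ V → IsConvexCone D → D ⊆ W →
      F.dualVal (V ⊔ W) (C + D) = F.dualVal V C * F.dualVal W D := by
    intro C D hC hCV hD hDW
    rw [F.dualVal_convex hC hCV, F.dualVal_convex hD hDW, F.dualVal_convex (hC.add hD) (by
      rw [Submodule.coe_sup]; exact Set.add_subset_add hCV hDW), dualCone_add hVW hCV hDW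
      hC.zero_mem hD.zero_mem]
    exact F.map_prod V W _ _ hVW (hC.isConeIn_dualCone hCV) (hD.isConeIn_dualCone hDW)
  have h2 : ∀ {D : Set E}, IsConvexCone D → D ⊆ W →
      F.dualVal (V ⊔ W) (P + D) = F.dualVal V P * F.dualVal W D := by
    intro D hD hDW
    refine valuation_eq_of_isConeIn (f := fun P => F.dualVal (V ⊔ W) (P + D))
      (g := fun P => F.dualVal V P * F.dualVal W D) ?_ (fun A B hA hB => ?_) (fun A B hA hB => ?_)
      (fun C hC hCV => h1 hC hCV hD hDW) hP
    · simp [F.dualVal_empty]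
    · rw [Set.union_add, hVW.inter_add hA.2.2 hB.2.2 hDW]
      exact F.dualVal_union (hA.add (hD.isConeIn hDW)) (hB.add (hD.isConeIn hDW))
    · rw [F.dualVal_union hA hB]
      ring
  refine valuation_eq_of_isConeIn (f := fun Q => F.dualVal (V ⊔ W) (P + Q))
    (g := fun Q => F.dualVal V P * F.dualVal W Q) ?_ (fun A B hA hB => ?_) (fun A B hA hB => ?_)
    (fun D hD hDW => h2 hD hDW) hQ
  · simp [F.dualVal_empty]
  · rw [Set.add_union, add_comm P (A ∩ B), hVW.symm.inter_add hA.2.2 hB.2.2 hP.2.2, add_comm A P,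
      add_comm B P]
    exact F.dualVal_union (hP.add hA) (hP.add hB)
  · rw [F.dualVal_union hA hB]
    ring

theorem ConeMor.isValFam_dualVal (F : ConeMor E k) : IsValFam IsConvexCone F.dualVal where
  map_empty _ _ := F.dualVal_empty
  map_union _ _ _ hV hA hB h := F.dualVal_union
    ⟨hV, hA, IsCone.vectorSpan_le_iff hA |>.1 ((vectorSpan_mono ℝ Set.subset_union_left).trans h)⟩
    ⟨hV, hB, IsCone.vectorSpan_le_iff hB |>.1 ((vectorSpan_mono ℝ Set.subset_union_right).trans h)⟩
  map_prod _ _ _ _ hVW hV hW hA hB hAV hBW := F.dualVal_add hVW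
    ⟨hV, hA, IsCone.vectorSpan_le_iff hA |>.1 hAV⟩ ⟨hW, hB, IsCone.vectorSpan_le_iff hB |>.1 hBW⟩

theorem dualCone_zero (V : Submodule ℝ E) : dualCone V {0} = V := by
  ext w
  simp [dualCone]

theorem dualCone_self (V : Submodule ℝ E) : dualCone V V = {0} := by
  ext w
  rw [Set.mem_singleton_iff]
  constructor
  · rintro ⟨hw, h⟩
    exact real_inner_self_nonpos.1 (h w hw)
  · rintro rfl
    exact ⟨V.zero_mem, by simp⟩

/-- The morphism whose values at the convex cones are the values of `F` at their duals. -/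
noncomputable def ConeMor.dual (F : ConeMor E k) : ConeMor E k :=
  ConeMor.ofValFam F.dualVal F.isValFam_dualVal (by
    rw [F.dualVal_convex isConvexCone_zero (by simp), dualCone_zero, Submodule.bot_coe, F.map_zero])

theorem ConeMor.dual_apply (F : ConeMor E k) {V : Submodule ℝ E} [FiniteDimensional ℝ V] {C : Set E}
    (hC : IsConvexCone C) (hCV : C ⊆ V) : F.dual.toFun V C = F.toFun V (dualCone V C) :=
  (ConeMor.ofValFam_apply _ _ (hC.isConeIn hCV)).trans (F.dualVal_convex hC hCV)

theorem ConeMor.source_dual (F : ConeMor E k) : F.dual.source = F.target :=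
  VectObj.ext_of_finiteDimensional fun V _ =>
    (F.dual_apply (isConvexCone_submodule V) subset_rfl).trans <| by rw [dualCone_self]; rfl

theorem ConeMor.target_dual (F : ConeMor E k) : F.dual.target = F.source :=
  VectObj.ext_of_finiteDimensional fun V _ =>
    (F.dual_apply isConvexCone_zero (by simp)).trans <| by rw [dualCone_zero]; rfl

theorem ConeMor.dual_dual (F : ConeMor E k) : F.dual.dual = F :=
  ConeMor.ext_of_isConvexCone fun V C _ hC hCV => by
    rw [F.dual.dual_apply hC hCV, F.dual_apply (hC.dual hCV) (dualCone_subset V C),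
      hC.dualCone_dualCone hCV]

/-! ### The dual morphism is the inverse -/

section Nearest

variable {V : Submodule ℝ E} {K : Finset (Set E)} {P σ : Set E} {x : E}

/-- The σ^⊥ part of z - y is in the normal cone, and `w` is orthogonal to the rest. So `y` is the
nearest point of `P` to y + w. -/
theorem inner_le_zero_of_mem_dualCone_normalCone [FiniteDimensional ℝ V] (hK : IsComplex K)
    (hP : Adapted K P) (hPV : vectorSpan ℝ P ≤ V) (hσ : σ ∈ K) (hσP : σ ⊆ P) (hPc : Convex ℝ P)
    (hx : x ∈ relCore σ) {w : E} (hw : w ∈ dualCone (perpIn V σ) (normalCone V P σ x))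
    {y z : E} (hy : y ∈ σ) (hz : z ∈ P) : inner ℝ w (z - y) ≤ 0 := by
  have hfd := (hK.poly σ hσ).finiteDimensional
  have hxP := hσP hx.1
  have h1 : z - y ∈ V := hPV (sub_mem_vectorSpan hz (hσP hy))
  have h2 : z - x ∈ tangent P x :=
    (hPc.mem_tangent_iff hxP).2 ⟨1, one_pos, by rwa [one_smul, add_sub_cancel]⟩
  rw [← Submodule.sup_orthogonal_inf_of_hasOrthogonalProjection
    ((vectorSpan_mono ℝ hσP).trans hPV)] at h1
  obtain ⟨s, hs, q, hq, hsq⟩ := Submodule.mem_sup.1 h1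
  have h3 : q ∈ normalCone V P σ x := by
    refine ⟨⟨hq.2, hq.1⟩, ?_⟩
    have h4 := hP.tangent_add_mem hK hσ hx h2
      (Submodule.sub_mem _ (sub_mem_vectorSpan hx.1 hy) hs)
    rw [← add_sub_assoc, sub_add_sub_cancel, ← hsq, add_sub_cancel_left] at h4
    exact h4
  rw [← hsq, inner_add_right, (perpIn_isOrtho V σ).inner_eq hw.1 hs, zero_add]
  exact hw.2 q h3

/-- The form ⟨w, ·⟩ is maximal over `σ` at the interior point `y`, hence constant on `σ`, so `w` is
orthogonal to ⟨σ⟩. -/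
theorem mem_dualCone_normalCone (hσP : σ ⊆ P) (hx : x ∈ relCore σ)
    {y w : E} (hy : y ∈ relCore σ) (hwV : w ∈ V) (hw : ∀ z ∈ P, inner ℝ w (z - y) ≤ 0) :
    w ∈ dualCone (perpIn V σ) (normalCone V P σ x) := by
  have h1 : ∀ z ∈ σ, inner ℝ w (z - y) = 0 := by
    intro z hz
    obtain ⟨ε, hε, hm⟩ := hy.2 z hz
    have h2 := hw _ (hσP hm)
    rw [add_sub_cancel_left, inner_smul_right, ← neg_sub z y, inner_neg_right] at h2
    exact le_antisymm (hw z (hσP hz)) (neg_nonpos.1 (nonpos_of_mul_nonpos_right h2 hε))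
  have h2 : w ∈ (vectorSpan ℝ σ)ᗮ := by
    have h3 : vectorSpan ℝ σ ≤ (ℝ ∙ w)ᗮ := by
      refine vectorSpan_le_iff.2 fun z hz z' hz' => ?_
      rw [Submodule.mem_orthogonal_singleton_iff_inner_right, ← sub_sub_sub_cancel_right z z' y,
        inner_sub_right, h1 z hz, h1 z' hz', sub_zero]
    rw [Submodule.mem_orthogonal']
    exact fun z hz => Submodule.mem_orthogonal_singleton_iff_inner_right.1 (h3 hz)
  refine ⟨⟨hwV, h2⟩, fun q hq => ?_⟩
  obtain ⟨t, h3, ht⟩ := ((mem_tangent.1 hq.2).and self_mem_nhdsWithin).exists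
  have ht : 0 < t := ht
  have h4 := hw _ h3
  rw [add_sub_right_comm, inner_add_right, h1 x hx.1, zero_add, inner_smul_right] at h4
  exact nonpos_of_mul_nonpos_right h4 ht

/-- The variational inequality characterizes the nearest point `s` of `P` to `y`. -/
theorem exists_inner_le_zero [FiniteDimensional ℝ V] (hPc : Convex ℝ P) (hPcl : IsClosed P)
    (hne : P.Nonempty) (hPV : P ⊆ V) {y : E} (hy : y ∈ V) :
    ∃ s ∈ P, ∀ z ∈ P, inner ℝ (y - s) (z - s) ≤ 0 := by
  have hc : Convex ℝ (V.subtype ⁻¹' P) := hPc.linear_preimage V.subtype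
  have hcl : IsClosed (V.subtype ⁻¹' P) := hPcl.preimage continuous_subtype_val
  have : CompleteSpace V := FiniteDimensional.complete ℝ V
  obtain ⟨p, hp⟩ := hne
  obtain ⟨s, hs, hmin⟩ := exists_norm_eq_iInf_of_complete_convex
    (K := V.subtype ⁻¹' P) ⟨⟨p, hPV hp⟩, hp⟩ hcl.isComplete hc ⟨y, hy⟩
  refine ⟨s, hs, fun z hz => ?_⟩
  exact (norm_eq_iInf_iff_real_inner_le_zero hc hs).1 hmin ⟨z, hPV hz⟩ hz

end Nearest

/-- By multiplicativity each term is F_V(N σ + σ) - F_V(N σ + ∂σ), the value at the open tile of the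
points of V whose nearest point in P is interior to σ. The closed tiles cover V and behave like
cells indexed by the σ, so the terms add up to F_V(V). -/
theorem starVal_dual_left (F : ConeMor E k) {V : Submodule ℝ E} [FiniteDimensional ℝ V] {P : Set E}
    (hP : IsConvexCone P) (hPV : P ⊆ V) :
    starVal IsConvexCone F.dual.toFun F.toFun V P = F.toFun V V := by
  classical
  obtain ⟨K, b, hK, had⟩ := isCellKind_convexCone.exists_pointed (P := fun _ : Unit => P)
    fun _ => isUnion_of_cell hP
  have hPK := had ()
  have hKc := hK.toIsComplex
  have hspan := vectorSpan_le_of_subset hPV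
  have hPc := hP.isPolyhedron.convex
  rw [starVal_eq isCellKind_convexCone F.isValFam
    (fun W _ => ConeMor.apply_self_eq F.source_dual W) hspan hK hPK, starOn]
  set N : Set E → Set E := fun σ => dualCone (perpIn V σ) (normalCone V P σ (b σ)) with hN
  have hσ : ∀ σ ∈ below K P, σ ∈ K ∧ σ ⊆ P ∧ vectorSpan ℝ σ ≤ V ∧ b σ ∈ relCore σ := by
    intro σ hσ
    obtain ⟨hσK, hσP⟩ := mem_below.1 hσ
    exact ⟨hσK, hσP, (vectorSpan_mono ℝ hσP).trans hspan, hK.base σ hσK⟩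
  have hcone : ∀ σ ∈ below K P, ∀ A, IsConeIn (vectorSpan ℝ σ) A →
      IsConeIn V (N σ + A) ∧ F.toFun V (N σ + A) =
        F.dual.toFun (perpIn V σ) (normalCone V P σ (b σ)) * F.toFun (vectorSpan ℝ σ) A := by
    intro σ hσ' A hA
    obtain ⟨hσK, hσP, hσV, hb⟩ := hσ σ hσ'
    have hfd := finiteDimensional_perpIn V σ
    have hfd2 := hA.1
    have hν : IsConvexCone (normalCone V P σ (b σ)) :=
      isConvexCone_inter_tangent hP.isPolyhedron (hσP hb.1) _
    have hνV : normalCone V P σ (b σ) ⊆ perpIn V σ := fun w hw => hw.1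
    have h1 := hν.isConeIn_dualCone hνV
    have h2 : perpIn V σ ⊔ vectorSpan ℝ σ = V := by
      rw [sup_comm, perpIn, Submodule.sup_inf_orthogonal hσV]
    have h3 := h1.add hA
    have h4 := F.map_prod _ _ _ _ (perpIn_isOrtho V σ) h1 hA
    rw [h2] at h3 h4
    exact ⟨h3, by rw [h4, F.dual_apply hν hνV]⟩
  have hcell : ∀ σ ∈ below K P, IsConeIn (vectorSpan ℝ σ) σ := fun σ hσ' =>
    have hk := (hK.kind σ (hσ σ hσ').1)
    ⟨hk.isPolyhedron.finiteDimensional, hk.isCone, hk.isCone.vectorSpan_le_iff.1 le_rfl⟩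
  have hbd : ∀ σ ∈ below K P, IsConeIn (vectorSpan ℝ σ) (σ \ relCore σ) := fun σ hσ' =>
    ⟨(hcell σ hσ').1, (hK.adapted_boundary (hσ σ hσ').1).isUnion hK.kind,
      Set.sdiff_subset.trans (hcell σ hσ').2.2⟩
  have hproj : ∀ σ ∈ below K P, ∀ n ∈ N σ, ∀ s ∈ σ, ∀ z ∈ P, inner ℝ n (z - s) ≤ 0 := by
    intro σ hσ' n hn s hs z hz
    obtain ⟨hσK, hσP, hσV, hb⟩ := hσ σ hσ'
    exact inner_le_zero_of_mem_dualCone_normalCone hKc hPK hspan hσK hσP hPc hb hn hs hz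
  have hmem : ∀ σ ∈ below K P, ∀ s ∈ relCore σ, ∀ n ∈ V, (∀ z ∈ P, inner ℝ n (z - s) ≤ 0) →
      n ∈ N σ := by
    intro σ hσ' s hs n hn h
    obtain ⟨hσK, hσP, hσV, hb⟩ := hσ σ hσ'
    exact mem_dualCone_normalCone hσP hb hs hn h
  have hunion : (⋃ σ ∈ below K P, (N σ + σ)) = V := by
    apply Set.Subset.antisymm
    · exact Set.iUnion₂_subset fun σ hσ' => (hcone σ hσ' σ (hcell σ hσ')).1.2.2
    · intro y hy
      -- The tile through `y` belongs to the open cell that contains the nearest point of `y`.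
      obtain ⟨s, hs, hsy⟩ := exists_inner_le_zero hPc hP.isPolyhedron.isClosed hP.nonempty hPV hy
      obtain ⟨σ, hσK, hsσ⟩ := hPK.exists_mem_relCore s hs
      have hσb := mem_below.2 ⟨hσK, hPK.subset σ hσK s hsσ hs⟩
      exact Set.mem_iUnion₂.2 ⟨σ, hσb, y - s, hmem σ hσb s hsσ _ (V.sub_mem hy (hPV hs)) hsy, s,
        hsσ.1, sub_add_cancel y s⟩
  have hiU : ∀ L ⊆ below K P, IsConeIn V (⋃ τ ∈ L, (N τ + τ)) := by
    intro L
    induction L using Finset.induction_on with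
    | empty => intro _; simpa using isConeIn_empty V
    | insert τ L _ ih =>
      intro hL
      rw [Finset.set_biUnion_insert]
      have hτ := hL (Finset.mem_insert_self τ L)
      exact (hcone τ hτ τ (hcell τ hτ)).1.union
        (ih ((Finset.subset_insert τ L).trans hL))
  have hval := valuation_biUnion_eq_sum (f := F.toFun V) (K := below K P) (A := fun σ => N σ + σ)
    (B := fun σ => N σ + σ \ relCore σ) (F.map_empty V inferInstance)
    (fun L hL σ hσ' => F.map_union V _ _ (hcone σ hσ' σ (hcell σ hσ')).1 (hiU L hL)) ?_ ?_
  · rw [← hunion, hval]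
    refine Finset.sum_congr rfl fun σ hσ' => ?_
    rw [(hcone σ hσ' σ (hcell σ hσ')).2, (hcone σ hσ' _ (hbd σ hσ')).2, openVal, mul_sub]
  · rintro σ hσ' τ hτ' hστ _ ⟨⟨n, hn, s, hs, rfl⟩, n', hn', t, ht, heq⟩
    have heq : n' + t = n + s := heq
    have h1 := hproj σ hσ' n hn s hs t ((hσ τ hτ').2.1 ht)
    have h2 := hproj τ hτ' n' hn' t ht s ((hσ σ hσ').2.1 hs)
    -- A point common to two tiles has the same nearest point in both. That point cannot be interior
    -- to σ unless σ ⊆ τ.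
    have hst : s = t := by
      have h3 : n' = n + (s - t) := by rw [← add_sub_assoc, ← heq, add_sub_cancel_right]
      rw [h3, inner_add_left] at h2
      rw [← neg_sub s t, inner_neg_right] at h1
      have h4 : inner ℝ (s - t) (s - t) ≤ 0 := by linarith
      exact sub_eq_zero.1 (real_inner_self_nonpos.1 h4)
    subst hst
    refine ⟨n, hn, s, ⟨hs, fun hc => hστ ?_⟩, rfl⟩
    exact hKc.subset σ (hσ σ hσ').1 τ (hσ τ hτ').1 s hc ht
  · rintro σ hσ' _ ⟨n, hn, s, hs, rfl⟩
    refine ⟨⟨n, hn, s, hs.1, rfl⟩, ?_⟩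
    -- The boundary point `s` is interior to a smaller cell `τ`, and `n` is normal to P at `s`, so
    -- the point lies in the tile of `τ`.
    obtain ⟨τ, hτK, hsτ⟩ := hKc.exists_mem_relCore σ (hσ σ hσ').1 s hs.1
    have hτσ := hKc.subset τ hτK σ (hσ σ hσ').1 s hsτ hs.1
    have hτ' : τ ∈ below K P := mem_below.2 ⟨hτK, hτσ.trans (hσ σ hσ').2.1⟩
    refine ⟨τ, hτ', hτσ.ssubset_of_ne (fun h => hs.2 (h ▸ hsτ)), n, ?_, s, hsτ.1, rfl⟩
    exact hmem τ hτ' s hsτ n hn.1.1 fun z hz => hproj σ hσ' n hn s hs.1 z hz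

theorem ConeMor.dual_star (F : ConeMor E k) : F.dual.star F F.source_dual = ConeMor.one F.source :=
  ConeMor.ext_of_isConvexCone fun V C _ hC hCV => by
    rw [ConeMor.star_apply _ (hC.isConeIn hCV), starVal_dual_left F hC hCV,
      ConeMor.one_apply _ (hC.isConeIn hCV) hC.nonempty]
    rfl

/-- This is the left inverse law for `F.dual`, whose dual is `F`. -/
theorem ConeMor.star_dual (F : ConeMor E k) :
    F.star F.dual F.target_dual.symm = ConeMor.one F.target := by
  have h := F.dual.dual_star
  rw [F.source_dual] at h
  rw [← h]
  congr 1
  exact F.dual_dual.symm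

end Duality

/-! ### The groupoid -/

section Groupoid

variable {E : Type u} [NormedAddCommGroup E] [InnerProductSpace ℝ E] {k : Type v} [CommRing k]

theorem IsConeStar.unique {F G H H' : ConeMor E k} (h : IsConeStar F G H)
    (h' : IsConeStar F G H') : H = H' :=
  ConeMor.ext_of_isConeIn fun V P hP => by
    obtain ⟨K, b, hK, hb⟩ := isCellKind_convexCone.exists_isCellStructure hP.isUnion
    rw [h V P hP K b hK hb, h' V P hP K b hK hb]

theorem IsPolyStar.unique {F : ConeMor E k} {G H H' : PolyInv E k} (h : IsPolyStar F G H)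
    (h' : IsPolyStar F G H') : H = H' :=
  PolyInv.ext_of_isPolytopeIn fun V P hP => by
    obtain ⟨K, b, hK, hb⟩ := isCellKind_convexPolytope.exists_isCellStructure hP.isUnion
    rw [h V P hP K b hK hb, h' V P hP K b hK hb]

theorem HomSet.comp_eq {A B C : VectObj E k} (F : HomSet B C) (G : HomSet A B) :
    F.1.source = G.1.target := F.2.1.trans G.2.2.symm

/-- The groupoid of the objects and morphisms, with the star product as composition. -/
@[reducible] noncomputable def starGroupoid : Groupoid.{max u v} (VectObj E k) where
  Hom A B := HomSet A B
  id A := ⟨ConeMor.one A, ConeMor.source_one A, ConeMor.target_one A⟩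
  -- Categorical composition is written in diagram order, so the star product reverses it, and the
  -- left unit law of the category is the right unit law of the star product.
  comp G F := ⟨F.1.star G.1 (HomSet.comp_eq F G), (ConeMor.source_star _).trans G.2.1,
    (ConeMor.target_star _).trans F.2.2⟩
  id_comp F := Subtype.ext
    (ConeMor.star_one (F.2.1.trans (ConeMor.target_one _).symm))
  comp_id F := Subtype.ext
    (ConeMor.one_star ((ConeMor.source_one _).trans F.2.2.symm))
  assoc H G F := Subtype.ext (ConeMor.star_assoc (HomSet.comp_eq F G) (HomSet.comp_eq G H)).symm
  inv F := ⟨F.1.dual, F.1.source_dual.trans F.2.2, F.1.target_dual.trans F.2.1⟩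
  inv_comp F := Subtype.ext (F.1.star_dual.trans (congrArg ConeMor.one F.2.2))
  comp_inv F := Subtype.ext (F.1.dual_star.trans (congrArg ConeMor.one F.2.1))

/-- The action of a morphism on the polytope invariants located at its source. -/
noncomputable def HomSet.act {A B : VectObj E k} (F : HomSet A B) (G : LocatedAt (k := k) A) :
    LocatedAt (k := k) B :=
  ⟨F.1.act G.1 (F.2.1.trans G.2.symm), (ConeMor.location_act _).trans F.2.2⟩

end Groupoid

theorem mainTheorem1 {E : Type u} [NormedAddCommGroup E] [InnerProductSpace ℝ E]
    (hE : Module.rank ℝ E = Cardinal.aleph0) {k : Type v} [CommRing k] :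
    -- every cone and every polytope has a cell structure, with points in the interiors of its cells
    (∀ P : Set E, IsCone P → ∃ K b, IsConicalCellStructure K P ∧ IsBasePoint K b) ∧
    (∀ P : Set E, IsPolytope P → ∃ K b, IsPolytopeCellStructure K P ∧ IsBasePoint K b) ∧
    -- the star product is well defined on composable pairs
    (∀ F G : ConeMor E k, F.source = G.target → ∃! H : ConeMor E k, IsConeStar F G H) ∧
    (∀ (F : ConeMor E k) (G : PolyInv E k), F.source = G.location →
      ∃! H : PolyInv E k, IsPolyStar F G H) ∧
    -- the groupoid
    ∃ (𝒢 : Groupoid.{max u v} (VectObj E k)) (hom : ∀ A B : VectObj E k, (A ⟶ B) ≃ HomSet A B),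
      -- composition is the star product
      (∀ (A B C : VectObj E k) (G : A ⟶ B) (F : B ⟶ C),
        IsConeStar (hom B C F).1 (hom A B G).1 (hom A C (G ≫ F)).1) ∧
      -- the identity of `A` is `A • ε`
      (∀ (A : VectObj E k) (V : Submodule ℝ E) (P : Set E), IsConeIn V P → P.Nonempty →
        (hom A A (𝟙 A)).1.toFun V P = A.toFun V) ∧
      -- the inverse is given by duality of convex cones
      (∀ (A B : VectObj E k) (F : A ⟶ B) (V : Submodule ℝ E) (P : Set E), IsConeIn V P →
        IsConvexCone P →
        (hom B A (Groupoid.inv F)).1.toFun V P = (hom A B F).1.toFun V (dualCone V P)) ∧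
      -- the star product with polytope invariants is an action of the groupoid
      ∃ act : ∀ A B : VectObj E k, (A ⟶ B) → LocatedAt (k := k) A → LocatedAt (k := k) B,
        (∀ (A B : VectObj E k) (F : A ⟶ B) (G : LocatedAt A),
          IsPolyStar (hom A B F).1 G.1 (act A B F G).1) ∧
        (∀ (A : VectObj E k) (G : LocatedAt A), act A A (𝟙 A) G = G) ∧
        (∀ (A B C : VectObj E k) (G : A ⟶ B) (F : B ⟶ C) (H : LocatedAt A),
          act A C (G ≫ F) H = act B C F (act A B G H)) := by

  refine ⟨fun P hP => isCellKind_convexCone.exists_isCellStructure hP,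
    fun P hP => isCellKind_convexPolytope.exists_isCellStructure hP,
    fun F G h => ⟨F.star G h, ConeMor.isConeStar_star h, fun H hH =>
      hH.unique (ConeMor.isConeStar_star h)⟩,
    fun F G h => ⟨F.act G h, ConeMor.isPolyStar_act h, fun H hH =>
      hH.unique (ConeMor.isPolyStar_act h)⟩,
    starGroupoid, fun A B => Equiv.refl (HomSet A B), ?_, ?_, ?_,
    fun A B (F : HomSet A B) G => F.act G, ?_, ?_, ?_⟩
  · exact fun A B C G F => ConeMor.isConeStar_star (HomSet.comp_eq F G)
  · exact fun A V P hP hP0 => ConeMor.one_apply A hP hP0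
  · intro A B F V P hP hPc
    have := hP.1
    exact ConeMor.dual_apply F.1 hPc hP.2.2
  · exact fun A B F G => ConeMor.isPolyStar_act (F.2.1.trans G.2.symm)
  · exact fun A G => Subtype.ext (ConeMor.one_act ((ConeMor.source_one A).trans G.2.symm))
  · exact fun A B C G F H =>
      Subtype.ext (ConeMor.star_act (HomSet.comp_eq F G) (G.2.1.trans H.2.symm))
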